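/- Let $n\ge 1$. **Diagrams.** The maximal shape of type $(D_n,n)$ is the staircase with boxes $(a,b)$, $1\le a<b\le n$. Box $(a,b)$ is in row $a$ (rows numbered $1,2,\dots$ from top to bottom) and in the column labelled $b$ (columns labelled $n,n-1,\dots,2$ from left to right), so row $a$ has $n-a$ boxes. A $\oplus$-diagram $D$ is a filling of the boxes by $0$ and $+$. Let $W$ be the Weyl group of type $D_n$, acting as signed permutations of $\{\pm1,\dots,\pm n\}$, generated by $s_i=(n-i,\,n-i+1)(-(n-i),\,-(n-i+1))$ for $1\le i\le n-1$ and $s_n=(1,-2)(2,-1)$ (there are no boxes if $n=1$). The box $(a,b)$ has simple label $n-(b-a)$ if $b>a+1$; the box $(a,a+1)$ has simple label $n$ if $n-1-a$ is even and $n-1$ otherwise. Reading the boxes row by row from top to bottom, and from right to left within each row, gives a word $s_{i_1}\cdots s_{i_N}$, $N=\binom n2$. Replace each factor coming from a box with a $+$ by $1$, and let $v_{(j)}$ be the product of the first $j$ factors of the resulting subexpression. $D$ is a *Le-diagram* if the subexpression is positive distinguished: $v_{(j-1)}<v_{(j-1)}s_{i_j}$ in Bruhat order for all $j=1,\dots,N$.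 Let $\mathcal D_n$ be the set of Le-diagrams of maximal shape. **Preference functions.** A preference function of length $n$ is a word of length $n$ whose set of letters is $\{1,\dots,k\}$ for some $k\le n$. It is *atomic* if there is no $j<k$ for which some proper nonempty leading subword consists exactly of all the occurrences in the word of the letters $1,\dots,j$. Let $\mathcal A_n$ be the set of atomic preference functions of length $n$. **The map $\Phi$.** Given $D$, add diagonal boxes $(a,a)$, $1\le a\le n$, filled with $*$. Turn every $+$ and every $*$ into an elbow (joining west to north, and south to east) and every $0$ into a crossing. Let $|\pi(i)|$ be the label of the column in which the wire entering from the west in row $i$ leaves through the north border, and let $\pi(i)>0$ if and only if $i\le n-1$ and row $i$ of $D$ is filled with $0$'s. Put $\Phi(D)=\alpha(\pi)$, where $p=\alpha(\pi)$ is the following word of length $n$. Let $I^+=\{i:\pi(i)>0\}$ and $I^++1=\{i+1:i\in I^+\}$. Take the sequence of negative entries of $\pi$, forget signs, standardize it to a permutation of $\{1,\dots,m\}$, and put its entries in order into the positions $k\in\{1,\dots,n\}\setminus(I^++1)$ of $p$; then for $i\in I^+$ in increasing order set $p_{i+1}=p_{\pi(i)}$. **The map $\Psi$.** Given $f\in\mathcal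 A_n$, let $w=\alpha^{-1}(f)$: for $i<n$ such that position $i+1$ of $f$ is not the first occurrence of its letter, $w(i)$ is the closest position to the left of $i+1$ carrying the same letter; the numbers in $\{1,\dots,n\}$ not used in this way are placed, with negative signs, in the remaining positions of $w$ in the same relative order as the first occurrences of letters in $f$. Let $i^*=|w|^{-1}(i)$. Starting from the empty staircase $D_{n+1}$, construct $D_n,D_{n-1},\dots,D_1$, where $D_i$ is obtained from $D_{i+1}$ by adding a path $P_i$ from the north border label $i$ to the west border label $i^*$. The new $+$'s of $P_i$ are found as follows. Start with $(a,b)=(0,i)$ and repeat the following. Let $a'$ be the highest row with $a<a'<b$ containing a $+$ of $D_{i+1}$, and $c^*=(a',b')$ the rightmost $+$ of $D_{i+1}$ in row $a'$ ($c^*$ may fail to exist). A row is complete if all its boxes are filled in $D_{i+1}$. Apply the first case that holds. (Z) All rows below row $a$ are complete; or $c^*$ does not exist and $i^*\ge b$; or $c^*=(i^*,b)$; or $c^*$ exists, $i^*>a'$ and all rows from $a'$ on downwards are complete: stop. (A) $c^*$ exists and $i^*<a'$, or $c^*$ does not exist and $i^*<b$: put a new $+$ in $(i^*,b)$ and stop.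 (B) $i^*=b$, and either $w(i^*)>0$ or row $b$ of $D_{i+1}$ is filled with $0$'s: stop. (C) $i^*>b$, $w(b)<0$ and row $b$ of $D_{i+1}$ is filled with $0$'s apart from exactly one box: put a new $+$ in $(b,b')$ and stop. (D) Otherwise put a new $+$ in $(a',b)$, replace $(a,b)$ by $c^*=(a',b')$ and repeat. Then $P_i$ is the path that starts at the top of column $i$ heading south, turns (from south to west, or from west to south) at every $+$, old or new, and at diagonal boxes, and goes straight through all other boxes; the empty boxes it visits are filled with $0$'s. Put $\Psi(f)=D_1$. **Theorem.** For every $n\ge1$, $\Phi$ restricts to a bijection $\mathcal D_n\to\mathcal A_n$, $\Psi$ is a bijection $\mathcal A_n\to\mathcal D_n$, and the two are inverse to each other. Consequently $|\mathcal D_n|=a_n$, where $(a_n)_{n\ge1}=1,2,8,48,368,\dots$ is OEIS sequence A095989, the INVERTi transform of the ordered Bell numbers: with $B_0=1$ and $B_m=\sum_{k=0}^{m-1}\binom mk B_k$ for $m\ge1$, the $a_n$ are determined by $B_n=\sum_{k=1}^{n}a_kB_{n-k}$ for all $n\ge1$. -/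

import Mathlib

/-  The Weyl group of type `D_n` -/

/-- The simple reflection `s_i` (`1 ≤ i ≤ n`) of the Weyl group of type `D_n`, acting on the letters
`±1, …, ±n` as a signed permutation: `s_n` is `(1,-2)(2,-1)`, and for `1 ≤ i ≤ n - 1` the reflection
`s_i` is `(n-i, n-i+1)(-(n-i), -(n-i+1))`. (For `n ≥ 2`; there are no boxes, so no simple reflection
is ever used, if `n ≤ 1`.) -/
def simpleD (n i : ℕ) : Equiv.Perm ℤ :=
  if i = n then Equiv.swap 1 (-2) * Equiv.swap 2 (-1)
  else Equiv.swap ((n : ℤ) - i) ((n : ℤ) - i + 1) * Equiv.swap (-((n : ℤ) - i)) (-((n : ℤ) - i + 1))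

/-- The Weyl group of type `D_n`: the group generated by `s_1, …, s_n`. -/
def weylD (n : ℕ) : Subgroup (Equiv.Perm ℤ) :=
  Subgroup.closure (simpleD n '' Set.Icc 1 n)

/-- Coxeter length: the least number of factors in an expression in `s_1, …, s_n`. -/
noncomputable def lengthD (n : ℕ) (w : Equiv.Perm ℤ) : ℕ :=
  sInf {k | ∃ l : List ℕ, (∀ i ∈ l, 1 ≤ i ∧ i ≤ n) ∧ l.length = k ∧ (l.map (simpleD n)).prod = w}

/-- Reflections: the conjugates of the simple reflections. -/
def IsReflectionD (n : ℕ) (t : Equiv.Perm ℤ) : Prop :=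
  ∃ g ∈ weylD n, ∃ i ∈ Set.Icc 1 n, t = g * simpleD n i * g⁻¹

/-- The strict (strong) Bruhat order: the transitive closure of `u < u t` for reflections `t` with
`ℓ(u) < ℓ(u t)`. -/
def BruhatLTD (n : ℕ) : Equiv.Perm ℤ → Equiv.Perm ℤ → Prop :=
  Relation.TransGen fun u v => ∃ t, IsReflectionD n t ∧ v = u * t ∧ lengthD n u < lengthD n v

/-- The product of a subexpression. A subexpression of `s_{i_1} ⋯ s_{i_N}` is a list of pairs
`(i_j, keep_j)`: the factor `s_{i_j}` is kept if `keep_j` is true and is replaced by `1` otherwise. -/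
def subexprProd (n : ℕ) (l : List (ℕ × Bool)) : Equiv.Perm ℤ :=
  (l.map fun t => if t.2 then simpleD n t.1 else 1).prod

/-- Positive distinguished subexpressions: `v_(j-1) < v_(j-1) s_{i_j}` for all `j`, where `v_(j)` is
the product of the first `j` factors of the subexpression. -/
def IsPDS (n : ℕ) (l : List (ℕ × Bool)) : Prop :=
  ∀ (j : ℕ) (hj : j < l.length),
    BruhatLTD n (subexprProd n (l.take j)) (subexprProd n (l.take j) * simpleD n (l[j]).1)

/-  Diagrams of maximal shape -/

/-- The boxes of the maximal shape (the staircase with rows of lengths `n-1, …, 1`). The box `(a, b)`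
lies in row `a`, where rows are numbered `1, 2, …` from top to bottom, and in the column with label
`b`, where columns are labelled `n, n-1, …` from left to right. With the additional diagonal boxes
`(a, a)` the staircase has `n` rows. -/
abbrev Box (n : ℕ) : Type := {p : ℕ × ℕ // 1 ≤ p.1 ∧ p.1 < p.2 ∧ p.2 ≤ n}

/-- A `⊕`-diagram of maximal shape; `true` stands for `+` and `false` for `0`. -/
abbrev Diagram (n : ℕ) : Type := Box n → Bool

/-- The simple label of a box. In row `a` the labels are `a, a+1, …, n-2` from left to right, except
for the rightmost box, whose label alternates between `n` and `n-1` from row to row, starting with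
`n` in the bottom row `n-1`. -/
def Box.label {n : ℕ} (x : Box n) : ℕ :=
  if x.1.2 = x.1.1 + 1 then (if Even (n - 1 - x.1.1) then n else n - 1)
  else n - (x.1.2 - x.1.1)

/-- All boxes, listed row by row from top to bottom and from right to left inside each row. This is
the reverse of the row reading order (bottom to top, left to right); reduced words are written down
from right to left along a reading order, so this is the order of the factors in the word. -/
def boxList (n : ℕ) : List (Box n) :=
  (List.range' 1 n).flatMap fun a => (List.range' 1 n).filterMap fun b =>
    if h : 1 ≤ a ∧ a < b ∧ b ≤ n then some ⟨(a, b), h⟩ else none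

/-- The subexpression `v(D)`: the simple reflection of a box is kept iff the box contains a `0`. -/
def Diagram.subexpr {n : ℕ} (D : Diagram n) : List (ℕ × Bool) :=
  (boxList n).map fun x => (x.label, !(D x))

/-- The type `(D_n, n)` Le-diagrams of maximal shape. -/
def leDiagrams (n : ℕ) : Set (Diagram n) := {D | IsPDS n D.subexpr}

/-  Preference functions -/

/-- Words of length `n` whose set of letters is `{1, …, k}` for some `k ≤ n`. -/
def IsPreferenceFunction (n : ℕ) (p : List ℕ) : Prop :=
  p.length = n ∧ ∃ k ≤ n, ∀ x, x ∈ p ↔ 1 ≤ x ∧ x ≤ k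

/-- A preference function is atomic if no proper nonempty leading subword consists of all the
occurrences in the word of the letters `1, …, j`, for some `j`. -/
def IsAtomicWord (p : List ℕ) : Prop :=
  ¬ ∃ (u v : List ℕ) (j : ℕ), p = u ++ v ∧ u ≠ [] ∧ v ≠ [] ∧ (∀ x ∈ u, x ≤ j) ∧ (∀ x ∈ v, j < x)

/-- Atomic preference functions of length `n`. -/
def atomicPreferenceFunctions (n : ℕ) : Set (List ℕ) :=
  {p | IsPreferenceFunction n p ∧ IsAtomicWord p}

/-  Partially filled staircases and wiring diagrams -/

/-- A partially filled staircase: the box `(a, b)` contains `+` (`some true`), `0` (`some false`) or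
is empty (`none`). Only the values at `1 ≤ a < b ≤ n` matter. -/
abbrev Filling : Type := ℕ → ℕ → Option Bool

/-- A diagram as a filling. -/
def Diagram.toFilling {n : ℕ} (D : Diagram n) : Filling := fun a b =>
  if h : 1 ≤ a ∧ a < b ∧ b ≤ n then some (D ⟨(a, b), h⟩) else none

/-- Boxes with a `+`, and the diagonal boxes (which contain `*`), are elbows, joining the west side
to the north side and the south side to the east side; all other boxes are crossings. -/
def Filling.IsElbow (D : Filling) (a b : ℕ) : Prop := a = b ∨ D a b = some true

instance (D : Filling) (a b : ℕ) : Decidable (D.IsElbow a b) := by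
  unfold Filling.IsElbow; infer_instance

/-- Follow a wire that enters the box `(a, b)` heading east (`true`) or north (`false`) until it
leaves through the north border; return the label of the column in which it leaves. -/
def Filling.northExit (D : Filling) (east : Bool) (a b : ℕ) : ℕ :=
  if a = 0 ∨ b = 0 then b
  else if (if D.IsElbow a b then !east else east) then D.northExit true a (b - 1)
  else D.northExit false (a - 1) b
termination_by a + b
decreasing_by all_goals omega

/-- All boxes of row `a` have been filled. -/
def Filling.RowComplete (n : ℕ) (D : Filling) (a : ℕ) : Prop := ∀ b ∈ Finset.Ioc a n, D a b ≠ none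

instance (n : ℕ) (D : Filling) (a : ℕ) : Decidable (D.RowComplete n a) := by
  unfold Filling.RowComplete; infer_instance

/-- All boxes of row `a` contain `0`. -/
def Filling.RowZero (n : ℕ) (D : Filling) (a : ℕ) : Prop := ∀ b ∈ Finset.Ioc a n, D a b = some false

instance (n : ℕ) (D : Filling) (a : ℕ) : Decidable (D.RowZero n a) := by
  unfold Filling.RowZero; infer_instance

/-- All boxes of row `a` but exactly one contain `0`. -/
def Filling.RowZeroExceptOne (n : ℕ) (D : Filling) (a : ℕ) : Prop :=
  ((Finset.Ioc a n).filter fun b => D a b ≠ some false).card = 1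

instance (n : ℕ) (D : Filling) (a : ℕ) : Decidable (D.RowZeroExceptOne n a) := by
  unfold Filling.RowZeroExceptOne; infer_instance

/-- The signed permutation `π(D)` in one-line notation `π(1), …, π(n)`: `|π(i)|` is the north border
label reached by the wire entering from the west in row `i`, and `π(i) > 0` iff `i ≤ n - 1` and row
`i` of `D` is filled with `0`s. -/
def signedPerm {n : ℕ} (D : Diagram n) : ℕ → ℤ := fun i =>
  if i < n ∧ D.toFilling.RowZero n i then (D.toFilling.northExit true i n : ℤ)
  else -(D.toFilling.northExit true i n : ℤ)

/-  The bijection `α` between signed permutations and preference functions -/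

/-- Membership in `I⁺ + 1 = {i + 1 : π(i) > 0}`. -/
def IsRepeat (w : ℕ → ℤ) (k : ℕ) : Prop := 2 ≤ k ∧ 0 < w (k - 1)

instance (w : ℕ → ℤ) (k : ℕ) : Decidable (IsRepeat w k) := by unfold IsRepeat; infer_instance

/-- The sequence `S_π`: the negative entries of `π` in order, standardized by absolute value. -/
def negPattern (n : ℕ) (w : ℕ → ℤ) : List ℕ :=
  let negs := ((List.range' 1 n).map w).filter fun x => x < 0
  negs.map fun x => negs.countP fun y => y.natAbs ≤ x.natAbs

/-- The letter `p_k` of `p = α(π)`: the entries of `S_π` are put in order into the positions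
`k ∉ I⁺ + 1`, and `p_{i+1} = p_{π(i)}` for `i ∈ I⁺` (where `π(i) ≤ i`). -/
def alphaLetter (n : ℕ) (w : ℕ → ℤ) (k : ℕ) : ℕ :=
  if IsRepeat w k then
    if (w (k - 1)).toNat < k then alphaLetter n w (w (k - 1)).toNat else 0
  else (negPattern n w).getD ((Finset.Ico 1 k).filter fun j => ¬ IsRepeat w j).card 0
termination_by k

/-- `α(π)`, a word of length `n`. -/
def alpha (n : ℕ) (w : ℕ → ℤ) : List ℕ := (List.range' 1 n).map (alphaLetter n w)

/-- The map `Φ`, from diagrams to words. -/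
def Phi (n : ℕ) (D : Diagram n) : List ℕ := alpha n (signedPerm D)

/-- The letter in position `k` (counted from `1`) of a word. -/
def letter (p : List ℕ) (k : ℕ) : ℕ := p.getD (k - 1) 0

/-- Position `k` is the first occurrence of its letter. -/
def IsFirst (p : List ℕ) (k : ℕ) : Prop := ∀ j ∈ Finset.Ico 1 k, letter p j ≠ letter p k

instance (p : List ℕ) (k : ℕ) : Decidable (IsFirst p k) := by unfold IsFirst; infer_instance

/-- The closest position to the left of `k` that carries the same letter (`0` if there is none). -/
def prevPos (p : List ℕ) (k : ℕ) : ℕ :=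
  ((Finset.Ico 1 k).filter fun j => letter p j = letter p k).sup id

/-- Position `i` of `w = α⁻¹(p)` carries a positive entry: `i + 1` is a position of `p` that is not
the first occurrence of its letter. -/
def IsPositivePos (n : ℕ) (p : List ℕ) (i : ℕ) : Prop := i < n ∧ ¬ IsFirst p (i + 1)

instance (n : ℕ) (p : List ℕ) (i : ℕ) : Decidable (IsPositivePos n p i) := by
  unfold IsPositivePos; infer_instance

/-- The signed permutation `w(p) = α⁻¹(p)` of a preference function `p`. In a positive position `i`
its value is the closest earlier position of the letter `p_{i+1}`. The remaining absolute values, with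
negative sign, are put into the remaining positions in the same relative order as the sequence of
first occurrences of letters in `p`. -/
def alphaInv (n : ℕ) (p : List ℕ) : ℕ → ℤ := fun i =>
  if IsPositivePos n p i then (prevPos p (i + 1) : ℤ)
  else
    let T := ((Finset.Icc 1 n).filter fun j => IsPositivePos n p j).image fun j => prevPos p (j + 1)
    let Tc := (List.range' 1 n).filter fun x => x ∉ T
    let firsts := ((List.range' 1 n).filter fun k => IsFirst p k).map (letter p)
    let m := ((Finset.Ico 1 i).filter fun j => ¬ IsPositivePos n p j).card
    (-1 : ℤ) * (Tc.getD (firsts.getD m 0 - 1) 0 : ℕ)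

/-  The map `Ψ` -/

/-- The box `c* = (a', b')`: `a'` is the highest row strictly below row `a` and strictly above row `b`
that contains a `+`, and `b'` is the column of the rightmost `+` of row `a'`. -/
def Filling.cStar (n : ℕ) (D : Filling) (a b : ℕ) : Option (ℕ × ℕ) :=
  ((List.range' (a + 1) (b - a - 1)).find? fun a' =>
      decide (∃ c ∈ Finset.Ioc a' n, D a' c = some true)).bind fun a' =>
    ((List.range' (a' + 1) (n - a')).find? fun c => decide (D a' c = some true)).map fun b' => (a', b')

/-- The new `+`s on the path `P_i` that runs from the north border label `i` to the west border label
`istar`, where `D` is the filling by the earlier paths. The path has reached `(a, b)`, which is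
`(0, i)` at the start and a `+` of `D`, entered from the east, later on, and is about to go south in
column `b`. The first argument bounds the number of rounds; since `a` increases strictly and
`a < b ≤ n`, at most `n` rounds occur. -/
def newPluses (n : ℕ) (w : ℕ → ℤ) (istar : ℕ) (D : Filling) : ℕ → ℕ → ℕ → List (ℕ × ℕ)
  | 0, _, _ => []
  | fuel + 1, a, b =>
    -- Case Z: all rows below row `a` are filled
    if ∀ r ∈ Finset.Ioc a n, D.RowComplete n r then []
    else match D.cStar n a b with
    | none =>
      -- Case Z: `c*` does not exist and `istar ≥ b`
      if b ≤ istar then []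
      -- Case A: `c*` does not exist and `istar < b`
      else [(istar, b)]
    | some (a', b') =>
      -- Case Z: `c* = (istar, b)`
      if (a', b') = (istar, b) then []
      -- Case Z: `istar > a'` and row `a'` and all rows below it are complete
      else if a' < istar ∧ ∀ r ∈ Finset.Icc a' n, D.RowComplete n r then []
      -- Case A: `istar < a'`
      else if istar < a' then [(istar, b)]
      -- Case B: the path goes straight to the diagonal box of row `istar` and then west
      else if istar = b ∧ (0 < w istar ∨ D.RowZero n b) then []
      -- Case C: the path goes straight to the diagonal box of row `b` and turns at `(b, b')`
      else if b < istar ∧ w b < 0 ∧ D.RowZeroExceptOne n b then [(b, b')]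
      -- Case D: the path turns at `(a', b)`, goes west to `c*` and turns south there
      else (a', b) :: newPluses n w istar D fuel a' b'

/-- The boxes visited by a wire that enters `(a, b)` heading south (`true`) or west (`false`) until it
leaves through the west border; empty boxes are crossed. -/
def Filling.southWestPath (n : ℕ) (D : Filling) (south : Bool) (a b : ℕ) : List (ℕ × ℕ) :=
  if n < a ∨ n < b then []
  else (a, b) ::
    if (if D.IsElbow a b then !south else south) then D.southWestPath n true (a + 1) b
    else D.southWestPath n false a (b + 1)
termination_by (n + 1 - a) + (n + 1 - b)
decreasing_by all_goals omega

/-- `i* = |w|⁻¹(i)`. -/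
def absInv (n : ℕ) (w : ℕ → ℤ) (i : ℕ) : ℕ :=
  ((List.range' 1 n).find? fun j => decide ((w j).natAbs = i)).getD 0

/-- Add the path `P_i` to the filling `D = D_{i+1}`: place the new `+`s, then fill all other empty
boxes of the path with `0`s. -/
def addPath (n : ℕ) (w : ℕ → ℤ) (D : Filling) (i : ℕ) : Filling :=
  let N := newPluses n w (absInv n w i) D n 0 i
  let D' : Filling := fun a b => if (a, b) ∈ N then some true else D a b
  let P := D'.southWestPath n true 1 i
  fun a b => if D' a b = none ∧ a < b ∧ (a, b) ∈ P then some false else D' a b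

/-- The map `Ψ`, from words to diagrams: add the paths `P_n, P_{n-1}, …, P_1` to the empty staircase.
(For an atomic preference function all boxes are filled at the end; a box left empty is read as `0`.) -/
def Psi (n : ℕ) (p : List ℕ) : Diagram n :=
  let D := (List.range' 1 n).reverse.foldl (addPath n (alphaInv n p)) fun _ _ => none
  fun x => (D x.1.1 x.1.2).getD false

/-  The counting sequence -/

/-- The ordered Bell numbers `1, 1, 3, 13, 75, …`. -/
def orderedBell (n : ℕ) : ℕ :=
  if n = 0 then 1 else ∑ k : Fin n, n.choose k * orderedBell k
termination_by n
decreasing_by exact k.2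

/-- The sequence A095989, `1, 2, 8, 48, 368, …` for `n = 1, 2, …`: the INVERTi transform of the ordered
Bell numbers, i.e. `orderedBell n = ∑_{k=1}^{n} a k * orderedBell (n - k)` for `n ≥ 1` (with `a 0 = 0`
by convention). -/
def A095989 (n : ℕ) : ℤ :=
  if n = 0 then 0 else (orderedBell n : ℤ) - ∑ k : Fin n, A095989 k * (orderedBell (n - k) : ℤ)
termination_by n
decreasing_by exact k.2

/-!
The argument rests on one invariant. Give every wire of the wiring diagram of `D` a sign that
changes with each diagonal box on its way, so that the wires through the north and the east edge of
a box have signed exit values `northVal` and `eastVal`, whose absolute values are the column labels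
in which they leave. Since a simple reflection `s_i` lengthens `v` iff `v` keeps the simple root of
`s_i` positive (`bruhatLTD_simpleD_iff`), and the prefix products of the subexpression of `D` record
exactly these exit values, `D` is a Le-diagram iff `eastVal < northVal` at every box
(`mem_leDiagrams_iff`).

*The map `Ψ` undoes `Φ`.* In a Le-diagram a `+` sits on a wire that is smaller than all wires to its
left, and a wire with a negative value to be passed on northwards forces all other values in its row
to be large (`lt_of_plus`, `lt_of_neg`). These two facts determine the `+`s met by the wire with
label `i` from the `+`s on the wires with greater labels, by the rule that defines `newPluses`
(`isNewPluses_newPluses`). Hence adding the path `P_i` turns the part of `D` visited by the wires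
with labels greater than `i` into the part visited by those with labels at least `i`
(`addPath_partialFilling`), and `Ψ` recovers `D` from its signed permutation (`psi_eq`).

*Words and signed permutations.* `Corresponds` describes the pairs of a word `p` and a signed
permutation `w` with `p = α(w)`. Each member of such a pair determines the other
(`Corresponds.word_eq`, `Corresponds.alphaInv_eq`), `alpha` and `alphaInv` produce such pairs
(`IsPrefPerm.corresponds_alpha`, `IsPreferenceFunction.corresponds_alphaInv`), and `p` is atomic iff
`w` has no negative entry at a cut, that is, at an `m < n` such that `|w|` preserves `{1, …, m}`
(`Corresponds.isAtomic_iff`). The signed permutation of a diagram satisfies this condition, because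
in a row containing a `+` the wire from the diagonal box comes from further below
(`signedPerm_isAtomicPerm`). So `Φ` is an injection of the Le-diagrams into the atomic preference
functions, with left inverse `Ψ`.

*Surjectivity.* It suffices to inject the atomic preference functions into the Le-diagrams. The
signed exit values of the rows of a Le-diagram can be prescribed: the leftmost column is recovered
by a round of bubble sort, and one proceeds by induction (`IsOutputWord.exists_isLe`). Changing the
signs of `w = α⁻¹(p)` suitably yields a word of this kind that still determines `w` (`outputWord`,
`eq_of_outputWord_eq`), hence a Le-diagram that determines `p`.

*The number of diagrams.* A preference function amounts to the set of positions of the letters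
greater than `1` and a preference function on this set, so their numbers are the ordered Bell
numbers. Every nonempty preference function is uniquely an atomic one followed by a preference
function in larger letters, which gives the recursion for the number of atomic ones
(`ncard_atomicPreferenceFunctions`).
-/

/-! ### Signed exit values of the wires -/

/-- The value transported to the east edge of a box while a row is scanned from right to left: it
starts as `c`, and at every box satisfying `p` it is exchanged for the value `x b` coming from the
north. `carry x p c b` is the value before box `b` is reached. -/
def carry (x : ℕ → ℤ) (p : ℕ → Bool) (c : ℤ) : ℕ → ℤ
  | 0 => c
  | b + 1 => if p b then x b else carry x p c b

/-- The signed label under which the wire passing through the north edge of box `(a, b)` leaves the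
staircase `q` of `+`s. The absolute value is the label of the column in which it leaves; the sign
changes with every diagonal box the wire visits on the way. -/
def northVal (q : ℕ → ℕ → Bool) : ℕ → ℕ → ℤ
  | 0 => fun b => b
  | a + 1 => fun b =>
    if q a b then carry (northVal q a) (q a) (-northVal q a a) b else northVal q a b

/-- The signed label under which the wire passing through the east edge of box `(a, b)` leaves the
staircase. The wire entering row `a` from the west has the value `eastVal q a (n + 1)`. -/
def eastVal (q : ℕ → ℕ → Bool) (a b : ℕ) : ℤ :=
  carry (northVal q a) (q a) (-northVal q a a) b

/-- The `+`s of `q` lie in the boxes of the staircase with `n` rows. -/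
def InStaircase (n : ℕ) (q : ℕ → ℕ → Bool) : Prop :=
  ∀ a b, q a b = true → 1 ≤ a ∧ a < b ∧ b ≤ n

/-- The Le-condition in terms of wires: at every box the wire through the east edge has a smaller
signed exit value than the wire through the north edge. -/
def IsLe (n : ℕ) (q : ℕ → ℕ → Bool) : Prop :=
  ∀ a b, 1 ≤ a → a < b → b ≤ n → eastVal q a b < northVal q a b

section Values

variable {n : ℕ} {q : ℕ → ℕ → Bool}

lemma northVal_succ (a b : ℕ) :
    northVal q (a + 1) b = if q a b then eastVal q a b else northVal q a b := rfl

lemma eastVal_succ (a b : ℕ) :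
    eastVal q a (b + 1) = if q a b then northVal q a b else eastVal q a b := rfl

lemma northVal_zero (b : ℕ) : northVal q 0 b = b := rfl

lemma northVal_succ_of_plus {a b : ℕ} (h : q a b = true) :
    northVal q (a + 1) b = eastVal q a b := by rw [northVal_succ, if_pos h]

lemma northVal_succ_of_not {a b : ℕ} (h : q a b = false) :
    northVal q (a + 1) b = northVal q a b := by rw [northVal_succ, h]; rfl

lemma eastVal_succ_of_plus {a b : ℕ} (h : q a b = true) :
    eastVal q a (b + 1) = northVal q a b := by rw [eastVal_succ, if_pos h]

lemma eastVal_succ_of_not {a b : ℕ} (h : q a b = false) :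
    eastVal q a (b + 1) = eastVal q a b := by rw [eastVal_succ, h]; rfl

lemma InStaircase.eq_false {a b : ℕ} (hq : InStaircase n q) (h : ¬ (1 ≤ a ∧ a < b ∧ b ≤ n)) :
    q a b = false := by
  by_contra hc
  exact h (hq a b (by simpa using hc))

lemma northVal_one (hq : InStaircase n q) (b : ℕ) : northVal q 1 b = b := by
  rw [northVal_succ_of_not (hq.eq_false (by omega)), northVal_zero]

lemma eastVal_of_le (hq : InStaircase n q) (a : ℕ) :
    ∀ b, b ≤ a + 1 → eastVal q a b = -northVal q a a
  | 0, _ => rfl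
  | b + 1, h => by
    rw [eastVal_succ_of_not (hq.eq_false (by omega)), eastVal_of_le hq a b (by omega)]

lemma eastVal_diag (hq : InStaircase n q) (a : ℕ) : eastVal q a (a + 1) = -northVal q a a :=
  eastVal_of_le hq a _ le_rfl

/-- A value in the row of the carry comes from the row of north values, or from the diagonal. -/
lemma eastVal_eq_or (hq : InStaircase n q) (a b : ℕ) :
    eastVal q a b = -northVal q a a ∨ ∃ c, a < c ∧ c < b ∧ q a c = true ∧
      eastVal q a b = northVal q a c := by
  induction b with
  | zero => left; rfl
  | succ b ih =>
    cases h : q a b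
    · rw [eastVal_succ_of_not h]
      rcases ih with h1 | ⟨c, h1, h2, h3⟩
      · exact Or.inl h1
      · exact Or.inr ⟨c, h1, by omega, h3⟩
    · rw [eastVal_succ_of_plus h]
      exact Or.inr ⟨b, (hq a b h).2.1, by omega, h, rfl⟩

lemma northVal_bound (hq : InStaircase n q) (a : ℕ) :
    ∀ b, a ≤ b → 1 ≤ b → 1 ≤ (northVal q a b).natAbs ∧ (northVal q a b).natAbs ≤ b := by
  induction a with
  | zero => intro b _ hb; rw [northVal_zero]; omega
  | succ a ih =>
    intro b hab hb
    cases h : q a b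
    · rw [northVal_succ_of_not h]; exact ih b (by omega) hb
    · rw [northVal_succ_of_plus h]
      have h1 := hq a b h
      rcases eastVal_eq_or hq a b with h2 | ⟨c, h2, h3, _, h4⟩
      · rw [h2, Int.natAbs_neg]
        have := ih a le_rfl (by omega)
        omega
      · rw [h4]
        have := ih c (by omega) (by omega)
        omega

lemma eastVal_bound (hq : InStaircase n q) {a b : ℕ} (ha : 1 ≤ a) (hab : a < b) :
    1 ≤ (eastVal q a b).natAbs ∧ (eastVal q a b).natAbs < b := by
  rcases eastVal_eq_or hq a b with h2 | ⟨c, h2, h3, _, h4⟩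
  · rw [h2, Int.natAbs_neg]
    have := northVal_bound hq a a le_rfl (by omega)
    omega
  · rw [h4]
    have := northVal_bound hq a c (by omega) (by omega)
    omega

/-- The exit labels along the boundary of the part of the staircase that precedes box `(a, b)`:
the outputs of the rows above `a`, the wire about to pass box `(a, b)` in row `a`, and the wires
heading north in the columns. -/
def slot (n : ℕ) (q : ℕ → ℕ → Bool) (a b j : ℕ) : ℕ :=
  if j < a then (eastVal q j (n + 1)).natAbs
  else if j = a then (eastVal q a b).natAbs
  else if j < b then (northVal q (a + 1) j).natAbs
  else (northVal q a j).natAbs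

/-- A box with a `+` interchanges the exit labels of its row and its column; in a box with a `0`
both wires go straight on and nothing changes. -/
lemma slot_succ {a b : ℕ} (hab : a < b) (j : ℕ) :
    slot n q a (b + 1) j =
      if q a b then slot n q a b (Equiv.swap a b j) else slot n q a b j := by
  unfold slot
  cases h : q a b
  · rw [eastVal_succ_of_not h]
    simp only [Bool.false_eq_true, if_false]
    rcases lt_trichotomy j b with h1 | h1 | h1
    · simp [h1, show j < b + 1 by omega]
    · subst h1
      simp [northVal_succ_of_not h]
    · simp [show ¬ j < b + 1 by omega, show ¬ j < b by omega]
  · rw [eastVal_succ_of_plus h]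
    simp only [if_true]
    by_cases hja : j = a
    · subst hja
      simp [show ¬ b < j by omega, show ¬ b = j by omega]
    by_cases hjb : j = b
    · subst hjb
      simp [northVal_succ_of_plus h, show ¬ j < a by omega, hja]
    rw [Equiv.swap_apply_of_ne_of_ne hja hjb]
    by_cases h1 : j < b
    · simp [h1, show j < b + 1 by omega, hja]
    · simp [show ¬ j < b + 1 by omega, h1, hja]

lemma slot_next_row (hq : InStaircase n q) {a : ℕ} (j : ℕ) (hj : j ≤ n) :
    slot n q (a + 1) (a + 2) j = slot n q a (n + 1) j := by
  unfold slot
  rcases lt_trichotomy j a with h1 | h1 | h1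
  · simp [h1, show j < a + 1 by omega]
  · subst h1; simp
  · rcases Nat.lt_or_ge j (a + 2) with h2 | h2
    · obtain rfl : j = a + 1 := by omega
      simp [eastVal_diag hq, show a + 1 < n + 1 by omega]
    · simp [show ¬ j < a + 1 by omega, show ¬ j < a by omega, show ¬ j = a by omega,
        show ¬ j = a + 1 by omega, show ¬ j < a + 2 by omega, show j < n + 1 by omega]

/-- Different wires leave through different columns. -/
lemma slot_injOn (hq : InStaircase n q) {a b : ℕ} (ha : 1 ≤ a) (han : a ≤ n) (hab : a < b)
    (hb : b ≤ n + 1) : Set.InjOn (slot n q a b) (Set.Icc 1 n) := by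
  induction a, ha using Nat.le_induction generalizing b with
  | base =>
    induction b, hab using Nat.le_induction with
    | base =>
      have key : ∀ j ∈ Set.Icc 1 n, slot n q 1 2 j = j := by
        intro j hj
        unfold slot
        rcases Nat.lt_or_ge 1 j with h | h
        · simp [show ¬ j = 0 by omega, show ¬ j = 1 by omega, show ¬ j < 2 by omega,
            northVal_one hq]
        · obtain rfl : j = 1 := by have := hj.1; omega
          simp [eastVal_diag hq 1, northVal_one hq]
      intro i hi j hj hij
      simp only [Nat.succ_eq_add_one, Nat.reduceAdd] at hij
      rwa [key i hi, key j hj] at hij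
    | succ b hab ih => exact step han hab hb (ih (by omega))
  | succ a ha ih' =>
    induction b, hab using Nat.le_induction with
    | base =>
      intro i hi j hj hij
      have := ih' (b := n + 1) (by omega) (by omega) le_rfl
      apply this hi hj
      rw [← slot_next_row hq i hi.2, ← slot_next_row hq j hj.2]
      exact hij
    | succ b hab ih => exact step han hab hb (ih (by omega))
where
  step {a b : ℕ} (han : a ≤ n) (hab : a < b) (hb : b + 1 ≤ n + 1)
      (ih : Set.InjOn (slot n q a b) (Set.Icc 1 n)) :
      Set.InjOn (slot n q a (b + 1)) (Set.Icc 1 n) := by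
    intro i hi j hj hij
    rw [slot_succ hab, slot_succ hab] at hij
    split at hij
    · rename_i h
      have h1 := hq a b h
      have hs : ∀ k ∈ Set.Icc 1 n, Equiv.swap a b k ∈ Set.Icc 1 n := by
        intro k hk
        rw [Equiv.swap_apply_def]
        simp only [Set.mem_Icc] at hk ⊢
        split_ifs <;> omega
      exact (Equiv.swap a b).injective (ih (hs i hi) (hs j hj) hij)
    · exact ih hi hj hij

lemma eastVal_end_inj (hq : InStaircase n q) {i j : ℕ} (hi : i ∈ Set.Icc 1 n)
    (hj : j ∈ Set.Icc 1 n)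
    (h : (eastVal q i (n + 1)).natAbs = (eastVal q j (n + 1)).natAbs) : i = j := by
  have h1 : 1 ≤ n := hi.1.trans hi.2
  have h2 : ∀ k ∈ Set.Icc 1 n, slot n q n (n + 1) k = (eastVal q k (n + 1)).natAbs := by
    intro k hk
    unfold slot
    rcases hk.2.lt_or_eq with h | h
    · simp [h]
    · simp [h]
  apply slot_injOn hq (a := n) (b := n + 1) h1 le_rfl (by omega) le_rfl hi hj
  rw [h2 i hi, h2 j hj, h]

/-- Every column label is the exit label of the wire entering in some row. -/
lemma exists_row (hq : InStaircase n q) {i : ℕ} (hi : i ∈ Set.Icc 1 n) :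
    ∃ r ∈ Set.Icc 1 n, (eastVal q r (n + 1)).natAbs = i := by
  have h1 : Set.SurjOn (fun k => (eastVal q k (n + 1)).natAbs)
      (Finset.Icc 1 n : Finset ℕ) (Finset.Icc 1 n : Finset ℕ) := by
    apply Finset.surjOn_of_injOn_of_card_le
    · intro k hk
      simp only [Finset.coe_Icc, Set.mem_Icc] at hk ⊢
      have := eastVal_bound hq (a := k) (b := n + 1) hk.1 (by omega)
      omega
    · intro k hk l hl hkl
      rw [Finset.coe_Icc] at hk hl
      exact eastVal_end_inj hq hk hl hkl
    · exact le_rfl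
  obtain ⟨r, hr, h⟩ := h1 (by simpa using hi : i ∈ ((Finset.Icc 1 n : Finset ℕ) : Set ℕ))
  exact ⟨r, by simpa using hr, h⟩

lemma northVal_inj (hq : InStaircase n q) {a b c : ℕ} (ha : 1 ≤ a) (hab : a ≤ b) (hac : a ≤ c)
    (hb : b ≤ n) (hc : c ≤ n) (h : (northVal q a b).natAbs = (northVal q a c).natAbs) :
    b = c := by
  have h2 : ∀ k, a ≤ k → slot n q a (a + 1) k = (northVal q a k).natAbs := by
    intro k hk
    unfold slot
    rcases hk.lt_or_eq with h | h
    · simp [show ¬ k < a by omega, show ¬ k = a by omega, show ¬ k < a + 1 by omega]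
    · subst h; simp [eastVal_diag hq]
  apply slot_injOn hq (a := a) (b := a + 1) ha (by omega) (by omega) (by omega)
    (Set.mem_Icc.2 ⟨by omega, hb⟩) (Set.mem_Icc.2 ⟨by omega, hc⟩)
  rw [h2 b hab, h2 c hac, h]

lemma eastVal_ne_northVal (hq : InStaircase n q) {a b c : ℕ} (ha : 1 ≤ a) (hab : a < b)
    (hbc : b ≤ c) (hc : c ≤ n) : (eastVal q a b).natAbs ≠ (northVal q a c).natAbs := by
  intro h
  have := slot_injOn hq (a := a) (b := b) ha (by omega) hab (by omega)
    (Set.mem_Icc.2 ⟨ha, by omega⟩ : a ∈ Set.Icc 1 n)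
    (Set.mem_Icc.2 ⟨by omega, hc⟩ : c ∈ Set.Icc 1 n)
    (by simp [slot, show ¬ c < a by omega, show ¬ c = a by omega, show ¬ c < b by omega, h])
  omega

lemma eastVal_ne_northVal_succ (hq : InStaircase n q) {a b c : ℕ} (ha : 1 ≤ a) (hac : a < c)
    (hbc : c < b) (hb : b ≤ n + 1) :
    (eastVal q a b).natAbs ≠ (northVal q (a + 1) c).natAbs := by
  intro h
  have := slot_injOn hq (a := a) (b := b) ha (by omega) (by omega) hb
    (Set.mem_Icc.2 ⟨ha, by omega⟩ : a ∈ Set.Icc 1 n)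
    (Set.mem_Icc.2 ⟨by omega, by omega⟩ : c ∈ Set.Icc 1 n)
    (by simp [slot, show ¬ c < a by omega, show ¬ c = a by omega, show c < b by omega, h])
  omega

lemma eastVal_end_ne_eastVal (hq : InStaircase n q) {a b j : ℕ} (hj : 1 ≤ j) (hja : j < a)
    (hab : a < b) (hb : b ≤ n + 1) :
    (eastVal q j (n + 1)).natAbs ≠ (eastVal q a b).natAbs := by
  intro h
  have := slot_injOn hq (a := a) (b := b) (by omega) (by omega) hab hb
    (Set.mem_Icc.2 ⟨hj, by omega⟩ : j ∈ Set.Icc 1 n)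
    (Set.mem_Icc.2 ⟨by omega, by omega⟩ : a ∈ Set.Icc 1 n)
    (by simp [slot, hja, h])
  omega

lemma eastVal_end_ne_northVal (hq : InStaircase n q) {a b j : ℕ} (hj : 1 ≤ j) (hja : j < a)
    (hab : a ≤ b) (hb : b ≤ n) :
    (eastVal q j (n + 1)).natAbs ≠ (northVal q a b).natAbs := by
  intro h
  rcases hab.lt_or_eq with hab | rfl
  · have := slot_injOn hq (a := a) (b := b) (by omega) (by omega) hab (by omega)
      (Set.mem_Icc.2 ⟨hj, by omega⟩ : j ∈ Set.Icc 1 n)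
      (Set.mem_Icc.2 ⟨by omega, by omega⟩ : b ∈ Set.Icc 1 n)
      (by simp [slot, hja, h, show ¬ b < a by omega, show ¬ b = a by omega])
    omega
  · refine eastVal_end_ne_eastVal hq hj hja (Nat.lt_succ_self a) (by omega) ?_
    rw [h, eastVal_diag hq, Int.natAbs_neg]

/-! ### Consequences of the Le-condition -/

lemma northVal_succ_le (hq : InStaircase n q) (hLe : IsLe n q) (a b : ℕ) :
    northVal q (a + 1) b ≤ northVal q a b := by
  cases h : q a b
  · rw [northVal_succ_of_not h]
  · rw [northVal_succ_of_plus h]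
    have := hq a b h
    exact (hLe a b this.1 this.2.1 this.2.2).le

lemma northVal_antitone (hq : InStaircase n q) (hLe : IsLe n q) {r s : ℕ} (b : ℕ) (h : r ≤ s) :
    northVal q s b ≤ northVal q r b :=
  antitone_nat_of_succ_le (f := fun r => northVal q r b)
    (fun a => northVal_succ_le hq hLe a b) h

lemma eastVal_monotone (hq : InStaircase n q) (hLe : IsLe n q) (a : ℕ) {b c : ℕ} (h : b ≤ c) :
    eastVal q a b ≤ eastVal q a c := by
  refine monotone_nat_of_le_succ (f := fun b => eastVal q a b) (fun b => ?_) h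
  cases h : q a b
  · rw [eastVal_succ_of_not h]
  · rw [eastVal_succ_of_plus h]
    have := hq a b h
    exact (hLe a b this.1 this.2.1 this.2.2).le

lemma neg_diag_lt (hq : InStaircase n q) (hLe : IsLe n q) {a b : ℕ} (ha : 1 ≤ a) (hab : a < b)
    (hb : b ≤ n) : -northVal q a a < northVal q a b := by
  rw [← eastVal_diag hq]
  exact (eastVal_monotone hq hLe a (by omega : a + 1 ≤ b)).trans_lt (hLe a b ha hab hb)

/-- A `+` of a Le-diagram sits on a wire that is smaller than all wires to its left. -/
lemma lt_of_plus (hq : InStaircase n q) (hLe : IsLe n q) {a b c : ℕ} (h : q a b = true)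
    (hbc : b < c) (hc : c ≤ n) : northVal q a b < northVal q a c := by
  have := hq a b h
  rw [← eastVal_succ_of_plus h]
  exact (eastVal_monotone hq hLe a (by omega : b + 1 ≤ c)).trans_lt
    (hLe a c this.1 (by omega) hc)

/-- If a negative value `-y` is heading north in some column, then all other values heading north in
the same row exceed `y`: otherwise some later row would violate the Le-condition. -/
lemma lt_of_neg (hq : InStaircase n q) (hLe : IsLe n q) {r g : ℕ} (hr : 1 ≤ r) (hrg : r ≤ g)
    (hg : g ≤ n) (hneg : northVal q r g < 0) {b : ℕ} (hrb : r ≤ b) (hb : b ≤ n) (hbg : b ≠ g) :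
    -northVal q r g < northVal q r b := by
  induction hrg using Nat.decreasingInduction generalizing b with
  | self =>
    exact neg_diag_lt hq hLe hr (by omega) hb
  | of_succ r hrg ih =>
    rcases hrb.lt_or_eq with hrb | rfl
    · have h1 := northVal_succ_le hq hLe r g
      have h2 := northVal_succ_le hq hLe r b
      have h3 := ih (by omega) (by omega) hrb hb hbg
      omega
    · have := neg_diag_lt hq hLe hr hrg hg
      omega

end Values

/-! ### Ascents in the Weyl group of type `D_n` -/

/-- The simple reflection `s_i` interchanges the letters `(rootPair n i).1` and `(rootPair n i).2`,
and their negatives; the first of the two is the smaller one. -/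
def rootPair (n i : ℕ) : ℤ × ℤ := if i = n then (-1, 2) else ((n : ℤ) - i, (n : ℤ) - i + 1)

/-- `i` is a (right) ascent of `v`: the simple root of `s_i` is sent to a positive root. -/
def IsAscent (n : ℕ) (v : Equiv.Perm ℤ) (i : ℕ) : Prop := v (rootPair n i).1 < v (rootPair n i).2

/-- `v` is a product of simple reflections. -/
def IsProdSimple (n : ℕ) (v : Equiv.Perm ℤ) : Prop :=
  ∃ l : List ℕ, (∀ i ∈ l, 1 ≤ i ∧ i ≤ n) ∧ (l.map (simpleD n)).prod = v

section Ascents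

variable {n i : ℕ}

lemma rootPair_spec (hi : 1 ≤ i ∧ i ≤ n) : (rootPair n i).1 < (rootPair n i).2 ∧
    (rootPair n i).1 ≠ 0 ∧ 0 < (rootPair n i).2 ∧ 0 < (rootPair n i).1 + (rootPair n i).2 ∧
    ((rootPair n i = (-1, 2)) ∨
      0 < (rootPair n i).1 ∧ (rootPair n i).2 = (rootPair n i).1 + 1) := by
  unfold rootPair
  split_ifs
  · simp
  · simp only
    refine ⟨by omega, by omega, by omega, by omega, Or.inr ⟨by omega, trivial⟩⟩

lemma simpleD_apply (hi : 1 ≤ i ∧ i ≤ n) (x : ℤ) : simpleD n i x =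
    if x = (rootPair n i).1 then (rootPair n i).2
    else if x = (rootPair n i).2 then (rootPair n i).1
    else if x = -(rootPair n i).1 then -(rootPair n i).2
    else if x = -(rootPair n i).2 then -(rootPair n i).1
    else x := by
  unfold simpleD rootPair
  by_cases h : i = n
  · simp only [h, if_true, Equiv.Perm.mul_apply, Equiv.swap_apply_def]
    split_ifs <;> first | contradiction | omega
  · simp only [h, if_false, Equiv.Perm.mul_apply, Equiv.swap_apply_def]
    split_ifs <;> omega

lemma simpleD_neg (hi : 1 ≤ i ∧ i ≤ n) (x : ℤ) : simpleD n i (-x) = -simpleD n i x := by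
  have h := rootPair_spec hi
  rw [simpleD_apply hi, simpleD_apply hi]
  generalize rootPair n i = p at *
  split_ifs <;> omega

lemma simpleD_simpleD (hi : 1 ≤ i ∧ i ≤ n) (x : ℤ) : simpleD n i (simpleD n i x) = x := by
  have h := rootPair_spec hi
  rw [simpleD_apply hi, simpleD_apply hi]
  generalize rootPair n i = p at *
  split_ifs <;> omega

lemma simpleD_mul_self (hi : 1 ≤ i ∧ i ≤ n) : simpleD n i * simpleD n i = 1 :=
  Equiv.ext fun x => simpleD_simpleD hi x

lemma simpleD_fst (hi : 1 ≤ i ∧ i ≤ n) :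
    simpleD n i (rootPair n i).1 = (rootPair n i).2 := by
  rw [simpleD_apply hi, if_pos rfl]

lemma simpleD_snd (hi : 1 ≤ i ∧ i ≤ n) :
    simpleD n i (rootPair n i).2 = (rootPair n i).1 := by
  rw [← simpleD_fst hi, simpleD_simpleD hi]

/-- The only positive root made negative by `s_i` is the simple root. -/
lemma eq_rootPair_of_simpleD_lt (hi : 1 ≤ i ∧ i ≤ n) {x y : ℤ} (hxy : x < y) (hx : x ≠ 0)
    (hy : y ≠ 0) (hs : x + y ≠ 0) (h : simpleD n i y < simpleD n i x) :
    (x = (rootPair n i).1 ∧ y = (rootPair n i).2) ∨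
      (x = -(rootPair n i).2 ∧ y = -(rootPair n i).1) := by
  have hp := rootPair_spec hi
  rw [simpleD_apply hi, simpleD_apply hi] at h
  generalize rootPair n i = p at *
  obtain ⟨p1, p2⟩ := p
  simp only [Prod.mk.injEq] at *
  split_ifs at h <;> omega

lemma prod_simpleD_neg {l : List ℕ} (hl : ∀ i ∈ l, 1 ≤ i ∧ i ≤ n) (x : ℤ) :
    (l.map (simpleD n)).prod (-x) = -(l.map (simpleD n)).prod x := by
  induction l with
  | nil => simp
  | cons j l ih =>
    simp only [List.map_cons, List.prod_cons, Equiv.Perm.mul_apply]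
    rw [ih fun i hi => hl i (List.mem_cons_of_mem _ hi), simpleD_neg (hl j List.mem_cons_self)]

/-- If a permutation commuting with negation carries the simple root of `s_i` to that of `s_j`, up
to sign, then it intertwines the two reflections. -/
lemma simpleD_mul_eq {j : ℕ} (hi : 1 ≤ i ∧ i ≤ n) (hj : 1 ≤ j ∧ j ≤ n) {g : Equiv.Perm ℤ}
    (hg : ∀ x, g (-x) = -g x)
    (h : (g (rootPair n i).1 = (rootPair n j).1 ∧ g (rootPair n i).2 = (rootPair n j).2) ∨
      (g (rootPair n i).1 = -(rootPair n j).2 ∧ g (rootPair n i).2 = -(rootPair n j).1)) :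
    simpleD n j * g = g * simpleD n i := by
  have hi1 := simpleD_fst hi
  have hi2 := simpleD_snd hi
  have hj1 := simpleD_fst hj
  have hj2 := simpleD_snd hj
  have hgx : ∀ x y, g x = g y → x = y := fun x y hy => g.injective hy
  have key : ∀ x, x = (rootPair n i).1 ∨ x = (rootPair n i).2 →
      simpleD n j (g x) = g (simpleD n i x) := by
    rintro x (rfl | rfl) <;> rcases h with ⟨h1, h2⟩ | ⟨h1, h2⟩ <;>
      simp only [h1, h2, hi1, hi2, hj1, hj2, simpleD_neg hj]
  ext x
  simp only [Equiv.Perm.mul_apply]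
  by_cases hx : x = (rootPair n i).1 ∨ x = (rootPair n i).2
  · exact key x hx
  by_cases hx' : -x = (rootPair n i).1 ∨ -x = (rootPair n i).2
  · have := key (-x) hx'
    rwa [hg, simpleD_neg hi, hg, simpleD_neg hj, neg_inj] at this
  have e : simpleD n i x = x := by
    rw [simpleD_apply hi]
    split_ifs <;> omega
  rw [e, simpleD_apply hj]
  have e1 := hgx x (rootPair n i).1
  have e2 := hgx x (rootPair n i).2
  have e3 := hgx (-x) (rootPair n i).1
  have e4 := hgx (-x) (rootPair n i).2
  rw [hg] at e3 e4
  rcases h with ⟨h1, h2⟩ | ⟨h1, h2⟩ <;> rw [h1] at e1 e3 <;> rw [h2] at e2 e4 <;>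
    (split_ifs <;> omega)

/-- The exchange property: a word whose product sends the simple root of `s_i` to a negative root
can be shortened by one letter after multiplication by `s_i`. -/
lemma exists_shorter_word (hi : 1 ≤ i ∧ i ≤ n) : ∀ l : List ℕ, (∀ j ∈ l, 1 ≤ j ∧ j ≤ n) →
    (l.map (simpleD n)).prod (rootPair n i).2 < (l.map (simpleD n)).prod (rootPair n i).1 →
    ∃ l' : List ℕ, (∀ j ∈ l', 1 ≤ j ∧ j ≤ n) ∧ l'.length + 1 = l.length ∧
      (l'.map (simpleD n)).prod = (l.map (simpleD n)).prod * simpleD n i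
  | [], _, h => by
    have := rootPair_spec hi
    simp only [List.map_nil, List.prod_nil, Equiv.Perm.one_apply] at h
    omega
  | j :: l, hl, h => by
    have hj := hl j List.mem_cons_self
    have hl' : ∀ k ∈ l, 1 ≤ k ∧ k ≤ n := fun k hk => hl k (List.mem_cons_of_mem _ hk)
    have hp := rootPair_spec hi
    have hodd := prod_simpleD_neg hl'
    simp only [List.map_cons, List.prod_cons, Equiv.Perm.mul_apply] at h ⊢
    rcases lt_trichotomy ((l.map (simpleD n)).prod (rootPair n i).2)
        ((l.map (simpleD n)).prod (rootPair n i).1) with h1 | h1 | h1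
    · obtain ⟨l', h2, h3, h4⟩ := exists_shorter_word hi l hl' h1
      refine ⟨j :: l', ?_, by simp [h3], by simp [h4, mul_assoc]⟩
      intro k hk
      rcases List.mem_cons.1 hk with rfl | hk
      exacts [hj, h2 k hk]
    · have := Equiv.injective _ h1
      omega
    -- here `s_j` turns a positive root into a negative one, which identifies it as the simple root
    · refine ⟨l, hl', by simp, ?_⟩
      set g := (l.map (simpleD n)).prod
      have hg0 : ∀ x, g x = 0 → x = 0 := by
        intro x hx
        have h0 : g 0 = 0 := by have := hodd 0; simp only [neg_zero] at this; omega
        exact g.injective (hx.trans h0.symm)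
      have hsum : g (rootPair n i).1 + g (rootPair n i).2 ≠ 0 := by
        intro h2
        have h3 : g (rootPair n i).1 = g (-(rootPair n i).2) := by rw [hodd]; omega
        have := g.injective h3
        omega
      have key := simpleD_mul_eq hi hj hodd (eq_rootPair_of_simpleD_lt hj h1
        (fun h => hp.2.1 (hg0 _ h)) (fun h => hp.2.2.1.ne' (hg0 _ h)) hsum h)
      rw [key, mul_assoc, simpleD_mul_self hi, mul_one]

lemma IsProdSimple.mul_simpleD {v : Equiv.Perm ℤ} (hv : IsProdSimple n v)
    (hi : 1 ≤ i ∧ i ≤ n) : IsProdSimple n (v * simpleD n i) := by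
  obtain ⟨l, hl, rfl⟩ := hv
  refine ⟨l ++ [i], ?_, by simp⟩
  intro j hj
  rcases List.mem_append.1 hj with hj | hj
  · exact hl j hj
  · rw [List.mem_singleton.1 hj]; exact hi

/-- Since `i` is a descent of `v s_i`, a shortest word for `v s_i` can be shortened to one for `v`.
-/
lemma lengthD_lt_of_isAscent {v : Equiv.Perm ℤ} (hv : IsProdSimple n v) (hi : 1 ≤ i ∧ i ≤ n)
    (h : IsAscent n v i) : lengthD n v < lengthD n (v * simpleD n i) := by
  obtain ⟨m, hm, hm'⟩ := hv.mul_simpleD hi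
  obtain ⟨l, hl, hlen, hprod⟩ := Nat.sInf_mem (s := {k | ∃ l : List ℕ,
    (∀ i ∈ l, 1 ≤ i ∧ i ≤ n) ∧ l.length = k ∧ (l.map (simpleD n)).prod = v * simpleD n i})
    ⟨m.length, m, hm, rfl, hm'⟩
  obtain ⟨l', hl', hlen', hprod'⟩ := exists_shorter_word hi l hl (by
    rw [hprod, Equiv.Perm.mul_apply, Equiv.Perm.mul_apply, simpleD_fst hi, simpleD_snd hi]
    exact h)
  rw [hprod, mul_assoc, simpleD_mul_self hi, mul_one] at hprod'
  have h1 : lengthD n v ≤ l'.length := Nat.sInf_le ⟨l', hl', rfl, hprod'⟩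
  have h2 : l.length = lengthD n (v * simpleD n i) := hlen
  omega

/-- In the Bruhat order, `v < v s_i` holds iff `i` is an ascent of `v`. -/
lemma bruhatLTD_simpleD_iff {v : Equiv.Perm ℤ} (hv : IsProdSimple n v) (hi : 1 ≤ i ∧ i ≤ n) :
    BruhatLTD n v (v * simpleD n i) ↔ IsAscent n v i := by
  constructor
  · intro h
    have hlen : lengthD n v < lengthD n (v * simpleD n i) := by
      have : ∀ w, BruhatLTD n v w → lengthD n v < lengthD n w := by
        intro w hw
        induction hw with
        | single h => exact h.choose_spec.2.2
        | tail _ h ih => exact ih.trans h.choose_spec.2.2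
      exact this _ h
    by_contra hasc
    have hp := rootPair_spec hi
    have hdesc : IsAscent n (v * simpleD n i) i := by
      unfold IsAscent at hasc ⊢
      rw [Equiv.Perm.mul_apply, Equiv.Perm.mul_apply, simpleD_fst hi, simpleD_snd hi]
      refine lt_of_le_of_ne (not_lt.1 hasc) fun h => ?_
      have := v.injective h
      omega
    have := lengthD_lt_of_isAscent (hv.mul_simpleD hi) hi hdesc
    rw [mul_assoc, simpleD_mul_self hi, mul_one] at this
    omega
  · intro h
    exact Relation.TransGen.single ⟨simpleD n i,
      ⟨1, one_mem _, i, ⟨hi.1, hi.2⟩, by simp⟩, rfl, lengthD_lt_of_isAscent hv hi h⟩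

/-- The recursive form of the positive distinguished condition for a subexpression that is read with
the product `v` already accumulated. -/
def AscentsFrom (n : ℕ) : Equiv.Perm ℤ → List (ℕ × Bool) → Prop
  | _, [] => True
  | v, t :: l => IsAscent n v t.1 ∧ AscentsFrom n (if t.2 then v * simpleD n t.1 else v) l

lemma isPDS_iff_ascentsFrom {l : List (ℕ × Bool)} (hl : ∀ t ∈ l, 1 ≤ t.1 ∧ t.1 ≤ n) :
    IsPDS n l ↔ AscentsFrom n 1 l := by
  have key : ∀ (l : List (ℕ × Bool)) (v : Equiv.Perm ℤ), (∀ t ∈ l, 1 ≤ t.1 ∧ t.1 ≤ n) →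
      IsProdSimple n v → ((∀ (j : ℕ) (hj : j < l.length),
        BruhatLTD n (v * subexprProd n (l.take j))
          (v * subexprProd n (l.take j) * simpleD n (l[j]).1)) ↔ AscentsFrom n v l) := by
    intro l
    induction l with
    | nil => intro v _ _; simp [AscentsFrom]
    | cons t l ih =>
      intro v hl hv
      have ht := hl t List.mem_cons_self
      have hv' : IsProdSimple n (if t.2 then v * simpleD n t.1 else v) := by
        split_ifs
        exacts [hv.mul_simpleD ht, hv]
      rw [AscentsFrom, ← ih _ (fun s hs => hl s (List.mem_cons_of_mem _ hs)) hv',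
        ← bruhatLTD_simpleD_iff hv ht]
      have hmul : ∀ j, v * subexprProd n ((t :: l).take (j + 1)) =
          (if t.2 then v * simpleD n t.1 else v) * subexprProd n (l.take j) := by
        intro j
        simp only [subexprProd, List.take_succ_cons, List.map_cons, List.prod_cons, ← mul_assoc]
        split_ifs <;> simp
      constructor
      · intro h
        have h0 := h 0 (by simp)
        simp only [List.take_zero, subexprProd, List.map_nil, List.prod_nil, mul_one,
          List.getElem_cons_zero] at h0
        refine ⟨h0, fun j hj => ?_⟩
        have := h (j + 1) (by simpa using hj)
        rwa [hmul] at this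
      · rintro ⟨h0, h⟩ j hj
        cases j with
        | zero => simpa [subexprProd] using h0
        | succ j =>
          rw [hmul]
          exact h j (by simpa using hj)
  have := key l 1 hl ⟨[], by simp, by simp⟩
  simp only [one_mul] at this
  exact this

end Ascents

/-! ### Le-diagrams in terms of exit values -/

/-- The positions of the `+`s of a diagram. -/
def Diagram.plus {n : ℕ} (D : Diagram n) (a b : ℕ) : Bool :=
  if h : 1 ≤ a ∧ a < b ∧ b ≤ n then D ⟨(a, b), h⟩ else false

lemma Diagram.plus_inStaircase {n : ℕ} (D : Diagram n) : InStaircase n D.plus := by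
  intro a b h
  by_contra hc
  simp [Diagram.plus, hc] at h

lemma Diagram.plus_apply {n : ℕ} (D : Diagram n) (x : Box n) : D.plus x.1.1 x.1.2 = D x :=
  dif_pos x.2

lemma Diagram.toFilling_eq {n : ℕ} (D : Diagram n) (a b : ℕ) :
    D.toFilling a b = if 1 ≤ a ∧ a < b ∧ b ≤ n then some (D.plus a b) else none := by
  unfold Diagram.toFilling Diagram.plus
  split_ifs <;> rfl

/-- The sign relating the first letter of the prefix product at the beginning of row `a` to the
value east of the first box of the row: only the labels `n` involve a change of sign. -/
def rowSign (n a : ℕ) : ℤ := if Even (n - 1 - a) then -1 else 1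

/-- The letters of the prefix product `v` reached just before box `(a, b)`, in terms of the exit
values of the wires crossing the boundary of the part of the staircase read so far. The function `t`
accounts for the freedom in the sign of the exit label `1`. -/
structure PrefixState (n : ℕ) (q : ℕ → ℕ → Bool) (t : ℤ → ℤ) (a b : ℕ) (v : Equiv.Perm ℤ) :
    Prop where
  odd : ∀ x, v (-x) = -v x
  north : ∀ j : ℕ, b ≤ j → a < j → j ≤ n → v ((j : ℤ) - a + 1) = t (northVal q a j)
  east : max b (a + 1) ≤ n → v ((max b (a + 1) : ℕ) - (a : ℤ)) =
    (if b ≤ a + 1 then rowSign n a else 1) * t (eastVal q a b)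
  done : ∀ j : ℕ, a < j → j < b → j ≤ n → v ((j : ℤ) - a) =
    (if j = a + 1 then rowSign n a else 1) * t (northVal q (a + 1) j)

section Tracking

variable {n : ℕ} {q : ℕ → ℕ → Bool} {t : ℤ → ℤ}

lemma Box.label_mem (x : Box n) : 1 ≤ x.label ∧ x.label ≤ n := by
  have := x.2
  unfold Box.label
  split_ifs <;> omega

lemma rowSign_mul_self (a : ℕ) : rowSign n a * rowSign n a = 1 := by
  unfold rowSign; split_ifs <;> norm_num

lemma rowSign_succ {a : ℕ} (h : a + 1 < n) : rowSign n (a + 1) = -rowSign n a := by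
  unfold rowSign
  have e : Even (n - 1 - a) ↔ ¬ Even (n - 1 - (a + 1)) := by
    rw [show n - 1 - a = n - 1 - (a + 1) + 1 by omega, Nat.even_add_one]
  split_ifs <;> first | rfl | (exfalso; tauto)

lemma Box.rootPair_label (x : Box n) : rootPair n x.label =
    if x.1.2 = x.1.1 + 1 then (rowSign n x.1.1, 2)
    else ((x.1.2 : ℤ) - x.1.1, (x.1.2 : ℤ) - x.1.1 + 1) := by
  obtain ⟨⟨a, b⟩, h⟩ := x
  simp only [Box.label, rootPair, rowSign] at h ⊢
  by_cases h1 : b = a + 1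
  · by_cases h2 : Even (n - 1 - a)
    · simp [h1, h2]
    · simp [h1, h2, show n - 1 ≠ n by omega]
      omega
  · simp only [h1, if_false, show n - (b - a) ≠ n by omega]
    rw [Prod.mk.injEq]
    omega

lemma simpleD_label_fixed (x : Box n) {k : ℤ} (hk : 0 < k)
    (h1 : k ≠ (x.1.2 : ℤ) - x.1.1) (h2 : k ≠ (x.1.2 : ℤ) - x.1.1 + 1) :
    simpleD n x.label k = k := by
  rw [simpleD_apply x.label_mem, x.rootPair_label]
  have := x.2
  by_cases h : x.1.2 = x.1.1 + 1
  · simp only [h, if_true]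
    unfold rowSign
    split_ifs <;> omega
  · simp only [h, if_false]
    split_ifs <;> omega

/-- At a box the simple root of its label is sent by the prefix product to the root given by the
exit values of the two wires passing the box, as this lemma and the next one state. -/
lemma PrefixState.fst {x : Box n} {v : Equiv.Perm ℤ}
    (hv : PrefixState n q t x.1.1 x.1.2 v) :
    v (rootPair n x.label).1 = t (eastVal q x.1.1 x.1.2) := by
  have hx := x.2
  have h1 := hv.east (by omega)
  rw [x.rootPair_label]
  by_cases h : x.1.2 = x.1.1 + 1
  · rw [if_pos h]
    rw [if_pos h.le, h, max_self] at h1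
    simp only [h] at *
    have e : ((x.1.1 + 1 : ℕ) : ℤ) - x.1.1 = 1 := by omega
    rw [e] at h1
    unfold rowSign at *
    split_ifs at *
    · rw [hv.odd, h1]; ring
    · rw [h1]; ring
  · rw [if_neg h]
    rwa [if_neg (by omega), one_mul, max_eq_left (by omega)] at h1

lemma PrefixState.snd {x : Box n} {v : Equiv.Perm ℤ} (hv : PrefixState n q t x.1.1 x.1.2 v) :
    v (rootPair n x.label).2 = t (northVal q x.1.1 x.1.2) := by
  have hx := x.2
  have h1 := hv.north x.1.2 le_rfl hx.2.1 hx.2.2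
  rw [x.rootPair_label, ← h1]
  by_cases h : x.1.2 = x.1.1 + 1
  · rw [if_pos h, h]
    congr 1
    push_cast
    ring
  · rw [if_neg h]

/-- Passing a box changes the prefix product as the box changes the boundary values. -/
lemma PrefixState.step {x : Box n} {v : Equiv.Perm ℤ}
    (hv : PrefixState n q t x.1.1 x.1.2 v) :
    PrefixState n q t x.1.1 (x.1.2 + 1)
      (if !q x.1.1 x.1.2 then v * simpleD n x.label else v) := by
  have hx := x.2
  have hfst := hv.fst
  have hsnd := hv.snd
  cases hq : q x.1.1 x.1.2
  · simp only [Bool.not_false, if_true]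
    have hsf := simpleD_fst x.label_mem
    have hss := simpleD_snd x.label_mem
    refine ⟨fun k => ?_, fun j h1 h2 h3 => ?_, fun h => ?_, fun j h1 h2 h3 => ?_⟩
    · rw [Equiv.Perm.mul_apply, simpleD_neg x.label_mem, hv.odd, Equiv.Perm.mul_apply]
    · rw [Equiv.Perm.mul_apply, simpleD_label_fixed x (by omega) (by omega) (by omega)]
      exact hv.north j (by omega) h2 h3
    · rw [if_neg (by omega), one_mul, eastVal_succ_of_not hq, ← hfst, ← hss,
        max_eq_left (by omega), Equiv.Perm.mul_apply]
      congr 2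
      rw [x.rootPair_label]
      split_ifs with h4
      · simp only [h4]; omega
      · simp only; omega
    · rw [Equiv.Perm.mul_apply]
      rcases (Nat.lt_succ_iff.1 h2).lt_or_eq with h4 | h4
      · rw [simpleD_label_fixed x (by omega) (by omega) (by omega)]
        exact hv.done j h1 h4 h3
      · rw [h4, northVal_succ_of_not hq, ← hsnd, ← hsf]
        rw [x.rootPair_label]
        by_cases h5 : x.1.2 = x.1.1 + 1
        · simp only [if_pos h5]
          have e : ((x.1.2 : ℕ) : ℤ) - x.1.1 = 1 := by omega
          rw [e]
          unfold rowSign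
          split_ifs
          · rw [simpleD_neg x.label_mem, hv.odd]; ring
          · rw [one_mul]
        · simp only [if_neg h5, one_mul]
  · simp only [Bool.not_true, Bool.false_eq_true, if_false]
    refine ⟨hv.odd, fun j h1 h2 h3 => hv.north j (by omega) h2 h3, fun h => ?_,
      fun j h1 h2 h3 => ?_⟩
    · rw [if_neg (by omega), one_mul, eastVal_succ_of_plus hq, max_eq_left (by omega),
        ← hv.north x.1.2 le_rfl hx.2.1 hx.2.2]
      congr 1
      push_cast
      ring
    · rcases (Nat.lt_succ_iff.1 h2).lt_or_eq with h4 | h4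
      · exact hv.done j h1 h4 h3
      · have := hv.east (by omega)
        rw [max_eq_left (by omega)] at this
        rw [h4, northVal_succ_of_plus hq, this]
        by_cases h5 : x.1.2 = x.1.1 + 1
        · rw [if_pos h5, if_pos h5.le]
        · rw [if_neg h5, if_neg (by omega)]

lemma PrefixState.skip (hq : InStaircase n q) {a b : ℕ} {v : Equiv.Perm ℤ} (hb : b ≤ a)
    (hv : PrefixState n q t a b v) : PrefixState n q t a (b + 1) v := by
  refine ⟨hv.odd, fun j _ h2 h3 => hv.north j (by omega) h2 h3, fun h => ?_,
    fun j h1 h2 _ => by omega⟩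
  have := hv.east (by omega)
  rw [max_eq_right (by omega), if_pos (by omega)] at this ⊢
  rw [this, eastVal_of_le hq a b (by omega), eastVal_of_le hq a (b + 1) (by omega)]

lemma PrefixState.nextRow (ht : ∀ x, t (-x) = -t x) (hq : InStaircase n q) {a : ℕ}
    {v : Equiv.Perm ℤ} (hv : PrefixState n q t a (n + 1) v) :
    PrefixState n q t (a + 1) 1 v := by
  refine ⟨hv.odd, fun j _ h2 h3 => ?_, fun h => ?_, fun j h1 h2 _ => by omega⟩
  · have := hv.done j (by omega) (by omega) h3
    rw [if_neg (by omega), one_mul] at this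
    rw [← this]
    congr 1
    push_cast
    ring
  · have := hv.done (a + 1) (by omega) (by omega) (by omega)
    rw [if_pos rfl] at this
    rw [max_eq_right (by omega), if_pos (by omega), rowSign_succ (by omega),
      eastVal_of_le hq _ _ (by omega), ht, neg_mul_neg, ← this]
    congr 1
    push_cast
    ring

lemma PrefixState.ascent_iff
    (hlt : ∀ x y : ℤ, x.natAbs ≠ y.natAbs → x ≠ 0 → y ≠ 0 → (t x < t y ↔ x < y))
    (hq : InStaircase n q) {x : Box n} {v : Equiv.Perm ℤ}
    (hv : PrefixState n q t x.1.1 x.1.2 v) :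
    IsAscent n v x.label ↔ eastVal q x.1.1 x.1.2 < northVal q x.1.1 x.1.2 := by
  have hx := x.2
  unfold IsAscent
  rw [hv.fst, hv.snd]
  apply hlt
  · exact eastVal_ne_northVal hq hx.1 hx.2.1 le_rfl hx.2.2
  · have := eastVal_bound hq hx.1 hx.2.1
    omega
  · have := northVal_bound hq x.1.1 x.1.2 hx.2.1.le (by omega)
    omega

/-- The boxes of row `a` in the columns listed in `l`. -/
def rowBoxes (n a : ℕ) (l : List ℕ) : List (Box n) :=
  l.filterMap fun b => if h : 1 ≤ a ∧ a < b ∧ b ≤ n then some ⟨(a, b), h⟩ else none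

/-- Reading the boxes of row `a` from column `b` on: the ascent conditions compare exit values, and
the boundary state is carried to the end of the row. -/
lemma ascentsFrom_row
    (hlt : ∀ x y : ℤ, x.natAbs ≠ y.natAbs → x ≠ 0 → y ≠ 0 → (t x < t y ↔ x < y))
    (hq : InStaircase n q) {a : ℕ} (ha : 1 ≤ a) : ∀ (k b : ℕ) (v : Equiv.Perm ℤ),
    b + k = n + 1 → PrefixState n q t a b v →
    ∃ v', PrefixState n q t a (n + 1) v' ∧ ∀ rest,
      (AscentsFrom n v (((rowBoxes n a (List.range' b k)).map fun x =>
          (x.label, !q x.1.1 x.1.2)) ++ rest) ↔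
        (∀ c, a < c → b ≤ c → c ≤ n → eastVal q a c < northVal q a c) ∧
          AscentsFrom n v' rest) := by
  intro k
  induction k with
  | zero =>
    intro b v hb hv
    obtain rfl : b = n + 1 := by omega
    refine ⟨v, hv, fun rest => ?_⟩
    simp only [rowBoxes, List.range'_zero, List.filterMap_nil, List.map_nil, List.nil_append]
    exact ⟨fun h => ⟨fun c _ _ _ => by omega, h⟩, fun h => h.2⟩
  | succ k ih =>
    intro b v hb hv
    by_cases hab : a < b
    · have hbox : 1 ≤ a ∧ a < b ∧ b ≤ n := ⟨ha, hab, by omega⟩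
      have hv0 : PrefixState n q t (⟨(a, b), hbox⟩ : Box n).1.1 (⟨(a, b), hbox⟩ : Box n).1.2 v :=
        hv
      obtain ⟨v', h1, h2⟩ := ih (b + 1) _ (by omega) (hv0.step)
      refine ⟨v', h1, fun rest => ?_⟩
      have e : rowBoxes n a (List.range' b (k + 1)) =
          ⟨(a, b), hbox⟩ :: rowBoxes n a (List.range' (b + 1) k) := by
        rw [rowBoxes, List.range'_succ, List.filterMap_cons, dif_pos hbox]
        rfl
      rw [e, List.map_cons, List.cons_append, AscentsFrom]
      rw [hv0.ascent_iff hlt hq, h2 rest, ← and_assoc]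
      refine and_congr_left fun _ => ?_
      constructor
      · rintro ⟨h3, h4⟩ c h5 h6 h7
        rcases h6.lt_or_eq with h6 | rfl
        · exact h4 c h5 h6 h7
        · exact h3
      · intro h3
        exact ⟨h3 b hab le_rfl (by omega), fun c h4 h5 h6 => h3 c h4 (by omega) h6⟩
    · obtain ⟨v', h1, h2⟩ := ih (b + 1) v (by omega) (hv.skip hq (by omega))
      refine ⟨v', h1, fun rest => ?_⟩
      have e : rowBoxes n a (List.range' b (k + 1)) = rowBoxes n a (List.range' (b + 1) k) := by
        rw [rowBoxes, List.range'_succ, List.filterMap_cons, dif_neg (by omega)]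
        rfl
      rw [e, h2 rest]
      refine and_congr_left fun _ => ?_
      exact ⟨fun h c h4 h5 h6 => h c h4 (by omega) h6, fun h c h4 h5 h6 => h c h4 (by omega) h6⟩

lemma ascentsFrom_rows (ht : ∀ x, t (-x) = -t x)
    (hlt : ∀ x y : ℤ, x.natAbs ≠ y.natAbs → x ≠ 0 → y ≠ 0 → (t x < t y ↔ x < y))
    (hq : InStaircase n q) : ∀ (k a : ℕ) (v : Equiv.Perm ℤ), 1 ≤ a → a + k = n + 1 →
    PrefixState n q t a 1 v →
    (AscentsFrom n v (((List.range' a k).flatMap fun a =>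
        rowBoxes n a (List.range' 1 n)).map fun x => (x.label, !q x.1.1 x.1.2)) ↔
      ∀ r c, a ≤ r → r < c → c ≤ n → eastVal q r c < northVal q r c) := by
  intro k
  induction k with
  | zero =>
    intro a v ha hk _
    simp only [List.range'_zero, List.flatMap_nil, List.map_nil, AscentsFrom, true_iff]
    intros
    omega
  | succ k ih =>
    intro a v ha hk hv
    obtain ⟨v', h1, h2⟩ := ascentsFrom_row hlt hq ha n 1 v (by omega) hv
    rw [List.range'_succ, List.flatMap_cons, List.map_append, h2,
      ih (a + 1) v' (by omega) (by omega) (h1.nextRow ht hq)]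
    constructor
    · rintro ⟨h3, h4⟩ r c h5 h6 h7
      rcases h5.lt_or_eq with h5 | rfl
      · exact h4 r c h5 h6 h7
      · exact h3 c h6 (by omega) h7
    · intro h
      exact ⟨fun c h3 _ h5 => h a c le_rfl h3 h5, fun r c h3 h4 h5 => h r c (by omega) h4 h5⟩

/-- The positive distinguished condition compares, at every box, the exit values of the two wires
that pass through its east and north edges. -/
lemma mem_leDiagrams_iff (D : Diagram n) : D ∈ leDiagrams n ↔ IsLe n D.plus := by
  -- the identity sends `1` to `1`, whereas the first row starts with the exit value `-1`; changing
  -- the sign of `±1` does not affect comparisons of values with distinct absolute values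
  set t : ℤ → ℤ := fun x => if x.natAbs = 1 then -rowSign n 1 * x else x with htdef
  have hs : rowSign n 1 = 1 ∨ rowSign n 1 = -1 := by unfold rowSign; split_ifs <;> simp
  have ht : ∀ x, t (-x) = -t x := by
    intro x
    simp only [htdef, Int.natAbs_neg]
    split_ifs <;> ring
  have hlt : ∀ x y : ℤ, x.natAbs ≠ y.natAbs → x ≠ 0 → y ≠ 0 → (t x < t y ↔ x < y) := by
    intro x y h1 h2 h3
    simp only [htdef]
    rcases hs with h | h <;> rw [h] <;> split_ifs <;> omega
  have h0 : PrefixState n D.plus t 1 1 1 := by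
    refine ⟨fun x => rfl, fun j h1 h2 h3 => ?_, fun h => ?_, fun j h1 h2 _ => by omega⟩
    · rw [northVal_one D.plus_inStaircase]
      simp only [htdef]
      rw [if_neg (by omega)]
      simp
    · rw [eastVal_of_le D.plus_inStaircase _ _ (by omega), northVal_one D.plus_inStaircase]
      simp only [htdef]
      have := rowSign_mul_self (n := n) 1
      simp [this]
  have hlist : D.subexpr = ((List.range' 1 n).flatMap fun a =>
      rowBoxes n a (List.range' 1 n)).map fun x => (x.label, !D.plus x.1.1 x.1.2) := by
    unfold Diagram.subexpr boxList rowBoxes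
    simp only [Diagram.plus_apply]
  have h1 : ∀ p ∈ D.subexpr, 1 ≤ p.1 ∧ p.1 ≤ n := by
    intro p hp
    obtain ⟨x, _, rfl⟩ := List.mem_map.1 hp
    exact x.label_mem
  have h2 := ascentsFrom_rows ht hlt D.plus_inStaircase n 1 1 le_rfl (by omega) h0
  rw [← hlist] at h2
  exact (isPDS_iff_ascentsFrom h1).trans h2

end Tracking

/-! ### Following a wire through a Le-diagram -/

/-- The wire that leaves through column `i` passes through the north or the east edge of box
`(a, b)`. -/
def Visits (q : ℕ → ℕ → Bool) (i a b : ℕ) : Prop :=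
  (northVal q a b).natAbs = i ∨ (eastVal q a b).natAbs = i

/-- One of the two wires in box `(a, b)` leaves through a column with label at least `m`. -/
def VisitedFrom (q : ℕ → ℕ → Bool) (m a b : ℕ) : Prop :=
  m ≤ (northVal q a b).natAbs ∨ m ≤ (eastVal q a b).natAbs

instance (q : ℕ → ℕ → Bool) (m a b : ℕ) : Decidable (VisitedFrom q m a b) := by
  unfold VisitedFrom; infer_instance

/-- The part of the staircase that is visited by the wires with labels at least `m`. -/
def partialFilling (n : ℕ) (q : ℕ → ℕ → Bool) (m : ℕ) : Filling := fun a b =>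
  if (1 ≤ a ∧ a < b ∧ b ≤ n) ∧ VisitedFrom q m a b then some (q a b) else none

section Wires

variable {n : ℕ} {q : ℕ → ℕ → Bool} {i : ℕ}

lemma eastVal_eq_of_forall {a b c : ℕ} (hbc : b ≤ c)
    (h : ∀ d, b ≤ d → d < c → q a d = false) : eastVal q a c = eastVal q a b := by
  induction c, hbc using Nat.le_induction with
  | base => rfl
  | succ c hbc ih =>
    rw [eastVal_succ_of_not (h c hbc (by omega)), ih fun d h1 h2 => h d h1 (by omega)]

lemma forall_or_exists_first (q : ℕ → ℕ → Bool) (a b : ℕ) : (∀ c, b ≤ c → q a c = false) ∨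
    ∃ c, b ≤ c ∧ q a c = true ∧ ∀ d, b ≤ d → d < c → q a d = false := by
  by_cases h : ∃ c, b ≤ c ∧ q a c = true
  · right
    refine ⟨Nat.find h, (Nat.find_spec h).1, (Nat.find_spec h).2, fun d h1 h2 => ?_⟩
    have := Nat.find_min h h2
    simpa [h1] using this
  · left
    intro c hc
    by_contra h1
    exact h ⟨c, hc, by simpa using h1⟩

/-- A wire going straight through row `r` in column `b` meets no `+` in that row. -/
lemma not_visits_of_straight (hq : InStaircase n q) {r b : ℕ} (hr : 1 ≤ r) (hrb : r < b)
    (hb : b ≤ n) (hN : northVal q r b = i) (hqb : q r b = false) {c : ℕ} (hqc : q r c = true) :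
    ¬ Visits q i r c := by
  have hc := hq r c hqc
  have hNi : (northVal q r b).natAbs = i := by omega
  have hcb : c ≠ b := by rintro rfl; rw [hqb] at hqc; exact absurd hqc (by simp)
  rintro (h | h)
  · exact hcb (northVal_inj hq hr (by omega) (by omega) hc.2.2 hb (h.trans hNi.symm))
  · rcases Nat.lt_or_ge b c with h1 | h1
    · have := eastVal_ne_northVal_succ hq hr hrb h1 (by omega)
      rw [northVal_succ_of_not hqb] at this
      exact this (h.trans hNi.symm)
    · exact eastVal_ne_northVal hq hr hc.2.1 h1 hb (h.trans hNi.symm)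

/-- A wire does not visit the rows below the one in which it enters from the west. -/
lemma not_visits_of_lt (hq : InStaircase n q) {s : ℕ} (hs : 1 ≤ s)
    (hE : (eastVal q s (n + 1)).natAbs = i) {r c : ℕ} (hsr : s < r) (hqc : q r c = true) :
    ¬ Visits q i r c := by
  have hc := hq r c hqc
  rintro (h | h)
  · exact eastVal_end_ne_northVal hq hs hsr hc.2.1.le hc.2.2 (hE.trans h.symm)
  · exact eastVal_end_ne_eastVal hq hs hsr hc.2.1 (by omega) (hE.trans h.symm)

/-- The row in which a wire enters from the west is not above any row it passes heading north. -/
lemma le_of_northVal_eq (hq : InStaircase n q) {s : ℕ} (hs : 1 ≤ s)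
    (hE : (eastVal q s (n + 1)).natAbs = i) {r b : ℕ} (hrb : r ≤ b) (hb : b ≤ n)
    (hN : (northVal q r b).natAbs = i) : r ≤ s := by
  by_contra h
  exact eastVal_end_ne_northVal hq hs (not_le.1 h) hrb hb (hE.trans hN.symm)

/-- Once all remaining wires have labels at least `i`, every remaining box is visited by a wire with
a label greater than `i`. -/
lemma visitedFrom_succ_of_forall (hq : InStaircase n q) {b : ℕ} (hb : 1 ≤ b)
    (h : ∀ c, b ≤ c → c ≤ n → i ≤ (northVal q b c).natAbs) {r c : ℕ} (hbr : b ≤ r) (hrc : r < c)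
    (hc : c ≤ n) : VisitedFrom q (i + 1) r c := by
  have hE : ∀ r, (∀ c, r ≤ c → c ≤ n → i ≤ (northVal q r c).natAbs) → ∀ c, r < c → c ≤ n →
      i ≤ (eastVal q r c).natAbs := by
    intro r hr c h1 h2
    rcases eastVal_eq_or hq r c with h3 | ⟨d, h3, h4, _, h5⟩
    · rw [h3, Int.natAbs_neg]
      exact hr r le_rfl (by omega)
    · rw [h5]
      exact hr d h3.le (by omega)
  have hN : ∀ c, r ≤ c → c ≤ n → i ≤ (northVal q r c).natAbs := by
    induction r, hbr using Nat.le_induction generalizing c with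
    | base => exact h
    | succ r hbr ih =>
      intro c h1 h2
      have ih' := ih (c := c) (by omega) h2
      rw [northVal_succ]
      split_ifs
      · exact hE r ih' c (by omega) h2
      · exact ih' c (by omega) h2
  have h1 := hN c hrc.le hc
  have h2 := hE r hN c hrc hc
  have h3 := eastVal_ne_northVal hq (hb.trans hbr) hrc le_rfl hc
  unfold VisitedFrom
  omega

/-- After its passage through a diagonal box a wire meets only `+`s lying on wires with greater
labels. -/
lemma visitedFrom_succ_of_neg (hq : InStaircase n q) (hLe : IsLe n q) {r g : ℕ} (hi : 1 ≤ i)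
    (hr : 1 ≤ r) (hrg : r ≤ g) (hg : g ≤ n) (hN : northVal q r g = -i) {s c : ℕ} (hrs : r ≤ s)
    (hqc : q s c = true) (hv : Visits q i s c) : VisitedFrom q (i + 1) s c := by
  have hc := hq s c hqc
  induction hrg using Nat.decreasingInduction with
  | self =>
    refine visitedFrom_succ_of_forall hq hr (fun d h1 h2 => ?_) hrs hc.2.1 hc.2.2
    rcases h1.lt_or_eq with h1 | rfl
    · have := lt_of_neg hq hLe hr le_rfl hg (by omega) h1.le h2 h1.ne'
      omega
    · omega
  | of_succ r hrg ih =>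
    have hNi : (northVal q r g).natAbs = i := by omega
    cases hqg : q r g
    · rcases hrs.lt_or_eq with h1 | rfl
      · exact ih (by omega) (by rw [northVal_succ_of_not hqg, hN]) h1
      · exfalso
        rcases lt_trichotomy c g with h1 | rfl | h1
        · rcases hv with hv | hv
          · exact h1.ne (northVal_inj hq hr hc.2.1.le hrg.le hc.2.2 hg (hv.trans hNi.symm))
          · exact eastVal_ne_northVal hq hr hc.2.1 h1.le hg (hv.trans hNi.symm)
        · rw [hqg] at hqc; exact absurd hqc (by simp)
        · rcases hv with hv | hv
          · exact h1.ne' (northVal_inj hq hr hc.2.1.le hrg.le hc.2.2 hg (hv.trans hNi.symm))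
          · have := eastVal_ne_northVal_succ hq hr hrg h1 (by omega)
            rw [northVal_succ_of_not hqg] at this
            exact this (hv.trans hNi.symm)
    · have hlt := hLe r g hr hrg hg
      rcases hrs.lt_or_eq with h1 | rfl
      · exfalso
        have hE : ∀ d, g + 1 ≤ d → d ≤ n + 1 → eastVal q r d = -i := by
          intro d hd
          induction d, hd using Nat.le_induction with
          | base => intro _; rw [eastVal_succ_of_plus hqg, hN]
          | succ d hd ihd =>
            intro hdn
            have h2 := ihd (by omega)
            cases hqd : q r d
            · rw [eastVal_succ_of_not hqd, h2]
            · have h3 := lt_of_neg hq hLe (r := r + 1) (g := g) (b := d) (by omega) (by omega) hg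
                (by rw [northVal_succ_of_plus hqg]; omega) (by omega) (by omega) (by omega)
              rw [northVal_succ_of_plus hqg, northVal_succ_of_plus hqd, h2] at h3
              omega
        exact not_visits_of_lt hq hr (by rw [hE (n + 1) (by omega) le_rfl]; omega) h1 hqc hv
      · rcases lt_trichotomy c g with h1 | rfl | h1
        · exfalso
          rcases hv with hv | hv
          · exact h1.ne (northVal_inj hq hr hc.2.1.le hrg.le hc.2.2 hg (hv.trans hNi.symm))
          · exact eastVal_ne_northVal hq hr hc.2.1 h1.le hg (hv.trans hNi.symm)
        · right; omega
        · left
          have := lt_of_neg hq hLe hr hrg.le hg (by omega) (b := c) (by omega) hc.2.2 h1.ne'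
          omega

/-- A wire that starts a row to the left of column `b`, heading north there, is still to the left of
column `b` in every row down to the one in which it enters. -/
lemma exists_northVal_eq (hq : InStaircase n q) {s b : ℕ}
    (hE : (eastVal q s (n + 1)).natAbs = i) (hsn : s ≤ n) {r : ℕ} (hr : 1 ≤ r)
    (h : ∃ c, b < c ∧ c ≤ n ∧ northVal q r c = i) {u : ℕ} (hru : r ≤ u) (hus : u ≤ s)
    (hub : u ≤ b) : ∃ c, b < c ∧ c ≤ n ∧ northVal q u c = i := by
  induction u, hru using Nat.le_induction with
  | base => exact h
  | succ u hru ih =>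
    obtain ⟨c, h1, h2, h3⟩ := ih (by omega) (by omega)
    cases hqc : q u c
    · exact ⟨c, h1, h2, by rw [northVal_succ_of_not hqc, h3]⟩
    · rcases forall_or_exists_first q u (c + 1) with h4 | ⟨d, h4, h5, h6⟩
      · exfalso
        have h7 : eastVal q u (n + 1) = i := by
          rw [eastVal_eq_of_forall (by omega : c + 1 ≤ n + 1) fun d h8 _ => h4 d h8,
            eastVal_succ_of_plus hqc, h3]
        have := eastVal_end_inj hq (Set.mem_Icc.2 ⟨by omega, by omega⟩ : u ∈ Set.Icc 1 n)
          (Set.mem_Icc.2 ⟨by omega, hsn⟩ : s ∈ Set.Icc 1 n) (by omega)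
        omega
      · refine ⟨d, by omega, (hq u d h5).2.2, ?_⟩
        rw [northVal_succ_of_plus h5, eastVal_eq_of_forall h4 h6, eastVal_succ_of_plus hqc, h3]

/-- A wire that goes straight through row `s` and has a smaller wire to its left goes straight on to
the diagonal, since a `+` in its column would require it to be smaller than all wires to its left.
-/
lemma straight_of_lt (hq : InStaircase n q) (hLe : IsLe n q) {s b b' : ℕ} (hbb' : b < b')
    (hb' : b' ≤ n) (hN : northVal q s b = i) (hlt : northVal q (s + 1) b' < i)
    (hqs : q s b = false) {r : ℕ} (hsr : s < r) (hrb : r ≤ b) :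
    northVal q r b = i ∧ northVal q r b' < i := by
  induction r, hsr using Nat.le_induction with
  | base => exact ⟨by rw [northVal_succ_of_not hqs, hN], hlt⟩
  | succ r hsr ih =>
    obtain ⟨h1, h2⟩ := ih (by omega)
    have h3 := northVal_succ_le hq hLe r b'
    refine ⟨?_, by omega⟩
    cases hqr : q r b
    · rw [northVal_succ_of_not hqr, h1]
    · have := lt_of_plus hq hLe hqr hbb' hb'
      omega

/-- A wire that reaches the diagonal box `(b, b)` while some wire to its left is smaller, and that
does not enter in row `b`, turns at the column of that smaller wire, and nowhere else in row `b`. -/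
lemma row_of_diag (hq : InStaircase n q) (hLe : IsLe n q) {s b b' : ℕ} (hi : 1 ≤ i)
    (hb : 1 ≤ b) (hbb' : b < b') (hb' : b' ≤ n) (hN : northVal q b b = i)
    (hlt : northVal q b b' < i) (hE : (eastVal q s (n + 1)).natAbs = i) (hsb : s ≠ b)
    (hs : s ∈ Set.Icc 1 n) :
    q b b' = true ∧ northVal q (b + 1) b' = -i ∧
      (∀ c, c ≠ b' → q b c = false) ∧ ∀ c, b < c → c ≤ n → c ≠ b' → (i : ℤ) < northVal q b c := by
  have hdiag := eastVal_diag hq b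
  rcases forall_or_exists_first q b (b + 1) with h4 | ⟨g, h4, h5, h6⟩
  · exfalso
    have h7 : eastVal q b (n + 1) = -i := by
      rw [eastVal_eq_of_forall (by omega : b + 1 ≤ n + 1) fun d h8 _ => h4 d h8, hdiag, hN]
    exact hsb (eastVal_end_inj hq hs (Set.mem_Icc.2 ⟨hb, by omega⟩) (by omega))
  · have hg := hq b g h5
    have hNg : northVal q (b + 1) g = -i := by
      rw [northVal_succ_of_plus h5, eastVal_eq_of_forall h4 h6, hdiag, hN]
    have hM : ∀ c, b < c → c ≤ n → c ≠ g → (i : ℤ) < northVal q (b + 1) c := by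
      intro c h1 h2 h3
      have := lt_of_neg hq hLe (r := b + 1) (g := g) (b := c) (by omega) h4 hg.2.2 (by omega)
        h1 h2 h3
      omega
    have hM' : ∀ c, b < c → c ≤ n → c ≠ g → (i : ℤ) < northVal q b c := by
      intro c h1 h2 h3
      have := hM c h1 h2 h3
      have := northVal_succ_le hq hLe b c
      omega
    obtain rfl : b' = g := by
      by_contra hne
      have := hM' b' hbb' hb' hne
      omega
    refine ⟨h5, hNg, fun c hc => ?_, hM'⟩
    have hright : ∀ c, b' + 1 ≤ c →
        eastVal q b c = northVal q b b' ∧ (b' < c - 1 → q b (c - 1) = false) := by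
      intro c hc
      induction c, hc using Nat.le_induction with
      | base => exact ⟨eastVal_succ_of_plus h5, fun h => by omega⟩
      | succ c hc ih =>
        cases hqc : q b c
        · exact ⟨by rw [eastVal_succ_of_not hqc, ih.1], fun _ => hqc⟩
        · have h7 := hM c (by omega) (hq b c hqc).2.2 (by omega)
          rw [northVal_succ_of_plus hqc, ih.1] at h7
          omega
    rcases lt_or_gt_of_ne hc with h7 | h7
    · rcases Nat.lt_or_ge b c with h8 | h8
      · exact h6 c h8 h7
      · exact hq.eq_false (by omega)
    · exact (hright (c + 1) (by omega)).2 h7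

end Wires

/-! ### The new `+`s of a path -/

section NewPluses

variable {n : ℕ} {q : ℕ → ℕ → Bool} {i : ℕ}

lemma partialFilling_eq_true (hq : InStaircase n q) {m a b : ℕ} :
    partialFilling n q m a b = some true ↔ q a b = true ∧ VisitedFrom q m a b := by
  unfold partialFilling
  constructor
  · intro h
    split_ifs at h with h1
    exact ⟨by simpa using h, h1.2⟩
  · rintro ⟨h1, h2⟩
    rw [if_pos ⟨hq a b h1, h2⟩, h1]

lemma visitedFrom_of_rowComplete (hq : InStaircase n q) {m a b : ℕ}
    (h : (partialFilling n q m).RowComplete n a) (hqb : q a b = true) : VisitedFrom q m a b := by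
  have hb := hq a b hqb
  have := h b (Finset.mem_Ioc.2 hb.2)
  unfold partialFilling at this
  by_contra hc
  rw [if_neg (by tauto)] at this
  exact this rfl

lemma cStar_eq_none {D : Filling} {a b : ℕ} (h : D.cStar n a b = none) {r c : ℕ} (har : a < r)
    (hrb : r < b) (hrc : r < c) (hc : c ≤ n) : D r c ≠ some true := by
  intro hD
  unfold Filling.cStar at h
  rw [Option.bind_eq_none_iff] at h
  rcases hf : (List.range' (a + 1) (b - a - 1)).find? fun a' =>
      decide (∃ c ∈ Finset.Ioc a' n, D a' c = some true) with _ | a'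
  · rw [List.find?_range'_eq_none] at hf
    have := hf r (by omega) (by omega)
    simp only [Bool.not_eq_true', decide_eq_false_iff_not] at this
    exact this ⟨c, Finset.mem_Ioc.2 ⟨hrc, hc⟩, hD⟩
  · have h1 := h a' hf
    have h2 := (List.find?_range'_eq_some.1 hf).1
    simp only [decide_eq_true_eq] at h2
    obtain ⟨d, hd, hD'⟩ := h2
    rw [Option.map_eq_none_iff, List.find?_range'_eq_none] at h1
    have := h1 d (by have := (Finset.mem_Ioc.1 hd).1; omega)
      (by have := Finset.mem_Ioc.1 hd; omega)
    simp [hD'] at this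

lemma cStar_eq_some {D : Filling} {a b a' b' : ℕ} (h : D.cStar n a b = some (a', b')) :
    a < a' ∧ a' < b ∧ a' < b' ∧ b' ≤ n ∧ D a' b' = some true ∧
      (∀ r c, a < r → r < a' → r < c → c ≤ n → D r c ≠ some true) ∧
      ∀ c, a' < c → c < b' → D a' c ≠ some true := by
  unfold Filling.cStar at h
  rw [Option.bind_eq_some_iff] at h
  obtain ⟨a'', h1, h2⟩ := h
  rw [Option.map_eq_some_iff] at h2
  obtain ⟨b'', h2, h3⟩ := h2
  obtain ⟨rfl, rfl⟩ := Prod.mk.inj h3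
  rw [List.find?_range'_eq_some] at h1 h2
  obtain ⟨_, h1m, h1b⟩ := h1
  obtain ⟨h2a, h2m, h2b⟩ := h2
  rw [List.mem_range'_1] at h1m h2m
  refine ⟨by omega, by omega, by omega, by omega, by simpa using h2a, ?_, ?_⟩
  · intro r c h4 h5 h6 h7 h8
    have := h1b r (by omega) h5
    simp only [Bool.not_eq_true', decide_eq_false_iff_not] at this
    exact this ⟨c, Finset.mem_Ioc.2 ⟨h6, h7⟩, h8⟩
  · intro c h4 h5 h6
    have := h2b c (by omega) h5
    simp [h6] at this

/-- As long as no row contains a `+` placed before, and the wire does not enter, it goes straight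
and all values to its left stay larger. -/
lemma straight_of_no_plus (hq : InStaircase n q) {s a b : ℕ} (hs : s ∈ Set.Icc 1 n)
    (hE : (eastVal q s (n + 1)).natAbs = i)
    (hN : northVal q (a + 1) b = i) (hInv : ∀ c, b < c → c ≤ n → (i : ℤ) < northVal q (a + 1) c)
    {u : ℕ} (hau : a < u) (hus : u ≤ s) (hub : u ≤ b)
    (hno : ∀ r c, a < r → r < u → r < c → c ≤ n → partialFilling n q (i + 1) r c ≠ some true) :
    northVal q u b = i ∧ (∀ c, b < c → c ≤ n → (i : ℤ) < northVal q u c) ∧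
      ∀ r, a < r → r < u → northVal q r b = i ∧ q r b = false := by
  induction u, hau using Nat.le_induction with
  | base => exact ⟨hN, hInv, fun r _ _ => by omega⟩
  | succ u hau ih =>
    obtain ⟨h1, h2, h3⟩ := ih (by omega) (by omega) fun r c h4 h5 => hno r c h4 (by omega)
    have hqu : ∀ c, b < c → q u c = false := by
      intro c hc
      by_contra hqc
      have hqc' : q u c = true := by simpa using hqc
      have hcn := (hq u c hqc').2.2
      refine hno u c hau (by omega) (by omega) hcn ((partialFilling_eq_true hq).2 ⟨hqc', Or.inl ?_⟩)
      have := h2 c hc hcn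
      omega
    have hqb : q u b = false := by
      by_contra hqb
      have hqb' : q u b = true := by simpa using hqb
      have hE' : eastVal q u (n + 1) = i := by
        rw [eastVal_eq_of_forall (by have := (hq u b hqb').2.2; omega : b + 1 ≤ n + 1)
          fun d h _ => hqu d h, eastVal_succ_of_plus hqb', h1]
      have := eastVal_end_inj hq (Set.mem_Icc.2 ⟨by omega, by have := hs.2; omega⟩ :
        u ∈ Set.Icc 1 n) hs (by omega)
      omega
    refine ⟨by rw [northVal_succ_of_not hqb, h1], fun c h4 h5 => ?_, fun r h4 h5 => ?_⟩
    · rw [northVal_succ_of_not (hqu c h4)]; exact h2 c h4 h5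
    · rcases (Nat.lt_succ_iff.1 h5).lt_or_eq with h6 | rfl
      · exact h3 r h4 h6
      · exact ⟨h1, hqb⟩

/-- What a list of new `+`s must satisfy: it accounts for all `+`s visited by the wire below row `a`
that are not visited by wires with greater labels, and it contains only `+`s visited by the wire. -/
def IsNewPluses (q : ℕ → ℕ → Bool) (i a : ℕ) (l : List (ℕ × ℕ)) : Prop :=
  (∀ r c, a < r → q r c = true → Visits q i r c → VisitedFrom q (i + 1) r c ∨ (r, c) ∈ l) ∧
    ∀ p ∈ l, q p.1 p.2 = true ∧ Visits q i p.1 p.2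

/-- The `+`s met by the wire in a row in which it comes from column `b`. -/
lemma visitedFrom_or_eq (hq : InStaircase n q) {u b : ℕ} (hu : 1 ≤ u) (hub : u ≤ b) (hb : b ≤ n)
    (hN : northVal q u b = i) (hInv : ∀ c, b < c → c ≤ n → (i : ℤ) < northVal q u c) {c : ℕ}
    (hqc : q u c = true) (hv : Visits q i u c) : VisitedFrom q (i + 1) u c ∨ c = b := by
  have hc := hq u c hqc
  rcases lt_trichotomy c b with h | h | h
  · exfalso
    rcases hv with hv | hv
    · exact h.ne (northVal_inj hq hu hc.2.1.le hub hc.2.2 hb (by omega))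
    · exact eastVal_ne_northVal hq hu hc.2.1 h.le hb (by omega)
  · exact Or.inr h
  · left; left
    have := hInv c h hc.2.2
    omega

/-- The wire enters in the row `s`, above all rows that contain a `+` placed before. -/
lemma isNewPluses_of_enter (hq : InStaircase n q) {s a b : ℕ} (hs : s ∈ Set.Icc 1 n)
    (hE : (eastVal q s (n + 1)).natAbs = i) (hb : b ≤ n) (hab : a < b)
    (hN : northVal q (a + 1) b = i) (hInv : ∀ c, b < c → c ≤ n → (i : ℤ) < northVal q (a + 1) c)
    (hsb : s < b)
    (hno : ∀ r c, a < r → r < s → r < c → c ≤ n → partialFilling n q (i + 1) r c ≠ some true) :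
    q s b = true ∧ IsNewPluses q i a [(s, b)] := by
  have has : a < s := le_of_northVal_eq hq hs.1 hE (r := a + 1) hab hb (by omega)
  obtain ⟨h1, h2, h3⟩ := straight_of_no_plus hq hs hE hN hInv has le_rfl hsb.le hno
  have hqs : q s b = true := by
    by_contra hqs
    have hqs' : q s b = false := by simpa using hqs
    exact eastVal_end_ne_northVal hq hs.1 (Nat.lt_succ_self s) hsb hb
      (by rw [northVal_succ_of_not hqs']; omega)
  refine ⟨hqs, fun r c har hqc hv => ?_, ?_⟩
  · rcases lt_trichotomy r s with h | rfl | h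
    · obtain ⟨h4, h5⟩ := h3 r har h
      exact absurd hv (not_visits_of_straight hq (by omega) (by omega) hb h4 h5 hqc)
    · rcases visitedFrom_or_eq hq hs.1 hsb.le hb h1 h2 hqc hv with h | rfl
      · exact Or.inl h
      · exact Or.inr (List.mem_singleton.2 rfl)
    · exact absurd hv (not_visits_of_lt hq hs.1 hE h hqc)
  · intro p hp
    rw [List.mem_singleton.1 hp]
    exact ⟨hqs, Or.inl (by simp only; omega)⟩

/-- Either the wire enters in the row `a'` of `c*`, or `c*` lies to the left of the wire. -/
lemma lt_or_enters (hq : InStaircase n q) (hLe : IsLe n q) {a' b b' : ℕ} (ha' : 1 ≤ a')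
    (hab : a' < b) (hb : b ≤ n) (hN : northVal q a' b = i) (hqb' : q a' b' = true)
    (hold : VisitedFrom q (i + 1) a' b') : b < b' ∨ (b' = b ∧ eastVal q a' (n + 1) = i) := by
  rcases Nat.lt_or_ge b b' with h | h
  · exact Or.inl h
  right
  have hb' := hq a' b' hqb'
  have hEN := hLe a' b' hb'.1 hb'.2.1 hb'.2.2
  have hNi : northVal q a' b' ≤ i := by
    rcases h.lt_or_eq with h | rfl
    · have := lt_of_plus hq hLe hqb' h hb
      omega
    · omega
  have hneg : eastVal q a' b' ≤ -(i + 1 : ℤ) := by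
    rcases hold with h1 | h1 <;> omega
  have hM : ∀ c, a' < c → c ≤ n → c ≠ b' → (i + 1 : ℤ) < northVal q (a' + 1) c := by
    intro c h1 h2 h3
    have := lt_of_neg hq hLe (r := a' + 1) (g := b') (b := c) (by omega) hb'.2.1 hb'.2.2
      (by rw [northVal_succ_of_plus hqb']; omega) h1 h2 h3
    rw [northVal_succ_of_plus hqb'] at this
    omega
  have hbb : b' = b := by
    by_contra hne
    have h1 := hM b hab hb (Ne.symm hne)
    have h2 := northVal_succ_le hq hLe a' b
    omega
  subst hbb
  refine ⟨rfl, ?_⟩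
  have : ∀ c, b' + 1 ≤ c → eastVal q a' c = i := by
    intro c hc
    induction c, hc using Nat.le_induction with
    | base => rw [eastVal_succ_of_plus hqb', hN]
    | succ c hc ih =>
      cases hqc : q a' c
      · rw [eastVal_succ_of_not hqc, ih]
      · have h1 := hM c (by omega) (hq a' c hqc).2.2 (by omega)
        rw [northVal_succ_of_plus hqc, ih] at h1
        omega
  exact this _ (by omega)

/-- The rule for the new `+`s finds exactly the `+`s on the path of the wire that are not visited by
wires with greater labels. -/
lemma isNewPluses_newPluses (hq : InStaircase n q) (hLe : IsLe n q) {w : ℕ → ℤ} {s : ℕ}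
    (hi : 1 ≤ i) (hs : s ∈ Set.Icc 1 n) (hE : (eastVal q s (n + 1)).natAbs = i)
    (hw : ∀ j ∈ Set.Icc 1 n, w j ≠ 0 ∧ (0 < w j ↔ j < n ∧ ∀ c, j < c → c ≤ n → q j c = false)) :
    ∀ (fuel a b : ℕ), n ≤ fuel + a → a < b → b ≤ n → northVal q (a + 1) b = i →
      (∀ c, b < c → c ≤ n → (i : ℤ) < northVal q (a + 1) c) →
      IsNewPluses q i a (newPluses n w s (partialFilling n q (i + 1)) fuel a b) := by
  intro fuel
  induction fuel with
  | zero => intro a b h1 h2 h3; omega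
  | succ fuel ih =>
    intro a b hfuel hab hb hN hInv
    have hNi : (northVal q (a + 1) b).natAbs = i := by omega
    have has : a < s := le_of_northVal_eq hq hs.1 hE hab hb hNi
    rw [newPluses]
    by_cases hZ : ∀ r ∈ Finset.Ioc a n, (partialFilling n q (i + 1)).RowComplete n r
    · rw [if_pos hZ]
      refine ⟨fun r c har hqc _ => Or.inl ?_, by simp⟩
      have := hq r c hqc
      exact visitedFrom_of_rowComplete hq (hZ r (Finset.mem_Ioc.2 ⟨har, by omega⟩)) hqc
    rw [if_neg hZ]
    rcases hcs : (partialFilling n q (i + 1)).cStar n a b with _ | ⟨a', b'⟩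
    · have hno : ∀ r c, a < r → r < b → r < c → c ≤ n →
          partialFilling n q (i + 1) r c ≠ some true :=
        fun r c h1 h2 h3 h4 => cStar_eq_none hcs h1 h2 h3 h4
      simp only
      by_cases hbs : b ≤ s
      · rw [if_pos hbs]
        obtain ⟨h1, h2, h3⟩ := straight_of_no_plus hq hs hE hN hInv hab hbs le_rfl hno
        refine ⟨fun r c har hqc hv => Or.inl ?_, by simp⟩
        have hc := hq r c hqc
        rcases Nat.lt_or_ge r b with h | h
        · obtain ⟨h4, h5⟩ := h3 r har h
          exact absurd hv (not_visits_of_straight hq (by omega) h hb h4 h5 hqc)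
        · refine visitedFrom_succ_of_forall hq (by omega) (fun d h4 h5 => ?_) h hc.2.1 hc.2.2
          rcases h4.lt_or_eq with h4 | rfl
          · have := h2 d h4 h5
            omega
          · omega
      · rw [if_neg hbs]
        exact (isNewPluses_of_enter hq hs hE hb hab hN hInv (by omega)
          fun r c h1 h2 => hno r c h1 (by omega)).2
    · obtain ⟨haa', ha'b, ha'b', hb'n, hDc, hno, hnoc⟩ := cStar_eq_some hcs
      obtain ⟨hqc, hold⟩ := (partialFilling_eq_true hq).1 hDc
      simp only
      by_cases hsa : s < a'
      · rw [if_neg (by simp only [Prod.mk.injEq]; omega), if_neg (by omega), if_pos hsa]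
        exact (isNewPluses_of_enter hq hs hE hb hab hN hInv (by omega)
          fun r c h1 h2 => hno r c h1 (by omega)).2
      have ha's : a' ≤ s := not_lt.1 hsa
      obtain ⟨hN', hInv', hbefore⟩ :=
        straight_of_no_plus hq hs hE hN hInv haa' ha's ha'b.le hno
      have hrows : ∀ r c, a < r → r < a' → q r c = true → ¬ Visits q i r c := by
        intro r c h1 h2 h3
        obtain ⟨h4, h5⟩ := hbefore r h1 h2
        exact not_visits_of_straight hq (by omega) (by omega) hb h4 h5 h3
      have hrow : ∀ c, q a' c = true → Visits q i a' c → VisitedFrom q (i + 1) a' c ∨ c = b :=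
        fun c h1 h2 => visitedFrom_or_eq hq (by omega) ha'b.le hb hN' hInv' h1 h2
      by_cases hZ3 : (a', b') = (s, b)
      · rw [if_pos hZ3]
        obtain ⟨rfl, rfl⟩ := Prod.mk.inj hZ3
        refine ⟨fun r c har hqr hv => Or.inl ?_, by simp⟩
        rcases lt_trichotomy r a' with h | rfl | h
        · exact absurd hv (hrows r c har h hqr)
        · rcases hrow c hqr hv with h | rfl
          · exact h
          · exact hold
        · exact absurd hv (not_visits_of_lt hq hs.1 hE h hqr)
      rw [if_neg hZ3]
      by_cases hZ4 : a' < s ∧ ∀ r ∈ Finset.Icc a' n, (partialFilling n q (i + 1)).RowComplete n r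
      · rw [if_pos hZ4]
        refine ⟨fun r c har hqr hv => Or.inl ?_, by simp⟩
        rcases Nat.lt_or_ge r a' with h | h
        · exact absurd hv (hrows r c har h hqr)
        · have := hq r c hqr
          exact visitedFrom_of_rowComplete hq (hZ4.2 r (Finset.mem_Icc.2 ⟨h, by omega⟩)) hqr
      rw [if_neg hZ4, if_neg hsa]
      have hbb' : b < b' := by
        rcases lt_or_enters hq hLe (by omega) ha'b hb hN' hqc hold with h | ⟨h1, h2⟩
        · exact h
        · exfalso
          have h3 := eastVal_end_inj hq (Set.mem_Icc.2 ⟨by omega, by omega⟩ : a' ∈ Set.Icc 1 n) hs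
            (by omega)
          exact hZ3 (by rw [h1, h3])
      -- no `+` of row `a'` lies strictly between the columns `b` and `b'`
      have hgap : ∀ d, b + 1 ≤ d → d < b' → q a' d = false := by
        intro d h1 h2
        by_contra h3
        have h3' : q a' d = true := by simpa using h3
        have h4 := hInv' d h1 (by omega)
        exact hnoc d (by omega) h2 ((partialFilling_eq_true hq).2 ⟨h3', Or.inl (by omega)⟩)
      have hE' : q a' b = true → eastVal q a' b' = i := by
        intro h
        rw [eastVal_eq_of_forall hbb' hgap, eastVal_succ_of_plus h, hN']
      -- if the box `(a', b)` contains no `+`, then the path goes straight to the diagonal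
      have hdiag : q a' b = false → ∀ r, a' < r → r ≤ b →
          northVal q r b = i ∧ northVal q r b' < i := by
        intro h r h1 h2
        refine straight_of_lt hq hLe hbb' hb'n hN' ?_ h h1 h2
        rw [northVal_succ_of_plus hqc, eastVal_eq_of_forall hbb' hgap, eastVal_succ_of_not h]
        have := hLe a' b (by omega) ha'b hb
        omega
      have hstraight : q a' b = false → ∀ r c, a' ≤ r → r < b → q r c = true →
          ¬ Visits q i r c := by
        intro h r c h1 h2 h3
        have hNr : northVal q r b = i := by
          rcases h1.lt_or_eq with h1 | rfl
          · exact (hdiag h r h1 h2.le).1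
          · exact hN'
        have hNr' := (hdiag h (r + 1) (by omega) h2).1
        refine not_visits_of_straight hq (by omega) h2 hb hNr ?_ h3
        by_contra hqr
        have hqr' : q r b = true := by simpa using hqr
        have h4 := hLe r b (by omega) h2 hb
        rw [northVal_succ_of_plus hqr'] at hNr'
        omega
      have hbles : q a' b = false → b ≤ s := by
        intro h
        exact le_of_northVal_eq hq hs.1 hE le_rfl hb (by have := (hdiag h b ha'b le_rfl).1; omega)
      -- otherwise, it is still to the left of column `b` in row `b`
      have hleft : q a' b = true → b ≤ s → ∃ c, b < c ∧ c ≤ n ∧ northVal q b c = i := by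
        intro h h1
        refine exists_northVal_eq hq hE hs.2 (r := a' + 1) (by omega) ⟨b', hbb', hb'n, ?_⟩ ha'b
          h1 le_rfl
        rw [northVal_succ_of_plus hqc, hE' h]
      by_cases hB : s = b ∧ (0 < w s ∨ (partialFilling n q (i + 1)).RowZero n b)
      · rw [if_pos hB]
        obtain ⟨rfl, hB⟩ := hB
        have hzero : ∀ c, s < c → c ≤ n → q s c = false := by
          rcases hB with h | h
          · exact ((hw s hs).2.1 h).2
          · intro c h1 h2
            have := h c (Finset.mem_Ioc.2 ⟨h1, h2⟩)
            unfold partialFilling at this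
            split_ifs at this
            simpa using this
        have hqa : q a' s = false := by
          by_contra hqa
          obtain ⟨c, h1, h2, h3⟩ := hleft (by simpa using hqa) le_rfl
          have h4 : eastVal q s (n + 1) = -northVal q s s := by
            rw [eastVal_eq_of_forall (by omega : s + 1 ≤ n + 1)
              fun d h5 h6 => hzero d h5 (by omega), eastVal_diag hq]
          have := northVal_inj hq hs.1 le_rfl h1.le hs.2 h2 (by omega)
          omega
        refine ⟨fun r c har hqr hv => ?_, by simp⟩
        exfalso
        rcases Nat.lt_or_ge r a' with h | h
        · exact hrows r c har h hqr hv
        rcases lt_trichotomy r s with h1 | rfl | h1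
        · exact hstraight hqa r c h h1 hqr hv
        · have := hq r c hqr
          rw [hzero c this.2.1 this.2.2] at hqr
          exact absurd hqr (by simp)
        · exact not_visits_of_lt hq hs.1 hE h1 hqr hv
      rw [if_neg hB]
      have hrowb := fun (h : q a' b = false) (hsb : s ≠ b) =>
        row_of_diag hq hLe hi (by omega) hbb' hb'n (hdiag h b ha'b le_rfl).1
          (hdiag h b ha'b le_rfl).2 hE hsb hs
      by_cases hC : b < s ∧ w b < 0 ∧ (partialFilling n q (i + 1)).RowZeroExceptOne n b
      · rw [if_pos hC]
        obtain ⟨hbs, hwb, hR⟩ := hC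
        have hqa : q a' b = false := by
          by_contra hqa
          have hqa' : q a' b = true := by simpa using hqa
          obtain ⟨d, h1, h2, h3⟩ := hleft hqa' hbs.le
          have h4 : northVal q b b < i := by
            have h5 := northVal_antitone hq hLe b (show a' + 1 ≤ b from ha'b)
            rw [northVal_succ_of_plus hqa'] at h5
            have := hLe a' b (by omega) ha'b hb
            omega
          have h5 := hLe b d (by omega) h1 h2
          have h6 := eastVal_monotone hq hLe b (show b + 1 ≤ d from h1)
          rw [eastVal_diag hq] at h6
          have hnone : partialFilling n q (i + 1) b d ≠ some false := by
            unfold partialFilling VisitedFrom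
            rw [if_neg (by omega)]
            simp
          obtain ⟨e, he⟩ := Finset.card_eq_one.1 hR
          have hde : d = e := by
            rw [← Finset.mem_singleton, ← he, Finset.mem_filter, Finset.mem_Ioc]
            exact ⟨⟨h1, h2⟩, hnone⟩
          subst hde
          have honly : ∀ c, c ≠ d → q b c = false := by
            intro c hcd
            by_contra hqbc
            have hqbc' : q b c = true := by simpa using hqbc
            have hc := hq b c hqbc'
            apply hcd
            rw [← Finset.mem_singleton, ← he, Finset.mem_filter, Finset.mem_Ioc]
            refine ⟨hc.2, ?_⟩
            unfold partialFilling
            split_ifs <;> simp [hqbc']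
          have hqbd : q b d = true := by
            by_contra hqbd
            have h7 := (hw b (Set.mem_Icc.2 ⟨by omega, hb⟩)).2.2 ⟨by omega, fun c _ _ => by
              rcases eq_or_ne c d with rfl | h
              · simpa using hqbd
              · exact honly c h⟩
            omega
          have h7 : eastVal q b (n + 1) = i := by
            rw [eastVal_eq_of_forall (by omega : d + 1 ≤ n + 1)
              fun c h8 _ => honly c (by omega), eastVal_succ_of_plus hqbd, h3]
          have := eastVal_end_inj hq (Set.mem_Icc.2 ⟨by omega, hb⟩ : b ∈ Set.Icc 1 n) hs
            (by omega)
          omega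
        obtain ⟨h1, h2, h3, h4⟩ := hrowb hqa (by omega)
        have hNb := (hdiag hqa b ha'b le_rfl).1
        refine ⟨fun r c har hqr hv => ?_, ?_⟩
        · rcases Nat.lt_or_ge r a' with h | h
          · exact absurd hv (hrows r c har h hqr)
          rcases lt_trichotomy r b with h5 | rfl | h5
          · exact absurd hv (hstraight hqa r c h h5 hqr)
          · right
            rw [List.mem_singleton, Prod.mk.injEq]
            refine ⟨rfl, ?_⟩
            by_contra hcb
            rw [h3 c hcb] at hqr
            exact absurd hqr (by simp)
          · left
            exact visitedFrom_succ_of_neg hq hLe hi (by omega) (by omega : b + 1 ≤ b') hb'n h2 h5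
              hqr hv
        · intro p hp
          rw [List.mem_singleton.1 hp]
          refine ⟨h1, Or.inr ?_⟩
          rw [northVal_succ_of_plus h1] at h2
          simp only
          omega
      rw [if_neg hC]
      have hqa : q a' b = true := by
        by_contra hqa
        have hqa' : q a' b = false := by simpa using hqa
        have hbs := hbles hqa'
        have hbI : b ∈ Set.Icc 1 n := Set.mem_Icc.2 ⟨by omega, hb⟩
        rcases hbs.lt_or_eq with hbs | rfl
        · obtain ⟨h1, h2, h3, h4⟩ := hrowb hqa' (by omega)
          refine hC ⟨hbs, ?_, ?_⟩
          · have h5 := hw b hbI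
            by_contra h6
            have h7 := (h5.2.1 (by omega)).2 b' hbb' hb'n
            rw [h1] at h7
            exact absurd h7 (by simp)
          · refine Finset.card_eq_one.2 ⟨b', ?_⟩
            ext c
            rw [Finset.mem_filter, Finset.mem_Ioc, Finset.mem_singleton]
            constructor
            · rintro ⟨⟨h5, h6⟩, h7⟩
              by_contra hcb
              apply h7
              have := h4 c h5 h6 hcb
              unfold partialFilling
              rw [if_pos ⟨⟨by omega, h5, h6⟩, Or.inl (by omega)⟩, h3 c hcb]
            · rintro rfl
              refine ⟨⟨hbb', hb'n⟩, ?_⟩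
              unfold partialFilling
              split_ifs <;> simp [h1]
        · refine hB ⟨rfl, Or.inl ((hw b hbI).2.2 ⟨by omega, fun c h1 h2 => ?_⟩)⟩
          rcases forall_or_exists_first q b (b + 1) with h3 | ⟨g, h3, h4, h5⟩
          · exact h3 c h1
          · exfalso
            have hNb := (hdiag hqa' b ha'b le_rfl).1
            refine eastVal_end_ne_northVal hq (n := n) (j := b) (a := b + 1) (b := g) hbI.1
              (by omega) h3 (hq b g h4).2.2 ?_
            rw [hE, northVal_succ_of_plus h4, eastVal_eq_of_forall h3 h5, eastVal_diag hq]
            omega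
      obtain ⟨ih1, ih2⟩ := ih a' b' (by omega) ha'b' hb'n
        (by rw [northVal_succ_of_plus hqc, hE' hqa]) (by
          intro c h1 h2
          have h3 := hInv' c (by omega) h2
          cases hqac : q a' c
          · rwa [northVal_succ_of_not hqac]
          · rw [northVal_succ_of_plus hqac]
            have h4 := eastVal_monotone hq hLe a' (show b' + 1 ≤ c from h1)
            rw [eastVal_succ_of_plus hqc] at h4
            have := hInv' b' hbb' hb'n
            omega)
      refine ⟨fun r c har hqr hv => ?_, ?_⟩
      · rcases lt_trichotomy r a' with h | rfl | h
        · exact absurd hv (hrows r c har h hqr)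
        · rcases hrow c hqr hv with h | rfl
          · exact Or.inl h
          · exact Or.inr List.mem_cons_self
        · rcases ih1 r c h hqr hv with h1 | h1
          · exact Or.inl h1
          · exact Or.inr (List.mem_cons_of_mem _ h1)
      · intro p hp
        rcases List.mem_cons.1 hp with rfl | hp
        · exact ⟨hqa, Or.inl (by simp only; omega)⟩
        · exact ih2 p hp

end NewPluses

/-! ### Reconstruction of a Le-diagram from its wires -/

section Reconstruction

variable {n : ℕ} {q : ℕ → ℕ → Bool} {i : ℕ}

/-- The wire leaving through column `i` passes the north (`south = true`) or the east edge of box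
`(a, b)`, the direction being the one in which the wire is followed from its end. -/
def OnEdge (q : ℕ → ℕ → Bool) (i : ℕ) : Bool → ℕ → ℕ → Prop
  | true, a, b => 1 ≤ a ∧ a ≤ b ∧ (northVal q a b).natAbs = i
  | false, a, b => 1 ≤ a ∧ a < b ∧ (eastVal q a b).natAbs = i

/-- The direction, row and column reached after the box `(a, b)`. -/
def nextEdge (q : ℕ → ℕ → Bool) (south : Bool) (a b : ℕ) : Bool × ℕ × ℕ :=
  if (if a = b ∨ q a b = true then !south else south) then (true, a + 1, b) else (false, a, b + 1)

lemma OnEdge.visits {south : Bool} {a b : ℕ} (h : OnEdge q i south a b) :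
    1 ≤ a ∧ a ≤ b ∧ Visits q i a b := by
  cases south
  · exact ⟨h.1, h.2.1.le, Or.inr h.2.2⟩
  · exact ⟨h.1, h.2.1, Or.inl h.2.2⟩

lemma OnEdge.next (hq : InStaircase n q) {south : Bool} {a b : ℕ} (h : OnEdge q i south a b) :
    OnEdge q i (nextEdge q south a b).1 (nextEdge q south a b).2.1
      (nextEdge q south a b).2.2 := by
  unfold nextEdge
  cases south
  · obtain ⟨h1, h2, h3⟩ := h
    cases hqb : q a b
    · simp only [h2.ne, Bool.false_eq_true, or_self, if_false]
      exact ⟨h1, by omega, by rwa [eastVal_succ_of_not hqb]⟩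
    · simp only [or_true, if_true, Bool.not_false]
      exact ⟨by omega, by omega, by rwa [northVal_succ_of_plus hqb]⟩
  · obtain ⟨h1, h2, h3⟩ := h
    by_cases hab : a = b
    · subst hab
      simp only [true_or, if_true, Bool.not_true, Bool.false_eq_true, if_false]
      exact ⟨h1, by omega, by rwa [eastVal_diag hq, Int.natAbs_neg]⟩
    · cases hqb : q a b
      · simp only [hab, Bool.false_eq_true, or_self, if_false, if_true]
        exact ⟨by omega, by omega, by rwa [northVal_succ_of_not hqb]⟩
      · simp only [or_true, if_true, Bool.not_true, Bool.false_eq_true, if_false]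
        exact ⟨h1, by omega, by rwa [eastVal_succ_of_plus hqb]⟩

/-- The path follows the wire, as soon as the filling has the right `+`s in the boxes visited by the
wire. -/
lemma southWestPath_eq {D : Filling}
    (hD : ∀ r c, 1 ≤ r → r < c → c ≤ n → Visits q i r c → (D r c = some true ↔ q r c = true))
    {south : Bool} {a b : ℕ} (h : OnEdge q i south a b) (hb : b ≤ n) :
    D.southWestPath n south a b = (a, b) :: D.southWestPath n (nextEdge q south a b).1
      (nextEdge q south a b).2.1 (nextEdge q south a b).2.2 := by
  obtain ⟨h1, h2, h3⟩ := h.visits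
  rw [Filling.southWestPath, if_neg (by omega)]
  have he : D.IsElbow a b ↔ (a = b ∨ q a b = true) := by
    unfold Filling.IsElbow
    rcases h2.lt_or_eq with h2 | h2
    · rw [hD a b h1 h2 hb h3]
    · simp [h2]
  unfold nextEdge
  simp only [he]
  split_ifs <;> rfl

lemma mem_southWestPath (hq : InStaircase n q) {D : Filling}
    (hD : ∀ r c, 1 ≤ r → r < c → c ≤ n → Visits q i r c → (D r c = some true ↔ q r c = true)) :
    ∀ (m : ℕ) (south : Bool) (a b : ℕ), (n + 1 - a) + (n + 1 - b) ≤ m → OnEdge q i south a b →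
      ∀ p ∈ D.southWestPath n south a b, 1 ≤ p.1 ∧ p.1 ≤ p.2 ∧ p.2 ≤ n ∧ Visits q i p.1 p.2 := by
  intro m
  induction m with
  | zero =>
    intro south a b hm h p hp
    rw [Filling.southWestPath, if_pos (by omega)] at hp
    simp at hp
  | succ m ih =>
    intro south a b hm h p hp
    obtain ⟨h1, h2, h3⟩ := h.visits
    by_cases hb : b ≤ n
    · rw [southWestPath_eq hD h hb] at hp
      rcases List.mem_cons.1 hp with rfl | hp
      · exact ⟨h1, h2, hb, h3⟩
      · refine ih _ _ _ ?_ (h.next hq) p hp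
        unfold nextEdge
        split_ifs <;> (dsimp only; omega)
    · rw [Filling.southWestPath, if_pos (by omega)] at hp
      simp at hp

/-- Every edge of the wire is reached by the path that starts at the top of column `i`. -/
lemma exists_southWestPath_eq_append (hq : InStaircase n q) {D : Filling}
    (hD : ∀ r c, 1 ≤ r → r < c → c ≤ n → Visits q i r c → (D r c = some true ↔ q r c = true)) :
    ∀ (m : ℕ) (south : Bool) (a b : ℕ), a + b ≤ m → b ≤ n → OnEdge q i south a b →
      ∃ l, D.southWestPath n true 1 i = l ++ D.southWestPath n south a b := by
  intro m
  induction m with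
  | zero =>
    intro south a b hm _ h
    have := h.visits
    omega
  | succ m ih =>
    have back : ∀ (south south' : Bool) (a b a' b' : ℕ), a' + b' ≤ m → b' ≤ n →
        OnEdge q i south' a' b' → nextEdge q south' a' b' = (south, a, b) →
        ∃ l, D.southWestPath n true 1 i = l ++ D.southWestPath n south a b := by
      intro south south' a b a' b' h1 h2 h3 h4
      obtain ⟨l, hl⟩ := ih south' a' b' h1 h2 h3
      rw [southWestPath_eq hD h3 h2, h4] at hl
      exact ⟨l ++ [(a', b')], by rw [hl, List.append_assoc]; rfl⟩
    intro south a b hm hb h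
    cases south
    · obtain ⟨h1, h2, h3⟩ := h
      obtain ⟨b, rfl⟩ : ∃ d, b = d + 1 := ⟨b - 1, by omega⟩
      by_cases hab : a = b
      · subst hab
        refine back _ true _ _ a a (by omega) (by omega) ⟨h1, le_rfl, ?_⟩ (by simp [nextEdge])
        rwa [eastVal_diag hq, Int.natAbs_neg] at h3
      · cases hqb : q a b
        · rw [eastVal_succ_of_not hqb] at h3
          exact back _ false _ _ a b (by omega) (by omega) ⟨h1, by omega, h3⟩
            (by simp [nextEdge, hab, hqb])
        · rw [eastVal_succ_of_plus hqb] at h3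
          exact back _ true _ _ a b (by omega) (by omega) ⟨h1, by omega, h3⟩
            (by simp [nextEdge, hqb])
    · obtain ⟨h1, h2, h3⟩ := h
      obtain ⟨a, rfl⟩ : ∃ d, a = d + 1 := ⟨a - 1, by omega⟩
      rcases Nat.eq_zero_or_pos a with rfl | ha
      · rw [northVal_one hq] at h3
        obtain rfl : b = i := by omega
        exact ⟨[], rfl⟩
      · cases hqb : q a b
        · rw [northVal_succ_of_not hqb] at h3
          exact back _ true _ _ a b (by omega) (by omega) ⟨ha, by omega, h3⟩
            (by simp [nextEdge, hqb, show a ≠ b by omega])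
        · rw [northVal_succ_of_plus hqb] at h3
          exact back _ false _ _ a b (by omega) (by omega) ⟨ha, by omega, h3⟩
            (by simp [nextEdge, hqb])

lemma visitedFrom_iff {a b : ℕ} :
    VisitedFrom q i a b ↔ VisitedFrom q (i + 1) a b ∨ Visits q i a b := by
  unfold VisitedFrom Visits
  omega

lemma absInv_eq {w : ℕ → ℤ} (hq : InStaircase n q)
    (hw : ∀ j ∈ Set.Icc 1 n, (w j).natAbs = (eastVal q j (n + 1)).natAbs) {s : ℕ}
    (hs : s ∈ Set.Icc 1 n) (hE : (eastVal q s (n + 1)).natAbs = i) : absInv n w i = s := by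
  have h : (List.range' 1 n).find? (fun j => decide ((w j).natAbs = i)) = some s := by
    rw [List.find?_range'_eq_some]
    refine ⟨by simp [hw s hs, hE], List.mem_range'_1.2 ⟨hs.1, by have := hs.2; omega⟩, ?_⟩
    intro j h1 h2
    have hj : j ∈ Set.Icc 1 n := ⟨h1, by have := hs.2; omega⟩
    simp only [Bool.not_eq_true', decide_eq_false_iff_not, hw j hj]
    intro h3
    exact h2.ne (eastVal_end_inj hq hj hs (h3.trans hE.symm))
  rw [absInv, h, Option.getD_some]

/-- Adding the path `P_i` to the part of a Le-diagram visited by the wires with labels greater than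
`i` gives the part visited by the wires with labels at least `i`. -/
lemma addPath_partialFilling (hq : InStaircase n q) (hLe : IsLe n q) {w : ℕ → ℤ}
    (hw : ∀ j ∈ Set.Icc 1 n, (w j).natAbs = (eastVal q j (n + 1)).natAbs ∧
      (0 < w j ↔ j < n ∧ ∀ c, j < c → c ≤ n → q j c = false)) (hi : i ∈ Set.Icc 1 n) :
    addPath n w (partialFilling n q (i + 1)) i = partialFilling n q i := by
  obtain ⟨s, hs, hE⟩ := exists_row hq hi
  have hN1 : ∀ c, northVal q (0 + 1) c = c := northVal_one hq
  have hnew := isNewPluses_newPluses hq hLe hi.1 hs hE (w := w) (fun j hj => by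
    have h1 := eastVal_bound hq (a := j) (b := n + 1) hj.1 (by have := hj.2; omega)
    have h2 := hw j hj
    exact ⟨by omega, h2.2⟩) n 0 i (by omega) hi.1 hi.2 (hN1 i)
    (fun c h1 h2 => by rw [hN1]; omega)
  unfold addPath
  rw [absInv_eq hq (fun j hj => (hw j hj).1) hs hE]
  set l := newPluses n w s (partialFilling n q (i + 1)) n 0 i with hl
  obtain ⟨hnew1, hnew2⟩ := hnew
  simp only
  set D' : Filling := fun a b => if (a, b) ∈ l then some true
    else partialFilling n q (i + 1) a b with hD'
  have hD : ∀ r c, 1 ≤ r → r < c → c ≤ n → Visits q i r c →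
      (D' r c = some true ↔ q r c = true) := by
    intro r c h1 h2 h3 hv
    simp only [hD']
    split_ifs with hmem
    · simp [(hnew2 _ hmem).1]
    · rw [partialFilling_eq_true hq]
      constructor
      · exact fun h => h.1
      · intro h
        refine ⟨h, ?_⟩
        rcases hnew1 r c h1 h hv with h4 | h4
        · exact h4
        · exact absurd h4 hmem
  have hstart : OnEdge q i true 1 i := ⟨le_rfl, hi.1, by rw [northVal_one hq]; simp⟩
  have hmemP : ∀ a b, a < b →
      ((a, b) ∈ D'.southWestPath n true 1 i ↔ 1 ≤ a ∧ b ≤ n ∧ Visits q i a b) := by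
    intro a b hab
    constructor
    · intro h
      have := mem_southWestPath hq hD _ true 1 i le_rfl hstart _ h
      exact ⟨this.1, this.2.2⟩
    · rintro ⟨h1, h2, h3⟩
      obtain ⟨south, hs'⟩ : ∃ south, OnEdge q i south a b := by
        rcases h3 with h3 | h3
        · exact ⟨true, h1, hab.le, h3⟩
        · exact ⟨false, h1, hab, h3⟩
      obtain ⟨l', hl'⟩ := exists_southWestPath_eq_append hq hD _ south a b le_rfl h2 hs'
      rw [hl', southWestPath_eq hD hs' h2]
      simp
  ext1 a
  ext1 b
  change (if D' a b = none ∧ a < b ∧ (a, b) ∈ D'.southWestPath n true 1 i then some false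
    else D' a b) = _
  by_cases hmem : (a, b) ∈ l
  · obtain ⟨h1, h2⟩ := hnew2 _ hmem
    have h3 := hq a b h1
    have h4 : D' a b = some true := by simp only [hD', if_pos hmem]
    rw [if_neg (by simp [h4]), h4, partialFilling, if_pos ⟨h3, visitedFrom_iff.2 (Or.inr h2)⟩]
    exact congrArg some h1.symm
  · have h4 : D' a b = partialFilling n q (i + 1) a b := by simp only [hD', if_neg hmem]
    rw [h4]
    unfold partialFilling
    by_cases h5 : (1 ≤ a ∧ a < b ∧ b ≤ n) ∧ VisitedFrom q (i + 1) a b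
    · rw [if_pos h5, if_neg (by simp), if_pos ⟨h5.1, visitedFrom_iff.2 (Or.inl h5.2)⟩]
    · rw [if_neg h5]
      by_cases h6 : a < b ∧ (a, b) ∈ D'.southWestPath n true 1 i
      · obtain ⟨h7, h8, h9⟩ := (hmemP a b h6.1).1 h6.2
        rw [if_pos ⟨rfl, h6⟩, if_pos ⟨⟨h7, h6.1, h8⟩, visitedFrom_iff.2 (Or.inr h9)⟩]
        cases hqb : q a b
        · rfl
        · rcases hnew1 a b h7 hqb h9 with h10 | h10
          · exact absurd ⟨⟨h7, h6.1, h8⟩, h10⟩ h5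
          · exact absurd h10 hmem
      · rw [if_neg (by tauto), if_neg]
        rintro ⟨h7, h8⟩
        rcases visitedFrom_iff.1 h8 with h8 | h8
        · exact h5 ⟨h7, h8⟩
        · exact h6 ⟨h7.2.1, (hmemP a b h7.2.1).2 ⟨h7.1, h7.2.2, h8⟩⟩

/-- After the paths with labels at least `m` have been added to the empty staircase, the filling is
the part of the diagram that the corresponding wires visit. -/
lemma foldr_addPath (hq : InStaircase n q) (hLe : IsLe n q) {w : ℕ → ℤ}
    (hw : ∀ j ∈ Set.Icc 1 n, (w j).natAbs = (eastVal q j (n + 1)).natAbs ∧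
      (0 < w j ↔ j < n ∧ ∀ c, j < c → c ≤ n → q j c = false)) :
    ∀ k m : ℕ, 1 ≤ m → m + k = n + 1 →
      (List.range' m k).foldr (fun i D => addPath n w D i) (fun _ _ => none) =
        partialFilling n q m := by
  intro k
  induction k with
  | zero =>
    intro m _ hm
    obtain rfl : m = n + 1 := by omega
    simp only [List.range'_zero, List.foldr_nil]
    ext1 a
    ext1 b
    unfold partialFilling
    rw [if_neg]
    rintro ⟨h1, h2⟩
    have h3 := northVal_bound hq a b h1.2.1.le (by omega)
    have h4 := eastVal_bound hq h1.1 h1.2.1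
    unfold VisitedFrom at h2
    omega
  | succ k ih =>
    intro m h1 hm
    rw [List.range'_succ, List.foldr_cons, ih (m + 1) (by omega) (by omega)]
    exact addPath_partialFilling hq hLe hw ⟨h1, by omega⟩

/-! ### The signed permutation of a diagram -/

/-- The exit label of a wire is the absolute value of its signed exit value. The induction is on a
bound `m` for the distance to the north-east corner. -/
lemma northExit_eq (D : Diagram n) : ∀ (m a b : ℕ), a + b ≤ m → b ≤ n →
    (1 ≤ a → a ≤ b → D.toFilling.northExit true a b = (eastVal D.plus a (b + 1)).natAbs) ∧
      (a < b → D.toFilling.northExit false a b = (northVal D.plus (a + 1) b).natAbs) := by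
  have hq := D.plus_inStaircase
  intro m
  induction m with
  | zero =>
    intro a b hm hb
    exact ⟨fun _ _ => by omega, fun _ => by omega⟩
  | succ m ih =>
    intro a b hm hb
    have he : 1 ≤ a → a < b → (D.toFilling.IsElbow a b ↔ D.plus a b = true) := by
      intro h1 h2
      unfold Filling.IsElbow
      rw [D.toFilling_eq, if_pos ⟨h1, h2, hb⟩]
      simp [h2.ne]
    constructor
    · intro h1 h2
      rw [Filling.northExit, if_neg (by omega)]
      rcases h2.lt_or_eq with h2 | rfl
      · simp only [he h1 h2]
        cases hqb : D.plus a b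
        · simp only [Bool.false_eq_true, if_false, if_true]
          rw [(ih a (b - 1) (by omega) (by omega)).1 h1 (by omega), eastVal_succ_of_not hqb]
          congr 2
          omega
        · simp only [if_true, Bool.not_true, Bool.false_eq_true, if_false]
          rw [(ih (a - 1) b (by omega) hb).2 (by omega), eastVal_succ_of_plus hqb]
          congr 2
          omega
      · simp only [show D.toFilling.IsElbow a a from Or.inl rfl, if_true, Bool.not_true,
          Bool.false_eq_true, if_false]
        rw [(ih (a - 1) a (by omega) hb).2 (by omega), eastVal_diag hq, Int.natAbs_neg]
        congr 2
        omega
    · intro h2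
      rw [Filling.northExit]
      rcases Nat.eq_zero_or_pos a with rfl | ha
      · rw [if_pos (Or.inl rfl), northVal_one hq, Int.natAbs_natCast]
      · rw [if_neg (by omega)]
        simp only [he ha h2]
        cases hqb : D.plus a b
        · simp only [Bool.false_eq_true, if_false]
          rw [(ih (a - 1) b (by omega) hb).2 (by omega), northVal_succ_of_not hqb]
          congr 2
          omega
        · simp only [if_true, Bool.not_false]
          rw [(ih a (b - 1) (by omega) (by omega)).1 ha (by omega), northVal_succ_of_plus hqb]
          congr 2
          omega

lemma signedPerm_spec (D : Diagram n) {j : ℕ} (hj : j ∈ Set.Icc 1 n) :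
    (signedPerm D j).natAbs = (eastVal D.plus j (n + 1)).natAbs ∧
      (0 < signedPerm D j ↔ j < n ∧ ∀ c, j < c → c ≤ n → D.plus j c = false) := by
  have h1 := (northExit_eq D _ j n le_rfl le_rfl).1 hj.1 hj.2
  have h2 := eastVal_bound D.plus_inStaircase (a := j) (b := n + 1) hj.1 (by have := hj.2; omega)
  have h3 : D.toFilling.RowZero n j ↔ ∀ c, j < c → c ≤ n → D.plus j c = false := by
    unfold Filling.RowZero
    constructor
    · intro h c h3 h4
      have := h c (Finset.mem_Ioc.2 ⟨h3, h4⟩)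
      rw [D.toFilling_eq, if_pos ⟨hj.1, h3, h4⟩] at this
      simpa using this
    · intro h c hc
      have hc' := Finset.mem_Ioc.1 hc
      rw [D.toFilling_eq, if_pos ⟨hj.1, hc'⟩, h c hc'.1 hc'.2]
  unfold signedPerm
  rw [h1, ← h3]
  split_ifs with h4
  · exact ⟨by omega, by simp only [h4, true_and, iff_true]; omega⟩
  · refine ⟨by omega, ?_⟩
    simp only [h4, iff_false]
    omega

/-- The map `Ψ` recovers a Le-diagram from any word whose signed permutation is that of the
diagram. -/
lemma psi_eq (D : Diagram n) (hLe : IsLe n D.plus) {p : List ℕ}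
    (hp : ∀ j ∈ Set.Icc 1 n, alphaInv n p j = signedPerm D j) : Psi n p = D := by
  unfold Psi
  rw [List.foldl_reverse, foldr_addPath D.plus_inStaircase hLe (fun j hj => by
    rw [hp j hj]; exact signedPerm_spec D hj) n 1 le_rfl (by omega)]
  ext1 x
  have hx := x.2
  have h1 := northVal_bound D.plus_inStaircase x.1.1 x.1.2 (by omega) (by omega)
  simp only [partialFilling]
  rw [if_pos ⟨hx, Or.inl h1.1⟩, Option.getD_some, D.plus_apply]

end Reconstruction

/-! ### The output words of Le-diagrams -/

/-- The condition that characterizes the words of signed exit values of the wires entering a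
Le-diagram from the west in the rows `1, …, n`: the absolute values form a permutation, no value in
row `j` lies below `-j`, and whenever the rows below row `m` contain only labels greater than `m`,
the product of their signs is the same as for the diagram without `+`s. -/
structure IsOutputWord (n : ℕ) (W : ℕ → ℤ) : Prop where
  surj : ∀ k ∈ Set.Icc 1 n, ∃ j ∈ Set.Icc 1 n, (W j).natAbs = k
  ge : ∀ j ∈ Set.Icc 1 n, -(j : ℤ) ≤ W j
  prod : ∀ m < n, (∀ j, m < j → j ≤ n → m < (W j).natAbs) →
    ∏ j ∈ Finset.Ioc m n, (W j).sign = (-1) ^ (n - m)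

section OutputWords

variable {n : ℕ}

lemma injOn_of_surj {f : ℕ → ℕ} (h : ∀ k ∈ Set.Icc 1 n, ∃ j ∈ Set.Icc 1 n, f j = k) :
    Set.InjOn f (Set.Icc 1 n) ∧ ∀ j ∈ Set.Icc 1 n, f j ∈ Set.Icc 1 n := by
  have hsub : Finset.Icc 1 n ⊆ (Finset.Icc 1 n).image f := by
    intro k hk
    obtain ⟨j, hj, rfl⟩ := h k (by simpa using hk)
    exact Finset.mem_image_of_mem f (by simpa using hj)
  have heq : Finset.Icc 1 n = (Finset.Icc 1 n).image f :=
    Finset.eq_of_subset_of_card_le hsub Finset.card_image_le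
  constructor
  · have := Finset.card_image_iff.1 (congrArg Finset.card heq).symm
    simpa using this
  · intro j hj
    have : f j ∈ (Finset.Icc 1 n).image f := Finset.mem_image_of_mem f (by simpa using hj)
    rw [← heq] at this
    simpa using this

/-- Bubbling the maximum of `W a, …, W n, c` to the front: `z a` is the value carried past the
entries with indices at least `a`. -/
lemma exists_bubble (n : ℕ) (W : ℕ → ℤ) (c : ℤ) :
    ∃ z : ℕ → ℤ, z (n + 1) = c ∧ ∀ a ≤ n, z a = max (z (a + 1)) (W a) := by
  let Z : ℕ → ℤ := fun k => Nat.rec c (fun k x => max x (W (n - k))) k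
  refine ⟨fun a => Z (n + 1 - a), by simp [Z], fun a ha => ?_⟩
  change Z (n + 1 - a) = max (Z (n + 1 - (a + 1))) (W a)
  have h1 : n + 1 - a = (n - a) + 1 := by omega
  have h2 : n + 1 - (a + 1) = n - a := by omega
  rw [h1, h2]
  change max (Z (n - a)) (W (n - (n - a))) = _
  rw [Nat.sub_sub_self ha]

section Bubble

variable {W z : ℕ → ℤ} (hz : ∀ a ≤ n, z a = max (z (a + 1)) (W a))
include hz

lemma bubble_forall (P : ℤ → Prop) {a : ℕ} (ha : a ≤ n + 1) :
    (P (z a) ∧ ∀ j, a ≤ j → j ≤ n → P (min (z (j + 1)) (W j))) ↔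
      (P (z (n + 1)) ∧ ∀ j, a ≤ j → j ≤ n → P (W j)) := by
  induction ha using Nat.decreasingInduction with
  | self => exact and_congr_right fun _ =>
      ⟨fun _ j _ _ => by omega, fun _ j _ _ => by omega⟩
  | of_succ a ha ih =>
    have han : a ≤ n := by omega
    have hsplit : ∀ Q : ℕ → Prop, (∀ j, a ≤ j → j ≤ n → Q j) ↔
        Q a ∧ ∀ j, a + 1 ≤ j → j ≤ n → Q j := by
      intro Q
      constructor
      · exact fun h => ⟨h a le_rfl han, fun j h1 h2 => h j (by omega) h2⟩
      · rintro ⟨h1, h2⟩ j h3 h4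
        rcases h3.lt_or_eq with h3 | rfl
        exacts [h2 j h3 h4, h1]
    have hmm : P (max (z (a + 1)) (W a)) ∧ P (min (z (a + 1)) (W a)) ↔
        P (z (a + 1)) ∧ P (W a) := by
      rcases le_total (z (a + 1)) (W a) with h | h
      · rw [max_eq_right h, min_eq_left h, and_comm]
      · rw [max_eq_left h, min_eq_right h]
    rw [hsplit (fun j => P (min (z (j + 1)) (W j))), hsplit (fun j => P (W j)), hz a han]
    tauto

lemma bubble_prod {m : ℕ} (hm : m ≤ n) :
    (z (m + 1)).sign * ∏ j ∈ Finset.Ioc m n, (min (z (j + 1)) (W j)).sign =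
      (z (n + 1)).sign * ∏ j ∈ Finset.Ioc m n, (W j).sign := by
  induction hm using Nat.decreasingInduction with
  | self => simp
  | of_succ m hm ih =>
    have hI : Finset.Ioc m n = insert (m + 1) (Finset.Ioc (m + 1) n) := by
      ext j
      simp only [Finset.mem_Ioc, Finset.mem_insert]
      omega
    rw [hI, Finset.prod_insert (by simp), Finset.prod_insert (by simp), hz (m + 1) hm,
      mul_left_comm (z (n + 1)).sign, ← ih, ← mul_assoc, ← mul_assoc]
    congr 1
    rcases le_total (z (m + 1 + 1)) (W (m + 1)) with h | h
    · rw [max_eq_right h, min_eq_left h]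
    · rw [max_eq_left h, min_eq_right h, mul_comm]

lemma bubble_le {a : ℕ} (ha : a ≤ n + 1) :
    z (n + 1) ≤ z a ∧ ∀ j, a ≤ j → j ≤ n → W j ≤ z a := by
  induction ha using Nat.decreasingInduction with
  | self => exact ⟨le_rfl, fun j _ _ => by omega⟩
  | of_succ a ha ih =>
    have h1 := hz a (by omega)
    have h2 := le_max_left (z (a + 1)) (W a)
    have h3 := le_max_right (z (a + 1)) (W a)
    refine ⟨by omega, fun j h4 h5 => ?_⟩
    rcases h4.lt_or_eq with h4 | rfl
    · have := ih.2 j h4 h5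
      omega
    · omega

end Bubble

lemma prod_sign_of_neg {W : ℕ → ℤ} {m : ℕ} (h : ∀ j, m < j → j ≤ n → W j < 0) :
    ∏ j ∈ Finset.Ioc m n, (W j).sign = (-1) ^ (n - m) := by
  rw [Finset.prod_congr rfl fun j hj => Int.sign_eq_neg_one_of_neg
    (h j (Finset.mem_Ioc.1 hj).1 (Finset.mem_Ioc.1 hj).2)]
  simp

/-- Removing the leftmost column of a Le-diagram acts on its output word by one round of bubble
sort: the value `-W (n + 1)` enters the column at the bottom, and in every row the larger value
moves on northwards in the column while the smaller one is left as the output of the shorter row.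
The value that arrives at the top is `n + 1`, and the remaining word satisfies the conditions for
`n`. -/
lemma IsOutputWord.bubble {W z : ℕ → ℤ} (hW : IsOutputWord (n + 1) W)
    (hz0 : z (n + 1) = -W (n + 1)) (hz : ∀ a ≤ n, z a = max (z (a + 1)) (W a)) :
    z 1 = n + 1 ∧ IsOutputWord n fun a => min (z (a + 1)) (W a) := by
  obtain ⟨hinj, hbd⟩ := injOn_of_surj hW.surj
  have hz1 : z 1 = n + 1 := by
    have hup := ((bubble_forall hz (fun x => x.natAbs ≤ n + 1) (by omega : 1 ≤ n + 1)).2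
      ⟨by rw [hz0, Int.natAbs_neg]; exact (hbd _ (by simp)).2,
        fun j h1 h2 => (hbd j ⟨h1, by omega⟩).2⟩).1
    obtain ⟨hl1, hl2⟩ := bubble_le hz (by omega : 1 ≤ n + 1)
    obtain ⟨j, hj, hjn⟩ := hW.surj (n + 1) (by simp)
    rcases hj.2.lt_or_eq with h | rfl
    · have h1 := hW.ge j hj
      have h2 := hl2 j hj.1 (by omega)
      omega
    · have h1 := hW.prod n (by omega) fun j h1 h2 => by
        rw [show j = n + 1 by omega, hjn]
        omega
      rw [Nat.Ioc_succ_singleton, Finset.prod_singleton, show n + 1 - n = 1 by omega,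
        pow_one] at h1
      have := Int.sign_eq_neg_one_iff_neg.1 h1
      omega
  refine ⟨hz1, fun k hk => ?_, fun a ha => ?_, fun m hm hcut => ?_⟩
  · by_contra hcon
    push Not at hcon
    have hk' := hk.2
    obtain ⟨h1, h2⟩ := (bubble_forall hz (fun x => x.natAbs ≠ k) (by omega : 1 ≤ n + 1)).1
      ⟨by simp only [hz1]; omega, fun j h1 h2 => hcon j ⟨h1, h2⟩⟩
    obtain ⟨j, hj, hjk⟩ := hW.surj k ⟨hk.1, by omega⟩
    rcases hj.2.lt_or_eq with h | rfl
    · exact h2 j hj.1 (by omega) hjk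
    · rw [hz0, Int.natAbs_neg] at h1
      exact h1 hjk
  · refine le_min ?_ (hW.ge a ⟨ha.1, by have := ha.2; omega⟩)
    by_contra hlt
    have han := ha.2
    obtain ⟨h1, h2⟩ := bubble_le hz (by omega : a + 1 ≤ n + 1)
    have h3 := hW.prod a (by omega) fun j h4 h5 => by
      rcases h5.lt_or_eq with h5 | rfl
      · have := h2 j h4 (by omega)
        omega
      · omega
    have h4 : ∏ j ∈ Finset.Ioc a n, (W j).sign = (-1) ^ (n - a) :=
      prod_sign_of_neg fun j h5 h6 => by
        have := h2 j h5 h6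
        omega
    rw [Finset.prod_Ioc_succ_top (by omega), h4, Int.sign_eq_one_of_pos (by omega),
      show n + 1 - a = n - a + 1 by omega, pow_succ] at h3
    have : (-1 : ℤ) ^ (n - a) ≠ 0 := by simp
    omega
  · rcases le_or_gt (z (m + 1)) m with h | h
    · apply prod_sign_of_neg
      intro j h1 h2
      have h3 := (bubble_le hz (by omega : m + 1 ≤ n + 1))
      have h4 := ((bubble_forall hz (fun x => x ≤ z (m + 1)) (by omega : m + 1 ≤ n + 1)).2 h3).2
        j h1 h2
      have h5 := hcut j h1 h2
      omega
    · obtain ⟨h1, h2⟩ := (bubble_forall hz (fun x => m < x.natAbs)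
        (by omega : m + 1 ≤ n + 1)).1 ⟨by omega, fun j h1 h2 => hcut j h1 h2⟩
      have h3 := hW.prod m (by omega) fun j h4 h5 => by
        rcases h5.lt_or_eq with h5 | rfl
        · exact h2 j h4 (by omega)
        · rwa [hz0, Int.natAbs_neg] at h1
      rw [Finset.prod_Ioc_succ_top (by omega), show n + 1 - m = n - m + 1 by omega,
        pow_succ] at h3
      have h4 := bubble_prod hz hm.le
      rw [hz0, Int.sign_neg, Int.sign_eq_one_of_pos (by omega)] at h4
      linarith

/-- The diagram obtained from `q` by adding a column with label `n + 1` at the left, with `+`s in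
the rows satisfying `p`. -/
def addColumn (n : ℕ) (q : ℕ → ℕ → Bool) (p : ℕ → Bool) (a b : ℕ) : Bool :=
  if b = n + 1 then decide (1 ≤ a ∧ a ≤ n) && p a else q a b

section AddColumn

variable {q : ℕ → ℕ → Bool} {p : ℕ → Bool}

lemma addColumn_of_le {a b : ℕ} (hb : b ≤ n) : addColumn n q p a b = q a b := if_neg (by omega)

lemma addColumn_inStaircase (hq : InStaircase n q) : InStaircase (n + 1) (addColumn n q p) := by
  intro a b h
  unfold addColumn at h
  split_ifs at h with hb
  · simp only [Bool.and_eq_true, decide_eq_true_eq] at h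
    omega
  · have := hq a b h
    omega

lemma eastVal_congr {q' : ℕ → ℕ → Bool} {a b : ℕ} (h0 : northVal q' a a = northVal q a a)
    (h : ∀ c < b, q' a c = q a c ∧ northVal q' a c = northVal q a c) :
    eastVal q' a b = eastVal q a b := by
  induction b with
  | zero => exact congrArg Neg.neg h0
  | succ b ih =>
    rw [eastVal_succ, eastVal_succ, (h b (by omega)).1, (h b (by omega)).2,
      ih fun c hc => h c (by omega)]

lemma northVal_addColumn {a : ℕ} (ha : a ≤ n + 1) :
    ∀ b ≤ n, northVal (addColumn n q p) a b = northVal q a b := by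
  induction a with
  | zero => intro b _; rfl
  | succ a ih =>
    intro b hb
    rw [northVal_succ, northVal_succ, addColumn_of_le hb, ih (by omega) b hb,
      eastVal_congr (ih (by omega) a (by omega)) fun c hc =>
        ⟨addColumn_of_le (by omega), ih (by omega) c (by omega)⟩]

lemma eastVal_addColumn {a b : ℕ} (ha : a ≤ n) (hb : b ≤ n + 1) :
    eastVal (addColumn n q p) a b = eastVal q a b :=
  eastVal_congr (northVal_addColumn (by omega) a ha) fun c hc =>
    ⟨addColumn_of_le (by omega), northVal_addColumn (by omega) c (by omega)⟩

end AddColumn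

/-- Every word satisfying the conditions is the output word of a Le-diagram: the leftmost column is
recovered from one round of bubble sort, with a `+` wherever the value moving northwards changes. -/
lemma IsOutputWord.exists_isLe {W : ℕ → ℤ} (hW : IsOutputWord n W) :
    ∃ q, InStaircase n q ∧ IsLe n q ∧ ∀ j ∈ Set.Icc 1 n, eastVal q j (n + 1) = W j := by
  induction n generalizing W with
  | zero =>
    refine ⟨fun _ _ => false, fun a b h => absurd h (by simp), fun a b _ _ _ => by omega, ?_⟩
    intro j hj
    have h1 := hj.1
    have h2 := hj.2
    omega
  | succ n ih =>
    obtain ⟨z, hz0, hz⟩ := exists_bubble n W (-W (n + 1))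
    obtain ⟨hz1, hW'⟩ := hW.bubble hz0 hz
    obtain ⟨q, hq, hLe, hout⟩ := ih hW'
    obtain ⟨hinj, -⟩ := injOn_of_surj hW.surj
    have hne : ∀ a ∈ Set.Icc 1 n, z (a + 1) ≠ W a := by
      intro a ha
      have ha1 := ha.1
      have ha2 := ha.2
      have hWne : ∀ j, a < j → j ≤ n + 1 → (W j).natAbs ≠ (W a).natAbs := by
        intro j h1 h2 h3
        have := hinj (x₁ := j) (x₂ := a) ⟨by omega, h2⟩ ⟨ha1, by omega⟩ h3
        omega
      refine ((bubble_forall hz (fun x => x ≠ W a) (by omega : a + 1 ≤ n + 1)).2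
        ⟨fun h => ?_, fun j h1 h2 h => ?_⟩).1
      · exact hWne (n + 1) (by omega) le_rfl (by rw [← h, hz0, Int.natAbs_neg])
      · exact hWne j h1 (by omega) (by rw [h])
    set p : ℕ → Bool := fun a => decide (z (a + 1) < W a) with hp
    have hq' := addColumn_inStaircase (p := p) hq
    have hlast : ∀ a ∈ Set.Icc 1 n, addColumn n q p a (n + 1) = p a := by
      intro a ha
      unfold addColumn
      rw [if_pos rfl, decide_eq_true (p := 1 ≤ a ∧ a ≤ n) ha, Bool.true_and]
    have hE : ∀ a ∈ Set.Icc 1 n,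
        eastVal (addColumn n q p) a (n + 1) = min (z (a + 1)) (W a) := by
      intro a ha
      rw [eastVal_addColumn ha.2 le_rfl, hout a ha]
    have hN : ∀ a, 1 ≤ a → a ≤ n + 1 → northVal (addColumn n q p) a (n + 1) = z a := by
      intro a ha
      induction a, ha using Nat.le_induction with
      | base => intro _; rw [northVal_one hq', hz1]; simp
      | succ a ha iha =>
        intro han
        have haI : a ∈ Set.Icc 1 n := ⟨ha, by omega⟩
        rw [northVal_succ, hlast a haI, hE a haI, iha (by omega), hz a haI.2]
        by_cases h : z (a + 1) < W a
        · rw [if_pos (by simpa [hp] using h), min_eq_left h.le]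
        · rw [if_neg (by simpa [hp] using h), max_eq_left (not_lt.1 h)]
    refine ⟨addColumn n q p, hq', fun a b ha hab hb => ?_, fun j hj => ?_⟩
    · rcases hb.lt_or_eq with hb | rfl
      · rw [eastVal_addColumn (by omega) (by omega), northVal_addColumn (by omega) b (by omega)]
        exact hLe a b ha hab (by omega)
      · have haI : a ∈ Set.Icc 1 n := ⟨ha, by omega⟩
        rw [hE a haI, hN a ha (by omega), hz a haI.2]
        exact min_lt_max.2 (hne a haI)
    · rcases hj.2.lt_or_eq with h | rfl
      · have hjI : j ∈ Set.Icc 1 n := ⟨hj.1, by omega⟩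
        rw [eastVal_succ, hlast j hjI, hE j hjI, hN j hj.1 (by omega), hz j hjI.2]
        by_cases h : z (j + 1) < W j
        · rw [if_pos (by simpa [hp] using h), max_eq_right h.le]
        · rw [if_neg (by simpa [hp] using h), min_eq_right (not_lt.1 h)]
      · rw [eastVal_diag hq', hN (n + 1) (by omega) le_rfl, hz0, neg_neg]

/-! ### Signed permutations and output words -/

/-- The condition on the signed permutations corresponding to preference functions: the absolute
values form a permutation, and a positive entry in position `j < n` is at most `j`, since it names a
position to the left of `j + 1`. -/
structure IsPrefPerm (n : ℕ) (w : ℕ → ℤ) : Prop where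
  surj : ∀ k ∈ Set.Icc 1 n, ∃ j ∈ Set.Icc 1 n, (w j).natAbs = k
  pos : ∀ j ∈ Set.Icc 1 n, 0 < w j → j < n ∧ w j ≤ j

/-- The signed permutation `w` permutes the absolute values greater than `m` among the positions
greater than `m`. -/
def IsCut (n : ℕ) (w : ℕ → ℤ) (m : ℕ) : Prop := ∀ j, m < j → j ≤ n → m < (w j).natAbs

/-- The condition on signed permutations corresponding to atomicity: the entry before a cut is
positive. -/
def IsAtomicPerm (n : ℕ) (w : ℕ → ℤ) : Prop := ∀ m, 1 ≤ m → m < n → IsCut n w m → 0 < w m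

open Classical in
/-- The product of the signs of `w` since the last cut. -/
noncomputable def signProd (n : ℕ) (w : ℕ → ℤ) : ℕ → ℤ
  | 0 => 1
  | k + 1 => if IsCut n w (k + 1) then 1 else signProd n w k * (w (k + 1)).sign

/-- The output word associated with a signed permutation: away from the cuts the signs are reversed,
and at the cuts they are adjusted so that the product of the signs over each block is right. -/
noncomputable def outputWord (n : ℕ) (w : ℕ → ℤ) (j : ℕ) : ℤ :=
  -(signProd n w (j - 1) * signProd n w j) * (w j).natAbs

section OutputWordOf

variable {w : ℕ → ℤ}

lemma IsPrefPerm.natAbs_mem (hw : IsPrefPerm n w) {j : ℕ} (hj : j ∈ Set.Icc 1 n) :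
    (w j).natAbs ∈ Set.Icc 1 n := (injOn_of_surj (f := fun j => (w j).natAbs) hw.surj).2 j hj

lemma IsPrefPerm.injOn (hw : IsPrefPerm n w) : Set.InjOn (fun j => (w j).natAbs) (Set.Icc 1 n) :=
  (injOn_of_surj (f := fun j => (w j).natAbs) hw.surj).1

lemma IsPrefPerm.signProd_eq (hw : IsPrefPerm n w) {j : ℕ} (hj : j ≤ n) :
    signProd n w j = 1 ∨ signProd n w j = -1 := by
  induction j with
  | zero => exact Or.inl rfl
  | succ j ih =>
    rw [signProd]
    split_ifs
    · exact Or.inl rfl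
    · have h1 := (hw.natAbs_mem (j := j + 1) ⟨by omega, hj⟩).1
      rcases ih (by omega) with h | h <;> rw [h] <;>
        rcases lt_trichotomy (w (j + 1)) 0 with h2 | h2 | h2
      · simp [Int.sign_eq_neg_one_of_neg h2]
      · omega
      · simp [Int.sign_eq_one_of_pos h2]
      · simp [Int.sign_eq_neg_one_of_neg h2]
      · omega
      · simp [Int.sign_eq_one_of_pos h2]

lemma signProd_of_isCut {m : ℕ} (h : IsCut n w m) : signProd n w m = 1 := by
  cases m with
  | zero => rfl
  | succ m => rw [signProd, if_pos h]

lemma IsPrefPerm.natAbs_outputWord (hw : IsPrefPerm n w) {j : ℕ} (hj : j ≤ n) :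
    (outputWord n w j).natAbs = (w j).natAbs := by
  unfold outputWord
  rcases hw.signProd_eq (j := j - 1) (by omega) with h1 | h1 <;>
    rcases hw.signProd_eq hj with h2 | h2 <;> rw [h1, h2] <;> omega

lemma IsPrefPerm.sign_outputWord (hw : IsPrefPerm n w) {j : ℕ} (hj : j ∈ Set.Icc 1 n) :
    (outputWord n w j).sign = -(signProd n w (j - 1) * signProd n w j) := by
  have h0 := (hw.natAbs_mem hj).1
  unfold outputWord
  rw [Int.sign_mul, Int.sign_eq_one_of_pos (show (0 : ℤ) < (w j).natAbs by omega), mul_one]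
  have hj2 := hj.2
  rcases hw.signProd_eq (j := j - 1) (by omega) with h1 | h1 <;>
    rcases hw.signProd_eq hj2 with h2 | h2 <;> rw [h1, h2] <;> rfl

/-- The sign products telescope from one cut to the end, and they are `1` at the cuts. -/
lemma IsPrefPerm.isOutputWord (hw : IsPrefPerm n w) (ha : IsAtomicPerm n w) :
    IsOutputWord n (outputWord n w) := by
  refine ⟨fun k hk => ?_, fun j hj => ?_, fun m hm hcut => ?_⟩
  · obtain ⟨j, hj, hjk⟩ := hw.surj k hk
    exact ⟨j, hj, by rw [hw.natAbs_outputWord hj.2, hjk]⟩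
  · have h1 := hw.natAbs_outputWord hj.2
    have h2 := hw.natAbs_mem hj
    have h3 := hw.pos j hj
    by_cases hneg : 0 < w j
    · have := (h3 hneg).2
      omega
    -- a negative entry away from the cuts becomes positive, and atomicity leaves `n` as the only
    -- cut with a negative entry
    · by_cases hc : IsCut n w j
      · rcases hj.2.lt_or_eq with h | rfl
        · exact absurd (ha j hj.1 h hc) hneg
        · have := h2.2
          omega
      · obtain ⟨k, rfl⟩ : ∃ k, j = k + 1 := ⟨j - 1, by have := hj.1; omega⟩
        have h4 := hw.sign_outputWord hj
        rw [signProd, if_neg hc, Nat.add_sub_cancel,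
          Int.sign_eq_neg_one_of_neg (a := w (k + 1)) (by have := h2.1; omega)] at h4
        have h5 : (outputWord n w (k + 1)).sign = 1 := by
          rw [h4]
          rcases hw.signProd_eq (j := k) (by have := hj.2; omega) with h | h <;> rw [h] <;> rfl
        have := Int.sign_eq_one_iff_pos.1 h5
        omega
  · have hcutm : IsCut n w m := fun j h1 h2 => by
      have := hcut j h1 h2
      rwa [hw.natAbs_outputWord h2] at this
    have key : ∀ k, m ≤ k → k ≤ n → ∏ j ∈ Finset.Ioc m k, (outputWord n w j).sign =
        (-1) ^ (k - m) * signProd n w k := by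
      intro k hk
      induction k, hk using Nat.le_induction with
      | base => intro _; simp [signProd_of_isCut hcutm]
      | succ k hk ih =>
        intro hkn
        rw [Finset.prod_Ioc_succ_top (by omega), ih (by omega),
          hw.sign_outputWord ⟨by omega, hkn⟩, Nat.add_sub_cancel,
          show k + 1 - m = k - m + 1 by omega, pow_succ]
        rcases hw.signProd_eq (j := k) (by omega) with h | h <;> rw [h] <;> ring
    rw [key n hm.le le_rfl, signProd_of_isCut (m := n) fun j h1 h2 => by omega, mul_one]

/-- A signed permutation subject to the two conditions is determined by its output word: the output
word has the same cuts and determines the partial sign products, hence the signs away from the cuts,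
and at a cut the sign is forced to be positive, except at `n`, where it is negative. -/
lemma eq_of_outputWord_eq {w' : ℕ → ℤ} (hw : IsPrefPerm n w) (ha : IsAtomicPerm n w)
    (hw' : IsPrefPerm n w') (ha' : IsAtomicPerm n w')
    (h : ∀ j ∈ Set.Icc 1 n, outputWord n w j = outputWord n w' j) :
    ∀ j ∈ Set.Icc 1 n, w j = w' j := by
  have habs : ∀ j ∈ Set.Icc 1 n, (w j).natAbs = (w' j).natAbs := by
    intro j hj
    rw [← hw.natAbs_outputWord hj.2, ← hw'.natAbs_outputWord hj.2, h j hj]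
  have hcut : ∀ m, IsCut n w m ↔ IsCut n w' m := by
    intro m
    refine forall_congr' fun j => forall_congr' fun h1 => forall_congr' fun h2 => ?_
    rw [habs j ⟨by omega, h2⟩]
  have hsq : ∀ x : ℤ, x = 1 ∨ x = -1 → x * x = 1 := by rintro x (rfl | rfl) <;> rfl
  have hR : ∀ j ≤ n, signProd n w j = signProd n w' j := by
    intro j
    induction j with
    | zero => intro _; rfl
    | succ j ih =>
      intro hj
      have hjI : j + 1 ∈ Set.Icc 1 n := ⟨by omega, hj⟩
      have h1 := hw.sign_outputWord hjI
      have h2 := hw'.sign_outputWord hjI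
      rw [h _ hjI, h2, Nat.add_sub_cancel, ← ih (by omega), neg_inj] at h1
      have h3 := hsq _ (hw.signProd_eq (j := j) (by omega))
      calc signProd n w (j + 1) = signProd n w j * signProd n w j * signProd n w (j + 1) := by
            rw [h3, one_mul]
        _ = signProd n w j * signProd n w j * signProd n w' (j + 1) := by
            rw [mul_assoc, ← h1, ← mul_assoc]
        _ = _ := by rw [h3, one_mul]
  intro j hj
  have hjn := hj.2
  by_cases hc : IsCut n w j
  · rcases hjn.lt_or_eq with hlt | rfl
    · have h1 := ha j hj.1 hlt hc
      have h2 := ha' j hj.1 hlt ((hcut j).1 hc)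
      have := habs j hj
      omega
    · have h1 := hw.pos j hj
      have h2 := hw'.pos j hj
      have := habs j hj
      omega
  · obtain ⟨k, rfl⟩ : ∃ k, j = k + 1 := ⟨j - 1, by have := hj.1; omega⟩
    have h1 := hR (k + 1) hjn
    rw [signProd, signProd, if_neg hc, if_neg (fun h => hc ((hcut _).2 h)),
      ← hR k (by omega)] at h1
    have h2 : signProd n w k ≠ 0 := by
      rcases hw.signProd_eq (j := k) (by omega) with h | h <;> rw [h] <;> simp
    have h3 := mul_left_cancel₀ h2 h1
    rw [← Int.sign_mul_natAbs (w (k + 1)), ← Int.sign_mul_natAbs (w' (k + 1)), h3, habs _ hj]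

end OutputWordOf

end OutputWords

/-! ### Signed permutations of Le-diagrams -/

section DiagramPerm

variable {n : ℕ}

lemma signedPerm_isPrefPerm (D : Diagram n) : IsPrefPerm n (signedPerm D) := by
  have hq := D.plus_inStaircase
  refine ⟨fun k hk => ?_, fun j hj hpos => ?_⟩
  · obtain ⟨r, hr, hrk⟩ := exists_row hq hk
    exact ⟨r, hr, by rw [(signedPerm_spec D hr).1, hrk]⟩
  · obtain ⟨h1, h2⟩ := signedPerm_spec D hj
    obtain ⟨h3, h4⟩ := h2.1 hpos
    refine ⟨h3, ?_⟩
    rw [eastVal_eq_of_forall (by omega : j + 1 ≤ n + 1) fun d h5 h6 => h4 d h5 (by omega),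
      eastVal_diag hq, Int.natAbs_neg] at h1
    have := northVal_bound hq j j le_rfl hj.1
    omega

/-- The diagonal wire of a row containing a `+` turns into a column further left, so it enters
below; hence no cut follows a negative entry. -/
lemma signedPerm_isAtomicPerm (D : Diagram n) : IsAtomicPerm n (signedPerm D) := by
  have hq := D.plus_inStaircase
  intro m hm hmn hcut
  have hmI : m ∈ Set.Icc 1 n := ⟨hm, hmn.le⟩
  rw [(signedPerm_spec D hmI).2]
  refine ⟨hmn, fun c h1 h2 => ?_⟩
  rcases forall_or_exists_first D.plus m (m + 1) with h3 | ⟨g, h3, h4, h5⟩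
  · exact h3 c h1
  · exfalso
    have hg := (hq m g h4).2.2
    have hN : northVal D.plus (m + 1) g = -northVal D.plus m m := by
      rw [northVal_succ_of_plus h4, eastVal_eq_of_forall h3 h5, eastVal_diag hq]
    have hb := northVal_bound hq m m le_rfl hm
    obtain ⟨r, hr, hrE⟩ := exists_row hq (i := (northVal D.plus (m + 1) g).natAbs)
      ⟨by omega, by omega⟩
    have hmr : m + 1 ≤ r := le_of_northVal_eq hq hr.1 hrE h3 hg rfl
    have := hcut r hmr hr.2
    rw [(signedPerm_spec D hr).1, hrE] at this
    omega

/-- Every signed permutation satisfying the two conditions has an output word that is realized by a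
Le-diagram. -/
lemma exists_leDiagram {w : ℕ → ℤ} (hw : IsPrefPerm n w) (ha : IsAtomicPerm n w) :
    ∃ D ∈ leDiagrams n, ∀ j ∈ Set.Icc 1 n, eastVal D.plus j (n + 1) = outputWord n w j := by
  obtain ⟨q, hq, hLe, hout⟩ := (hw.isOutputWord ha).exists_isLe
  have hD : Diagram.plus (n := n) (fun x => q x.1.1 x.1.2) = q := by
    ext1 a
    ext1 b
    unfold Diagram.plus
    split_ifs with h
    · rfl
    · exact (hq.eq_false h).symm
  exact ⟨fun x => q x.1.1 x.1.2, (mem_leDiagrams_iff _).2 (by rwa [hD]), by rwa [hD]⟩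

end DiagramPerm

/-! ### Counting along filtered ranges -/

section Filters

variable {n : ℕ} (P : ℕ → Prop) [DecidablePred P]

lemma length_filter_range' : ((List.range' 1 n).filter P).length =
    ((Finset.Ico 1 (n + 1)).filter P).card := by
  rw [← List.toFinset_card_of_nodup ((List.nodup_range' (step := 1)).filter _)]
  congr 1
  ext x
  simp only [List.mem_toFinset, List.mem_filter, List.mem_range'_1, Finset.mem_filter,
    Finset.mem_Ico, decide_eq_true_eq, add_comm 1 n]

lemma card_filter_Ico_succ {m : ℕ} (hm : 1 ≤ m) : ((Finset.Ico 1 (m + 1)).filter P).card =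
    ((Finset.Ico 1 m).filter P).card + if P m then 1 else 0 := by
  have h : Finset.Ico 1 (m + 1) = insert m (Finset.Ico 1 m) := by
    ext x
    simp only [Finset.mem_Ico, Finset.mem_insert]
    omega
  rw [h, Finset.filter_insert]
  split_ifs
  · rw [Finset.card_insert_of_notMem (by simp)]
  · rfl

lemma card_filter_Ico_mono {a b : ℕ} (hab : a ≤ b) :
    ((Finset.Ico 1 a).filter P).card ≤ ((Finset.Ico 1 b).filter P).card :=
  Finset.card_le_card (Finset.filter_subset_filter _ (Finset.Ico_subset_Ico_right hab))

/-- For a position satisfying `P`, its index among such positions lies below the number of such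
positions in `[1, m]` iff the position is at most `m`. -/
lemma card_filter_Ico_lt_iff {k m : ℕ} (hk : 1 ≤ k) (hP : P k) :
    ((Finset.Ico 1 k).filter P).card < ((Finset.Ico 1 (m + 1)).filter P).card ↔ k ≤ m := by
  constructor
  · intro h
    by_contra hkm
    exact absurd (card_filter_Ico_mono P (show m + 1 ≤ k by omega)) (by omega)
  · intro h
    have h1 := card_filter_Ico_mono P (show k + 1 ≤ m + 1 by omega)
    rw [card_filter_Ico_succ P hk, if_pos hP] at h1
    omega

/-- The indices of the positions satisfying `P` are `0, 1, 2, …` in order. -/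
lemma map_card_filter_range' : ((List.range' 1 n).filter P).map
    (fun k => ((Finset.Ico 1 k).filter P).card) =
      List.range ((List.range' 1 n).filter P).length := by
  induction n with
  | zero => rfl
  | succ n ih =>
    rw [List.range'_concat, List.filter_append, List.map_append, ih, List.length_append]
    by_cases h : P (1 + 1 * n)
    · rw [List.filter_cons_of_pos (by simpa using h)]
      simp only [List.filter_nil, List.map_cons, List.map_nil, List.length_cons, List.length_nil]
      rw [List.range_succ, length_filter_range', one_mul, add_comm 1 n]
    · rw [List.filter_cons_of_neg (by simpa using h)]
      simp

/-- The element of index `t` among the positions satisfying `P`. -/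
lemma exists_card_filter_eq {t : ℕ} (ht : t < ((Finset.Ico 1 (n + 1)).filter P).card) :
    ∃ k ∈ Set.Icc 1 n, P k ∧ ((Finset.Ico 1 k).filter P).card = t := by
  rw [← length_filter_range', ← List.mem_range, ← map_card_filter_range', List.mem_map] at ht
  obtain ⟨k, hk, hkt⟩ := ht
  rw [List.mem_filter, List.mem_range'_1] at hk
  exact ⟨k, ⟨by omega, by omega⟩, by simpa using hk.2, hkt⟩

lemma getD_map_filter_range' {α : Type*} (g : ℕ → α) (d : α) {k : ℕ} (hk : k ∈ Set.Icc 1 n)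
    (hP : P k) :
    (((List.range' 1 n).filter P).map g).getD ((Finset.Ico 1 k).filter P).card d = g k := by
  obtain ⟨h1, h2⟩ := hk
  have hsplit : List.range' 1 n = List.range' 1 (k - 1) ++ k :: List.range' (k + 1) (n - k) := by
    have := List.range'_append (s := 1) (m := k - 1) (n := n - k + 1) (step := 1)
    rw [show 1 + 1 * (k - 1) = k by omega, show k - 1 + (n - k + 1) = n by omega,
      List.range'_succ] at this
    exact this.symm
  have hlen : ((List.range' 1 (k - 1)).filter P).length =
      ((Finset.Ico 1 k).filter P).card := by
    rw [length_filter_range', Nat.sub_add_cancel h1]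
  rw [hsplit, List.filter_append, List.filter_cons_of_pos (by simpa using hP), List.map_append,
    List.getD_append_right _ _ _ _ (by rw [List.length_map, hlen])]
  simp [hlen]

/-- If the positions `i + 1` with `A` are those for which `i` satisfies `B`, and `1` satisfies `A`,
then the counts are shifted by one. -/
lemma card_filter_shift (A B : ℕ → Prop) [DecidablePred A] [DecidablePred B] (hA : A 1)
    (h : ∀ i, 1 ≤ i → i < n → (A (i + 1) ↔ B i)) {m : ℕ} (hm : 1 ≤ m) (hmn : m ≤ n) :
    ((Finset.Ico 1 (m + 1)).filter A).card = ((Finset.Ico 1 m).filter B).card + 1 := by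
  induction m, hm using Nat.le_induction with
  | base =>
    rw [card_filter_Ico_succ A le_rfl, if_pos hA]
    simp
  | succ m hm ih =>
    rw [card_filter_Ico_succ A (by omega), card_filter_Ico_succ B hm, ih (by omega)]
    simp only [h m hm (by omega)]
    omega

end Filters

/-- The entries beyond a cut at `m` exhaust the absolute values greater than `m`. -/
lemma IsPrefPerm.natAbs_le_of_isCut {n : ℕ} {w : ℕ → ℤ} (hw : IsPrefPerm n w) {m : ℕ}
    (hm : m ≤ n) (hc : IsCut n w m) {j : ℕ} (hj : 1 ≤ j) (hjm : j ≤ m) : (w j).natAbs ≤ m := by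
  by_contra hcon
  have hmaps : ∀ i ∈ insert j (Finset.Ioc m n), (w i).natAbs ∈ Finset.Ioc m n := by
    intro i hi
    rcases Finset.mem_insert.1 hi with rfl | hi
    · exact Finset.mem_Ioc.2 ⟨by omega, (hw.natAbs_mem ⟨hj, by omega⟩).2⟩
    · obtain ⟨h1, h2⟩ := Finset.mem_Ioc.1 hi
      exact Finset.mem_Ioc.2 ⟨hc i h1 h2, (hw.natAbs_mem ⟨by omega, h2⟩).2⟩
  have := Finset.card_le_card_of_injOn (fun i => (w i).natAbs) hmaps (by
    intro a ha b hb hab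
    refine hw.injOn ?_ ?_ hab
    · rcases Finset.mem_insert.1 (Finset.mem_coe.1 ha) with rfl | h
      · exact ⟨hj, by omega⟩
      · have := Finset.mem_Ioc.1 h; exact ⟨by omega, this.2⟩
    · rcases Finset.mem_insert.1 (Finset.mem_coe.1 hb) with rfl | h
      · exact ⟨hj, by omega⟩
      · have := Finset.mem_Ioc.1 h; exact ⟨by omega, this.2⟩)
  rw [Finset.card_insert_of_notMem (by simp; omega)] at this
  omega

lemma letter_eq {n : ℕ} (f : ℕ → ℕ) {k : ℕ} (hk : k ∈ Set.Icc 1 n) :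
    letter ((List.range' 1 n).map f) k = f k := by
  obtain ⟨h1, h2⟩ := hk
  unfold letter
  rw [List.getD_eq_getElem _ _ (by simp; omega)]
  simp
  congr 1
  omega

/-! ### Words and signed permutations -/

/-- The number of negative entries of `w` whose absolute value is at most that of `w i`: the
standardization of the entry `w i` among the negative ones. -/
def negRank (n : ℕ) (w : ℕ → ℤ) (i : ℕ) : ℕ :=
  ((Finset.Ico 1 (n + 1)).filter fun j => w j < 0 ∧ (w j).natAbs ≤ (w i).natAbs).card

/-- The word `p` and the signed permutation `w` correspond to each other under the bijection `α`.
The conditions determine each of `p` and `w` from the other. -/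
structure Corresponds (n : ℕ) (w : ℕ → ℤ) (p : List ℕ) : Prop where
  length_eq : p.length = n
  perm : IsPrefPerm n w
  first_iff : ∀ i, 1 ≤ i → i < n → (IsFirst p (i + 1) ↔ w i < 0)
  prev : ∀ i, 1 ≤ i → i < n → 0 < w i → w i = prevPos p (i + 1)
  letter_eq : ∀ i ∈ Set.Icc 1 n, ∀ k ∈ Set.Icc 1 n, w i < 0 → IsFirst p k →
    ((Finset.Ico 1 k).filter (IsFirst p)).card =
      ((Finset.Ico 1 i).filter fun j => w j < 0).card → letter p k = negRank n w i

section Positions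

variable {n : ℕ} {p : List ℕ}

lemma isFirst_one : IsFirst p 1 := by
  intro j hj
  simp at hj

lemma exists_isFirst {k : ℕ} (hk : 1 ≤ k) :
    ∃ r, 1 ≤ r ∧ r ≤ k ∧ IsFirst p r ∧ letter p r = letter p k := by
  induction k using Nat.strong_induction_on with
  | _ k ih =>
    by_cases h : IsFirst p k
    · exact ⟨k, hk, le_rfl, h, rfl⟩
    · unfold IsFirst at h
      push Not at h
      obtain ⟨j, hj, hjk⟩ := h
      rw [Finset.mem_Ico] at hj
      obtain ⟨r, h1, h2, h3, h4⟩ := ih j hj.2 hj.1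
      exact ⟨r, h1, by omega, h3, h4.trans hjk⟩

lemma eq_of_isFirst {k l : ℕ} (hk : 1 ≤ k) (hl : 1 ≤ l) (h1 : IsFirst p k) (h2 : IsFirst p l)
    (h : letter p k = letter p l) : k = l := by
  rcases lt_trichotomy k l with h3 | h3 | h3
  · exact absurd h (h2 k (Finset.mem_Ico.2 ⟨hk, h3⟩))
  · exact h3
  · exact absurd h.symm (h1 l (Finset.mem_Ico.2 ⟨hl, h3⟩))

lemma le_prevPos {j k : ℕ} (hj : 1 ≤ j) (hjk : j < k) (h : letter p j = letter p k) :
    j ≤ prevPos p k :=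
  Finset.le_sup (f := id) (Finset.mem_filter.2 ⟨Finset.mem_Ico.2 ⟨hj, hjk⟩, h⟩)

lemma prevPos_spec {k : ℕ} (h : ¬ IsFirst p k) :
    1 ≤ prevPos p k ∧ prevPos p k < k ∧ letter p (prevPos p k) = letter p k := by
  unfold IsFirst at h
  push Not at h
  obtain ⟨j, hj, hjk⟩ := h
  have hne : ((Finset.Ico 1 k).filter fun j => letter p j = letter p k).Nonempty :=
    ⟨j, Finset.mem_filter.2 ⟨hj, hjk⟩⟩
  obtain ⟨i, hi, hsup⟩ := Finset.exists_mem_eq_sup _ hne id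
  rw [Finset.mem_filter, Finset.mem_Ico] at hi
  have : prevPos p k = i := hsup
  rw [this]
  exact ⟨hi.1.1, hi.1.2, hi.2⟩

lemma prevPos_inj {k l : ℕ} (hk : ¬ IsFirst p k) (hl : ¬ IsFirst p l) (hk1 : 1 ≤ k) (hl1 : 1 ≤ l)
    (h : prevPos p k = prevPos p l) : k = l := by
  have hk' := prevPos_spec hk
  have hl' := prevPos_spec hl
  have hkl : letter p k = letter p l := by rw [← hk'.2.2, h, hl'.2.2]
  rcases lt_trichotomy k l with h3 | h3 | h3
  · have := le_prevPos hk1 h3 hkl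
    omega
  · exact h3
  · have := le_prevPos hl1 h3 hkl.symm
    omega

lemma letter_mem {k : ℕ} (hk : k ∈ Set.Icc 1 p.length) : letter p k ∈ p := by
  obtain ⟨h1, h2⟩ := hk
  unfold letter
  rw [List.getD_eq_getElem _ _ (by omega)]
  exact List.getElem_mem _

lemma exists_letter_eq {x : ℕ} (hx : x ∈ p) : ∃ k ∈ Set.Icc 1 p.length, letter p k = x := by
  obtain ⟨i, hi, rfl⟩ := List.getElem_of_mem hx
  refine ⟨i + 1, ⟨by omega, by omega⟩, ?_⟩
  unfold letter
  rw [Nat.add_sub_cancel, List.getD_eq_getElem _ _ hi]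

lemma eq_of_letter_eq {p' : List ℕ} (hp : p.length = n) (hp' : p'.length = n)
    (h : ∀ k ∈ Set.Icc 1 n, letter p k = letter p' k) : p = p' := by
  refine List.ext_getElem (by omega) fun i h1 h2 => ?_
  have := h (i + 1) ⟨by omega, by omega⟩
  unfold letter at this
  rwa [Nat.add_sub_cancel, List.getD_eq_getElem _ _ h1, List.getD_eq_getElem _ _ h2] at this

end Positions

section NegRank

variable {n : ℕ} {w : ℕ → ℤ}

lemma IsPrefPerm.lt_zero_of_not_pos (hw : IsPrefPerm n w) {i : ℕ} (hi : i ∈ Set.Icc 1 n)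
    (h : ¬ 0 < w i) : w i < 0 := by
  have := (hw.natAbs_mem hi).1
  omega

lemma negRank_mono {i j : ℕ} (h : (w i).natAbs ≤ (w j).natAbs) : negRank n w i ≤ negRank n w j :=
  Finset.card_le_card fun x hx => by
    rw [Finset.mem_filter] at hx ⊢
    exact ⟨hx.1, hx.2.1, hx.2.2.trans h⟩

lemma negRank_lt_iff {i j : ℕ} (hj : j ∈ Set.Icc 1 n) (hj0 : w j < 0) :
    negRank n w i < negRank n w j ↔ (w i).natAbs < (w j).natAbs := by
  constructor
  · intro h
    by_contra hcon
    exact absurd (negRank_mono (n := n) (not_lt.1 hcon)) (by omega)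
  · intro h
    refine Finset.card_lt_card (Finset.ssubset_iff_of_subset (fun x hx => ?_) |>.2 ⟨j, ?_, ?_⟩)
    · rw [Finset.mem_filter] at hx ⊢
      exact ⟨hx.1, hx.2.1, hx.2.2.trans h.le⟩
    · exact Finset.mem_filter.2 ⟨Finset.mem_Ico.2 ⟨hj.1, by have := hj.2; omega⟩, hj0, le_rfl⟩
    · rw [Finset.mem_filter]
      omega

lemma IsPrefPerm.negRank_inj (hw : IsPrefPerm n w) {i j : ℕ} (hi : i ∈ Set.Icc 1 n)
    (hj : j ∈ Set.Icc 1 n) (hi0 : w i < 0) (hj0 : w j < 0) (h : negRank n w i = negRank n w j) :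
    i = j := by
  refine hw.injOn hi hj (le_antisymm ?_ ?_)
  · exact not_lt.1 fun h' => absurd ((negRank_lt_iff hi hi0).2 h') (by omega)
  · exact not_lt.1 fun h' => absurd ((negRank_lt_iff hj hj0).2 h') (by omega)

lemma negRank_mem {i : ℕ} (hi : i ∈ Set.Icc 1 n) (hi0 : w i < 0) : 1 ≤ negRank n w i ∧
    negRank n w i ≤ ((Finset.Ico 1 (n + 1)).filter fun j => w j < 0).card := by
  constructor
  · refine Finset.card_pos.2 ⟨i, ?_⟩
    exact Finset.mem_filter.2 ⟨Finset.mem_Ico.2 ⟨hi.1, by have := hi.2; omega⟩, hi0, le_rfl⟩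
  · refine Finset.card_le_card fun x hx => ?_
    rw [Finset.mem_filter] at hx ⊢
    exact ⟨hx.1, hx.2.1⟩

lemma IsPrefPerm.exists_negRank_eq (hw : IsPrefPerm n w) {x : ℕ} (h1 : 1 ≤ x)
    (h2 : x ≤ ((Finset.Ico 1 (n + 1)).filter fun j => w j < 0).card) :
    ∃ i ∈ Set.Icc 1 n, w i < 0 ∧ negRank n w i = x := by
  have hmem : ∀ i ∈ (Finset.Ico 1 (n + 1)).filter (fun j => w j < 0),
      i ∈ Set.Icc 1 n ∧ w i < 0 := by
    intro i hi
    rw [Finset.mem_filter, Finset.mem_Ico] at hi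
    exact ⟨⟨hi.1.1, by omega⟩, hi.2⟩
  have himg : ((Finset.Ico 1 (n + 1)).filter fun j => w j < 0).image (negRank n w) =
      Finset.Icc 1 ((Finset.Ico 1 (n + 1)).filter fun j => w j < 0).card := by
    refine Finset.eq_of_subset_of_card_le (fun y hy => ?_) ?_
    · obtain ⟨i, hi, rfl⟩ := Finset.mem_image.1 hy
      exact Finset.mem_Icc.2 (negRank_mem (hmem i hi).1 (hmem i hi).2)
    · rw [Finset.card_image_of_injOn fun i hi j hj h => hw.negRank_inj (hmem i hi).1 (hmem j hj).1
        (hmem i hi).2 (hmem j hj).2 h]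
      simp
  obtain ⟨i, hi, hix⟩ := Finset.mem_image.1 (himg ▸ Finset.mem_Icc.2 ⟨h1, h2⟩)
  exact ⟨i, (hmem i hi).1, (hmem i hi).2, hix⟩

/-- If `S` holds for the absolute values of the negative entries only, counting the numbers with `S`
up to `y` amounts to counting negative entries. -/
lemma IsPrefPerm.card_filter_eq (hw : IsPrefPerm n w) (S : ℕ → Prop) [DecidablePred S]
    (hS : ∀ j ∈ Set.Icc 1 n, S (w j).natAbs ↔ w j < 0) {y : ℕ} (hy : y ≤ n) :
    ((Finset.Ico 1 (y + 1)).filter S).card =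
      ((Finset.Ico 1 (n + 1)).filter fun j => w j < 0 ∧ (w j).natAbs ≤ y).card := by
  symm
  refine Finset.card_bij (fun j _ => (w j).natAbs) ?_ ?_ ?_
  · intro j hj
    rw [Finset.mem_filter, Finset.mem_Ico] at hj ⊢
    have hjI : j ∈ Set.Icc 1 n := ⟨hj.1.1, by omega⟩
    exact ⟨⟨(hw.natAbs_mem hjI).1, by omega⟩, (hS j hjI).2 hj.2.1⟩
  · intro i hi j hj h
    rw [Finset.mem_filter, Finset.mem_Ico] at hi hj
    exact hw.injOn ⟨hi.1.1, by omega⟩ ⟨hj.1.1, by omega⟩ h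
  · intro x hx
    rw [Finset.mem_filter, Finset.mem_Ico] at hx
    obtain ⟨j, hj, rfl⟩ := hw.surj x ⟨hx.1.1, by omega⟩
    refine ⟨j, ?_, rfl⟩
    rw [Finset.mem_filter, Finset.mem_Ico]
    exact ⟨⟨hj.1, by have := hj.2; omega⟩, (hS j hj).1 hx.2, by omega⟩

end NegRank

namespace Corresponds

variable {n : ℕ} {w : ℕ → ℤ} {p : List ℕ}

lemma last_neg (h : Corresponds n w p) (hn : 1 ≤ n) : w n < 0 :=
  h.perm.lt_zero_of_not_pos ⟨hn, le_rfl⟩ fun h0 =>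
    absurd (h.perm.pos n ⟨hn, le_rfl⟩ h0).1 (lt_irrefl n)

lemma card_first (h : Corresponds n w p) {m : ℕ} (hm : 1 ≤ m) (hmn : m ≤ n) :
    ((Finset.Ico 1 (m + 1)).filter (IsFirst p)).card =
      ((Finset.Ico 1 m).filter fun j => w j < 0).card + 1 :=
  card_filter_shift (n := n) (IsFirst p) (fun j => w j < 0) isFirst_one h.first_iff hm hmn

/-- Up to a position with a negative entry, first occurrences and negative entries are equal in
number. -/
lemma card_first_of_neg (h : Corresponds n w p) {m : ℕ} (hm : m ∈ Set.Icc 1 n) (hm0 : w m < 0) :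
    ((Finset.Ico 1 (m + 1)).filter (IsFirst p)).card =
      ((Finset.Ico 1 (m + 1)).filter fun j => w j < 0).card := by
  rw [h.card_first hm.1 hm.2, card_filter_Ico_succ (fun j => w j < 0) hm.1, if_pos hm0]

lemma exists_first (h : Corresponds n w p) {i : ℕ} (hi : i ∈ Set.Icc 1 n) (hi0 : w i < 0) :
    ∃ k ∈ Set.Icc 1 n, IsFirst p k ∧ letter p k = negRank n w i ∧
      ((Finset.Ico 1 k).filter (IsFirst p)).card =
        ((Finset.Ico 1 i).filter fun j => w j < 0).card := by
  have hn := hi.1.trans hi.2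
  have h1 := (card_filter_Ico_lt_iff (fun j => w j < 0) (m := n) hi.1 hi0).2 hi.2
  rw [← h.card_first_of_neg ⟨hn, le_rfl⟩ (h.last_neg hn)] at h1
  obtain ⟨k, hk, hk1, hk2⟩ := exists_card_filter_eq (IsFirst p) h1
  exact ⟨k, hk, hk1, h.letter_eq i hi k hk hi0 hk1 hk2, hk2⟩

lemma exists_neg (h : Corresponds n w p) {k : ℕ} (hk : k ∈ Set.Icc 1 n) (hk1 : IsFirst p k) :
    ∃ i ∈ Set.Icc 1 n, w i < 0 ∧ letter p k = negRank n w i ∧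
      ((Finset.Ico 1 k).filter (IsFirst p)).card =
        ((Finset.Ico 1 i).filter fun j => w j < 0).card := by
  have hn := hk.1.trans hk.2
  have h1 := (card_filter_Ico_lt_iff (IsFirst p) (m := n) hk.1 hk1).2 hk.2
  rw [h.card_first_of_neg ⟨hn, le_rfl⟩ (h.last_neg hn)] at h1
  obtain ⟨i, hi, hi0, hi2⟩ := exists_card_filter_eq (fun j => w j < 0) h1
  exact ⟨i, hi, hi0, h.letter_eq i hi k hk hi0 hk1 hi2.symm, hi2.symm⟩

/-- The letters of the word are the standardized negative entries. -/
lemma isPreferenceFunction (h : Corresponds n w p) : IsPreferenceFunction n p := by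
  refine ⟨h.length_eq, ((Finset.Ico 1 (n + 1)).filter fun j => w j < 0).card, ?_, fun x => ?_⟩
  · refine (Finset.card_filter_le _ _).trans ?_
    simp
  constructor
  · intro hx
    obtain ⟨k, hk, rfl⟩ := exists_letter_eq hx
    obtain ⟨r, hr1, hrk, hr, hrl⟩ := exists_isFirst (p := p) hk.1
    have hk2 := hk.2
    rw [h.length_eq] at hk2
    obtain ⟨i, hi, hi0, hik, -⟩ := h.exists_neg ⟨hr1, hrk.trans hk2⟩ hr
    rw [← hrl, hik]
    exact negRank_mem hi hi0
  · rintro ⟨h1, h2⟩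
    obtain ⟨i, hi, hi0, rfl⟩ := h.perm.exists_negRank_eq h1 h2
    obtain ⟨k, hk, -, hkl, -⟩ := h.exists_first hi hi0
    rw [← hkl]
    exact letter_mem (by rwa [h.length_eq])

lemma letter_succ (h : Corresponds n w p) {i : ℕ} (hi : 1 ≤ i) (hin : i < n) (hi0 : 0 < w i) :
    w i = prevPos p (i + 1) ∧ 1 ≤ prevPos p (i + 1) ∧ prevPos p (i + 1) ≤ i ∧
      letter p (prevPos p (i + 1)) = letter p (i + 1) := by
  have h1 : ¬ IsFirst p (i + 1) := by
    rw [h.first_iff i hi hin]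
    omega
  obtain ⟨h2, h3, h4⟩ := prevPos_spec h1
  exact ⟨h.prev i hi hin hi0, h2, by omega, h4⟩

lemma congr {w' : ℕ → ℤ} (h : Corresponds n w p) (hw : ∀ j ∈ Set.Icc 1 n, w j = w' j) :
    Corresponds n w' p := by
  refine ⟨h.length_eq, ⟨fun k hk => ?_, fun j hj => ?_⟩, fun i hi hin => ?_, fun i hi hin => ?_, ?_⟩
  · obtain ⟨j, hj, hjk⟩ := h.perm.surj k hk
    exact ⟨j, hj, by rw [← hw j hj, hjk]⟩
  · rw [← hw j hj]
    exact h.perm.pos j hj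
  · rw [← hw i ⟨hi, hin.le⟩]
    exact h.first_iff i hi hin
  · rw [← hw i ⟨hi, hin.le⟩]
    exact h.prev i hi hin
  · intro i hi k hk hi0 hkF hc
    rw [← hw i hi] at hi0
    have hi2 := hi.2
    have hfilter : ((Finset.Ico 1 i).filter fun j => w' j < 0) =
        (Finset.Ico 1 i).filter fun j => w j < 0 :=
      Finset.filter_congr fun j hj => by
        rw [Finset.mem_Ico] at hj
        rw [hw j ⟨hj.1, by omega⟩]
    rw [hfilter] at hc
    rw [h.letter_eq i hi k hk hi0 hkF hc, negRank, negRank, hw i hi]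
    congr 1
    refine Finset.filter_congr fun j hj => ?_
    rw [Finset.mem_Ico] at hj
    rw [hw j ⟨hj.1, by omega⟩]

/-- The word is determined by the signed permutation. -/
lemma word_eq {p' : List ℕ} (h : Corresponds n w p) (h' : Corresponds n w p') : p = p' := by
  refine eq_of_letter_eq h.length_eq h'.length_eq ?_
  have hfirst : ∀ k, 1 ≤ k → k ≤ n → (IsFirst p k ↔ IsFirst p' k) := by
    intro k hk hkn
    obtain rfl | hk1 := eq_or_lt_of_le hk
    · exact iff_of_true isFirst_one isFirst_one
    · obtain ⟨i, rfl⟩ : ∃ i, k = i + 1 := ⟨k - 1, by omega⟩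
      rw [h.first_iff i (by omega) (by omega), h'.first_iff i (by omega) (by omega)]
  intro k hk
  obtain ⟨hk1, hkn⟩ := hk
  induction k using Nat.strong_induction_on with
  | _ k ih =>
    by_cases hF : IsFirst p k
    · obtain ⟨i, hi, hi0, hl, hc⟩ := h.exists_neg ⟨hk1, hkn⟩ hF
      rw [hl, h'.letter_eq i hi k ⟨hk1, hkn⟩ hi0 ((hfirst k hk1 hkn).1 hF)]
      rw [← hc]
      congr 1
      refine Finset.filter_congr fun j hj => ?_
      rw [Finset.mem_Ico] at hj
      exact (hfirst j hj.1 (by omega)).symm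
    · obtain ⟨i, rfl⟩ : ∃ i, k = i + 1 := ⟨k - 1, by omega⟩
      have hi1 : 1 ≤ i := Nat.one_le_iff_ne_zero.2 (by rintro rfl; exact hF isFirst_one)
      have hi0 : 0 < w i := by
        by_contra h0
        exact hF ((h.first_iff i hi1 (by omega)).2
          (h.perm.lt_zero_of_not_pos ⟨hi1, by omega⟩ h0))
      obtain ⟨h1, h2, h3, h4⟩ := h.letter_succ hi1 (by omega) hi0
      obtain ⟨h1', h2', h3', h4'⟩ := h'.letter_succ hi1 (by omega) hi0
      have heq : prevPos p (i + 1) = prevPos p' (i + 1) := by omega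
      rw [← h4, ← h4', ← heq]
      exact ih _ (by omega) h2 (by omega)

/-- A cut of the word at `m`, where all letters up to position `m` are smaller than all later ones,
is a cut of the signed permutation with a negative entry at `m`. -/
lemma isCut (h : Corresponds n w p) {m : ℕ} (hm : 1 ≤ m) (hmn : m < n)
    (hc : ∀ k l, 1 ≤ k → k ≤ m → m < l → l ≤ n → letter p k < letter p l) :
    IsCut n w m ∧ w m < 0 := by
  have hmF : IsFirst p (m + 1) := fun j hj => by
    rw [Finset.mem_Ico] at hj
    exact (hc j (m + 1) hj.1 (by omega) (by omega) (by omega)).ne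
  have hm0 := (h.first_iff m hm hmn).1 hmF
  refine ⟨?_, hm0⟩
  have hpos : ∀ j, m < j → j ≤ n → 0 < w j → m < (w j).natAbs := by
    intro j hj hjn hj0
    have hjn' := (h.perm.pos j ⟨by omega, hjn⟩ hj0).1
    obtain ⟨h1, h2, h3, h4⟩ := h.letter_succ (by omega) hjn' hj0
    by_contra hcon
    exact absurd h4 (hc _ (j + 1) h2 (by omega) (by omega) (by omega)).ne
  have hneg : ∀ i j, 1 ≤ i → i ≤ m → m < j → j ≤ n → w i < 0 → w j < 0 →
      (w i).natAbs < (w j).natAbs := by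
    intro i j hi him hj hjn hi0 hj0
    have hjI : j ∈ Set.Icc 1 n := ⟨by omega, hjn⟩
    rw [← negRank_lt_iff hjI hj0]
    have hcard := h.card_first_of_neg ⟨hm, hmn.le⟩ hm0
    obtain ⟨k, hk, hkF, hkl, hkc⟩ := h.exists_first ⟨hi, by omega⟩ hi0
    obtain ⟨l, hl, hlF, hll, hlc⟩ := h.exists_first hjI hj0
    rw [← hkl, ← hll]
    have h1 := card_filter_Ico_lt_iff (fun j => w j < 0) (m := m) hi hi0
    have h2 := card_filter_Ico_lt_iff (fun j => w j < 0) (m := m) hjI.1 hj0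
    rw [← hcard, ← hkc, card_filter_Ico_lt_iff _ hk.1 hkF] at h1
    rw [← hcard, ← hlc, card_filter_Ico_lt_iff _ hl.1 hlF] at h2
    exact hc k l hk.1 (h1.2 him) (by omega) hl.2
  intro j hj hjn
  by_contra hcon
  have hj0 : w j < 0 := h.perm.lt_zero_of_not_pos ⟨by omega, hjn⟩ fun h0 => hcon (hpos j hj hjn h0)
  -- the entries at `1, …, m` and `j` would be `m + 1` distinct numbers in `[1, m]`
  have hmaps : ∀ i ∈ insert j (Finset.Icc 1 m), (w i).natAbs ∈ Finset.Icc 1 m := by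
    intro i hi
    rcases Finset.mem_insert.1 hi with rfl | hi
    · exact Finset.mem_Icc.2 ⟨(h.perm.natAbs_mem ⟨by omega, hjn⟩).1, by omega⟩
    · obtain ⟨h1, h2⟩ := Finset.mem_Icc.1 hi
      have hiI : i ∈ Set.Icc 1 n := ⟨h1, by omega⟩
      refine Finset.mem_Icc.2 ⟨(h.perm.natAbs_mem hiI).1, ?_⟩
      by_cases hi0 : 0 < w i
      · have := (h.perm.pos i hiI hi0).2
        omega
      · have := hneg i j h1 h2 hj hjn (h.perm.lt_zero_of_not_pos hiI hi0) hj0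
        omega
  have := Finset.card_le_card_of_injOn (fun i => (w i).natAbs) hmaps (by
    intro a ha b hb hab
    refine h.perm.injOn ?_ ?_ hab
    · rcases Finset.mem_insert.1 (Finset.mem_coe.1 ha) with rfl | h
      · exact ⟨by omega, hjn⟩
      · have := Finset.mem_Icc.1 h; exact ⟨this.1, by omega⟩
    · rcases Finset.mem_insert.1 (Finset.mem_coe.1 hb) with rfl | h
      · exact ⟨by omega, hjn⟩
      · have := Finset.mem_Icc.1 h; exact ⟨this.1, by omega⟩)
  rw [Finset.card_insert_of_notMem (by simp; omega)] at this
  omega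

lemma letter_lt_of_isCut (h : Corresponds n w p) {m : ℕ} (hm : 1 ≤ m) (hmn : m < n)
    (hc : IsCut n w m) (hm0 : w m < 0) {k l : ℕ} (hk : 1 ≤ k) (hkm : k ≤ m) (hl : m < l)
    (hln : l ≤ n) : letter p k < letter p l := by
  -- letters in positions beyond `m` do not occur before
  have hroot : ∀ l, m < l → l ≤ n → ∃ r, m < r ∧ r ≤ n ∧ IsFirst p r ∧ letter p r = letter p l := by
    intro l hl hln
    induction l using Nat.strong_induction_on with
    | _ l ih =>
      by_cases hF : IsFirst p l
      · exact ⟨l, hl, hln, hF, rfl⟩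
      · obtain ⟨i, rfl⟩ : ∃ i, l = i + 1 := ⟨l - 1, by omega⟩
        have hi0 : 0 < w i := by
          by_contra h0
          exact hF ((h.first_iff i (by omega) (by omega)).2
            (h.perm.lt_zero_of_not_pos ⟨by omega, by omega⟩ h0))
        have him : m < i := by
          by_contra hcon
          have : i = m := by omega
          subst this
          omega
        obtain ⟨h1, h2, h3, h4⟩ := h.letter_succ (by omega) (by omega) hi0
        have := hc i him (by omega)
        obtain ⟨r, hr1, hr2, hr3, hr4⟩ := ih (prevPos p (i + 1)) (by omega) (by omega) (by omega)
        exact ⟨r, hr1, hr2, hr3, hr4.trans h4⟩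
  obtain ⟨r, hr1, hrk, hrF, hrl⟩ := exists_isFirst (p := p) hk
  obtain ⟨s, hs1, hsn, hsF, hsl⟩ := hroot l hl hln
  obtain ⟨i, hi, hi0, hil, hic⟩ := h.exists_neg ⟨hr1, by omega⟩ hrF
  obtain ⟨j, hj, hj0, hjl, hjc⟩ := h.exists_neg ⟨by omega, hsn⟩ hsF
  have hcard := h.card_first_of_neg ⟨hm, hmn.le⟩ hm0
  have h1 := card_filter_Ico_lt_iff (fun j => w j < 0) (m := m) hi.1 hi0
  have h2 := card_filter_Ico_lt_iff (fun j => w j < 0) (m := m) hj.1 hj0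
  rw [← hcard, ← hic, card_filter_Ico_lt_iff _ hr1 hrF] at h1
  rw [← hcard, ← hjc, card_filter_Ico_lt_iff _ (by omega) hsF] at h2
  rw [← hrl, ← hsl, hil, hjl, negRank_lt_iff hj hj0]
  have := h.perm.natAbs_le_of_isCut hmn.le hc hi.1 (h1.1 (by omega))
  have := hc j (by omega) hj.2
  omega

end Corresponds

/-- Atomicity in terms of positions. -/
lemma isAtomicWord_iff {n : ℕ} {p : List ℕ} (hp : p.length = n) : IsAtomicWord p ↔
    ¬ ∃ m, 1 ≤ m ∧ m < n ∧
      ∀ k l, 1 ≤ k → k ≤ m → m < l → l ≤ n → letter p k < letter p l := by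
  unfold IsAtomicWord
  refine not_congr ⟨?_, ?_⟩
  · rintro ⟨u, v, j, rfl, hu, hv, huj, hvj⟩
    have hu' := List.length_pos_iff.2 hu
    have hv' := List.length_pos_iff.2 hv
    rw [List.length_append] at hp
    refine ⟨u.length, hu', by omega, fun k l hk hkm hl hln => ?_⟩
    have h1 : letter (u ++ v) k ≤ j := by
      unfold letter
      rw [List.getD_append _ _ _ _ (by omega), List.getD_eq_getElem _ _ (by omega)]
      exact huj _ (List.getElem_mem _)
    have h2 : j < letter (u ++ v) l := by
      unfold letter
      rw [List.getD_append_right _ _ _ _ (by omega), List.getD_eq_getElem _ _ (by omega)]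
      exact hvj _ (List.getElem_mem _)
    omega
  · rintro ⟨m, hm, hmn, h⟩
    have hlt : ∀ x ∈ p.take m, ∀ y ∈ p.drop m, x < y := by
      intro x hx y hy
      obtain ⟨i, hi, rfl⟩ := List.getElem_of_mem hx
      obtain ⟨j, hj, rfl⟩ := List.getElem_of_mem hy
      rw [List.length_take] at hi
      rw [List.length_drop] at hj
      have := h (i + 1) (m + j + 1) (by omega) (by omega) (by omega) (by omega)
      unfold letter at this
      rw [Nat.add_sub_cancel, Nat.add_sub_cancel, List.getD_eq_getElem _ _ (by omega),
        List.getD_eq_getElem _ _ (by omega)] at this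
      rwa [List.getElem_take, List.getElem_drop]
    have hne : p.take m ≠ [] := List.ne_nil_of_length_pos (by rw [List.length_take]; omega)
    refine ⟨p.take m, p.drop m, (p.take m).foldr max 0, (List.take_append_drop m p).symm,
      hne, List.ne_nil_of_length_pos (by rw [List.length_drop]; omega), ?_, ?_⟩
    · intro x hx
      exact List.le_max_of_le hx le_rfl
    · intro y hy
      have hy0 : 0 < y := by
        obtain ⟨x, hx⟩ := List.exists_mem_of_ne_nil _ hne
        exact (Nat.zero_le x).trans_lt (hlt x hx y hy)
      have : ∀ l : List ℕ, (∀ x ∈ l, x < y) → l.foldr max 0 < y := by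
        intro l hl
        induction l with
        | nil => exact hy0
        | cons a l ih =>
          exact max_lt (hl a (by simp)) (ih fun x hx => hl x (by simp [hx]))
      exact this _ fun x hx => hlt x hx y hy

lemma Corresponds.isAtomic_iff {n : ℕ} {w : ℕ → ℤ} {p : List ℕ} (h : Corresponds n w p) :
    IsAtomicWord p ↔ IsAtomicPerm n w := by
  rw [isAtomicWord_iff h.length_eq]
  constructor
  · intro hp m hm hmn hc
    by_contra h0
    refine hp ⟨m, hm, hmn, fun k l => h.letter_lt_of_isCut hm hmn hc ?_⟩
    exact h.perm.lt_zero_of_not_pos ⟨hm, hmn.le⟩ h0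
  · rintro hw ⟨m, hm, hmn, hlt⟩
    obtain ⟨hc, h0⟩ := h.isCut hm hmn hlt
    have := hw m hm hmn hc
    omega

/-! ### The map `α` -/

section Alpha

variable {n : ℕ} {w : ℕ → ℤ}

lemma IsPrefPerm.not_isRepeat_succ (hw : IsPrefPerm n w) {i : ℕ} (hi : 1 ≤ i) (hin : i < n) :
    ¬ IsRepeat w (i + 1) ↔ w i < 0 := by
  have := (hw.natAbs_mem ⟨hi, hin.le⟩).1
  unfold IsRepeat
  rw [Nat.add_sub_cancel]
  omega

lemma negPattern_eq : negPattern n w =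
    ((List.range' 1 n).filter fun j => w j < 0).map (negRank n w) := by
  simp only [negPattern, List.filter_map, List.map_map]
  refine List.map_congr_left fun i _ => ?_
  rw [Function.comp_apply, List.countP_map, List.countP_eq_length_filter, List.filter_filter,
    negRank, ← length_filter_range']
  refine congrArg List.length (List.filter_congr fun j _ => ?_)
  simp [and_comm]

lemma alphaLetter_of_not_isRepeat {i k : ℕ} (hi : i ∈ Set.Icc 1 n)
    (hi0 : w i < 0) (hk : ¬ IsRepeat w k)
    (h : ((Finset.Ico 1 k).filter fun j => ¬ IsRepeat w j).card =
      ((Finset.Ico 1 i).filter fun j => w j < 0).card) :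
    alphaLetter n w k = negRank n w i := by
  rw [alphaLetter, if_neg hk, h, negPattern_eq]
  exact getD_map_filter_range' (fun j => w j < 0) (negRank n w) 0 hi hi0

lemma IsPrefPerm.alphaLetter_succ (hw : IsPrefPerm n w) {i : ℕ} (hi : i ∈ Set.Icc 1 n)
    (hi0 : 0 < w i) : alphaLetter n w (i + 1) = alphaLetter n w (w i).toNat := by
  have := (hw.pos i hi hi0).2
  have := hi.1
  rw [alphaLetter, if_pos ⟨by omega, by rwa [Nat.add_sub_cancel]⟩, Nat.add_sub_cancel,
    if_pos (by omega)]

/-- A position that is not of the form `i + 1` with `w i` positive is matched with a negative entry.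
-/
lemma IsPrefPerm.exists_alphaLetter_eq (hw : IsPrefPerm n w) {k : ℕ} (hk : k ∈ Set.Icc 1 n)
    (hk0 : ¬ IsRepeat w k) : ∃ i ∈ Set.Icc 1 n, w i < 0 ∧
      ((Finset.Ico 1 k).filter fun j => ¬ IsRepeat w j).card =
        ((Finset.Ico 1 i).filter fun j => w j < 0).card ∧
      alphaLetter n w k = negRank n w i := by
  have hn := hk.1.trans hk.2
  have hnn : w n < 0 := hw.lt_zero_of_not_pos ⟨hn, le_rfl⟩ fun h0 =>
    absurd (hw.pos n ⟨hn, le_rfl⟩ h0).1 (lt_irrefl n)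
  have h1 := (card_filter_Ico_lt_iff (fun j => ¬ IsRepeat w j) (m := n) hk.1 hk0).2 hk.2
  rw [card_filter_shift (n := n) (fun j => ¬ IsRepeat w j) (fun j => w j < 0)
    (by simp [IsRepeat]) (fun i => hw.not_isRepeat_succ) hn le_rfl] at h1
  have h2 := card_filter_Ico_succ (fun j => w j < 0) hn
  rw [if_pos hnn] at h2
  rw [← h2] at h1
  obtain ⟨i, hi, hi0, hik⟩ := exists_card_filter_eq (fun j => w j < 0) h1
  exact ⟨i, hi, hi0, hik.symm, alphaLetter_of_not_isRepeat hi hi0 hk0 hik.symm⟩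

lemma IsPrefPerm.eq_of_alphaLetter_eq (hw : IsPrefPerm n w) {k l : ℕ} (hk : k ∈ Set.Icc 1 n)
    (hl : l ∈ Set.Icc 1 n) (hk0 : ¬ IsRepeat w k) (hl0 : ¬ IsRepeat w l)
    (h : alphaLetter n w k = alphaLetter n w l) : k = l := by
  obtain ⟨i, hi, hi0, hik, hir⟩ := hw.exists_alphaLetter_eq hk hk0
  obtain ⟨j, hj, hj0, hjl, hjr⟩ := hw.exists_alphaLetter_eq hl hl0
  have hij := hw.negRank_inj hi hj hi0 hj0 (by omega)
  subst hij
  have h1 := card_filter_Ico_lt_iff (fun j => ¬ IsRepeat w j) (m := l) hk.1 hk0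
  have h2 := card_filter_Ico_lt_iff (fun j => ¬ IsRepeat w j) (m := k) hl.1 hl0
  rw [hik, ← hjl, card_filter_Ico_lt_iff _ hl.1 hl0] at h1
  rw [hjl, ← hik, card_filter_Ico_lt_iff _ hk.1 hk0] at h2
  have := h1.1 le_rfl
  have := h2.1 le_rfl
  omega

lemma IsPrefPerm.exists_not_isRepeat (hw : IsPrefPerm n w) {k : ℕ} (hk : k ∈ Set.Icc 1 n) :
    ∃ r ∈ Set.Icc 1 n, r ≤ k ∧ ¬ IsRepeat w r ∧ alphaLetter n w r = alphaLetter n w k := by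
  obtain ⟨hk1, hkn⟩ := hk
  induction k using Nat.strong_induction_on with
  | _ k ih =>
    by_cases h : IsRepeat w k
    · obtain ⟨i, rfl⟩ : ∃ i, k = i + 1 := ⟨k - 1, by omega⟩
      have hi0 : 0 < w i := h.2
      have hi : i ∈ Set.Icc 1 n := ⟨by have := h.1; omega, by omega⟩
      have := (hw.pos i hi hi0).2
      obtain ⟨r, hr, hrk, hr0, hrl⟩ := ih (w i).toNat (by omega) (by omega) (by omega)
      exact ⟨r, hr, by omega, hr0, by rw [hrl, hw.alphaLetter_succ hi hi0]⟩
    · exact ⟨k, ⟨hk1, hkn⟩, le_rfl, h, rfl⟩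

/-- Each later occurrence of the letter in position `q` points back, through positive entries, to
the occurrence that follows `q`; the latter points to `q`. -/
lemma IsPrefPerm.exists_pos_eq (hw : IsPrefPerm n w) {q j : ℕ} (hq : 1 ≤ q) (hqj : q < j)
    (hjn : j ≤ n) (h : alphaLetter n w q = alphaLetter n w j) :
    ∃ s, q ≤ s ∧ s < j ∧ w s = q := by
  induction j using Nat.strong_induction_on generalizing q with
  | _ j ih =>
    by_cases hj : IsRepeat w j
    · obtain ⟨i, rfl⟩ : ∃ i, j = i + 1 := ⟨j - 1, by omega⟩
      have hi0 : 0 < w i := hj.2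
      have hi : i ∈ Set.Icc 1 n := ⟨by omega, by omega⟩
      have hle := (hw.pos i hi hi0).2
      have hl := hw.alphaLetter_succ hi hi0
      rcases lt_trichotomy q (w i).toNat with h1 | h1 | h1
      · obtain ⟨s, hs1, hs2, hs3⟩ := ih (w i).toNat (by omega) hq h1 (by omega) (h.trans hl)
        exact ⟨s, hs1, by omega, hs3⟩
      · exact ⟨i, by omega, by omega, by omega⟩
      · obtain ⟨s, hs1, hs2, hs3⟩ := ih q (by omega) (q := (w i).toNat) (by omega) h1 (by omega)
          (hl.symm.trans h.symm)
        have := hw.injOn (x₁ := s) (x₂ := i) ⟨by omega, by omega⟩ hi (by simp only; omega)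
        omega
    · obtain ⟨r, hr, hrq, hr0, hrl⟩ := hw.exists_not_isRepeat (k := q) ⟨hq, by omega⟩
      have := hw.eq_of_alphaLetter_eq hr ⟨by omega, hjn⟩ hr0 hj (hrl.trans h)
      omega

lemma IsPrefPerm.isFirst_alpha_iff (hw : IsPrefPerm n w) {k : ℕ} (hk : k ∈ Set.Icc 1 n) :
    IsFirst (alpha n w) k ↔ ¬ IsRepeat w k := by
  constructor
  · intro h hr
    obtain ⟨i, rfl⟩ : ∃ i, k = i + 1 := ⟨k - 1, by have := hr.1; omega⟩
    have hi0 : 0 < w i := hr.2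
    have hi : i ∈ Set.Icc 1 n := ⟨by have := hr.1; omega, by have := hk.2; omega⟩
    have h1 := (hw.pos i hi hi0).2
    refine h (w i).toNat (Finset.mem_Ico.2 ⟨by omega, by omega⟩) ?_
    have h2 := hi.2
    rw [alpha, letter_eq _ ⟨by omega, by omega⟩, letter_eq _ hk, hw.alphaLetter_succ hi hi0]
  · intro h j hj heq
    rw [Finset.mem_Ico] at hj
    have hjI : j ∈ Set.Icc 1 n := ⟨hj.1, by have := hk.2; omega⟩
    rw [alpha, letter_eq _ hjI, letter_eq _ hk] at heq
    obtain ⟨r, hr, hrj, hr0, hrl⟩ := hw.exists_not_isRepeat hjI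
    have := hw.eq_of_alphaLetter_eq hr hk hr0 h (hrl.trans heq)
    omega

lemma IsPrefPerm.corresponds_alpha (hw : IsPrefPerm n w) : Corresponds n w (alpha n w) := by
  refine ⟨by simp [alpha], hw, fun i hi hin => ?_, fun i hi hin hi0 => ?_, ?_⟩
  · rw [hw.isFirst_alpha_iff ⟨by omega, by omega⟩, hw.not_isRepeat_succ hi hin]
  · have hiI : i ∈ Set.Icc 1 n := ⟨hi, hin.le⟩
    have hle := (hw.pos i hiI hi0).2
    have hF : ¬ IsFirst (alpha n w) (i + 1) := by
      rw [hw.isFirst_alpha_iff ⟨by omega, by omega⟩, hw.not_isRepeat_succ hi hin]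
      omega
    obtain ⟨h1, h2, h3⟩ := prevPos_spec hF
    have h4 : (w i).toNat ≤ prevPos (alpha n w) (i + 1) := by
      refine le_prevPos (by omega) (by omega) ?_
      rw [alpha, letter_eq _ ⟨by omega, by omega⟩, letter_eq _ ⟨by omega, by omega⟩,
        hw.alphaLetter_succ hiI hi0]
    by_contra hne
    have h5 : (w i).toNat < prevPos (alpha n w) (i + 1) := by omega
    have h6 : alphaLetter n w (w i).toNat = alphaLetter n w (prevPos (alpha n w) (i + 1)) := by
      rw [← hw.alphaLetter_succ hiI hi0, ← letter_eq (n := n) (alphaLetter n w) (k := prevPos _ _)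
        ⟨by omega, by omega⟩]
      rw [← letter_eq (n := n) (alphaLetter n w) (k := i + 1) ⟨by omega, by omega⟩]
      exact h3.symm
    obtain ⟨s, hs1, hs2, hs3⟩ := hw.exists_pos_eq (by omega) h5 (by omega) h6
    have := hw.injOn (x₁ := s) (x₂ := i) ⟨by omega, by omega⟩ hiI (by simp only; omega)
    omega
  · intro i hi k hk hi0 hkF hc
    rw [alpha, letter_eq _ hk]
    refine alphaLetter_of_not_isRepeat hi hi0 ((hw.isFirst_alpha_iff hk).1 hkF) ?_
    rw [← hc]
    congr 1
    refine Finset.filter_congr fun j hj => ?_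
    rw [Finset.mem_Ico] at hj
    exact (hw.isFirst_alpha_iff ⟨hj.1, by have := hk.2; omega⟩).symm

end Alpha

/-! ### The map inverse to `α` -/

/-- The absolute values of the positive entries of `α⁻¹(p)`. -/
def posValues (n : ℕ) (p : List ℕ) : Finset ℕ :=
  ((Finset.Icc 1 n).filter fun j => IsPositivePos n p j).image fun j => prevPos p (j + 1)

section AlphaInv

variable {n : ℕ} {p : List ℕ}

lemma alphaInv_of_pos {i : ℕ} (h : IsPositivePos n p i) :
    alphaInv n p i = prevPos p (i + 1) := if_pos h

/-- The entry of `α⁻¹(p)` in a nonpositive position, if `k` is the first occurrence and `y` the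
number that are matched with it. -/
lemma alphaInv_of_not_pos {i k y : ℕ} (h : ¬ IsPositivePos n p i) (hk : k ∈ Set.Icc 1 n)
    (hkF : IsFirst p k) (hik : ((Finset.Ico 1 k).filter (IsFirst p)).card =
      ((Finset.Ico 1 i).filter fun j => ¬ IsPositivePos n p j).card)
    (hy : y ∈ Set.Icc 1 n) (hyT : y ∉ posValues n p)
    (hl : letter p k = ((Finset.Ico 1 y).filter (· ∉ posValues n p)).card + 1) :
    alphaInv n p i = -y := by
  have h1 := getD_map_filter_range' (IsFirst p) (letter p) 0 hk hkF
  have h2 := getD_map_filter_range' (· ∉ posValues n p) id 0 hy hyT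
  rw [List.map_id] at h2
  unfold alphaInv
  rw [if_neg h]
  simp only
  rw [← hik, h1, hl, Nat.add_sub_cancel]
  unfold posValues at h2
  unfold posValues
  simp only [id] at h2
  rw [h2]
  simp

lemma Corresponds.isPositivePos_iff {w : ℕ → ℤ} (h : Corresponds n w p) {i : ℕ}
    (hi : i ∈ Set.Icc 1 n) : IsPositivePos n p i ↔ 0 < w i := by
  have h0 := (h.perm.natAbs_mem hi).1
  unfold IsPositivePos
  constructor
  · rintro ⟨h1, h2⟩
    rw [h.first_iff i hi.1 h1] at h2
    omega
  · intro hpos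
    have h1 := (h.perm.pos i hi hpos).1
    rw [h.first_iff i hi.1 h1]
    exact ⟨h1, by omega⟩

lemma Corresponds.mem_posValues_iff {w : ℕ → ℤ} (h : Corresponds n w p) {i : ℕ}
    (hi : i ∈ Set.Icc 1 n) : (w i).natAbs ∈ posValues n p ↔ 0 < w i := by
  unfold posValues
  rw [Finset.mem_image]
  constructor
  · rintro ⟨j, hj, hji⟩
    rw [Finset.mem_filter, Finset.mem_Icc] at hj
    have hj0 := (h.isPositivePos_iff hj.1).1 hj.2
    have := h.prev j hj.1.1 hj.2.1 hj0
    have hij := h.perm.injOn (x₁ := j) (x₂ := i) hj.1 hi (by simp only; omega)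
    rwa [← hij]
  · intro hi0
    have hp := (h.isPositivePos_iff hi).2 hi0
    refine ⟨i, Finset.mem_filter.2 ⟨Finset.mem_Icc.2 hi, hp⟩, ?_⟩
    have := h.prev i hi.1 hp.1 hi0
    omega

/-- The signed permutation is determined by the word, namely as its image under `alphaInv`. -/
lemma Corresponds.alphaInv_eq {w : ℕ → ℤ} (h : Corresponds n w p) {i : ℕ} (hi : i ∈ Set.Icc 1 n) :
    alphaInv n p i = w i := by
  by_cases hi0 : 0 < w i
  · rw [alphaInv_of_pos ((h.isPositivePos_iff hi).2 hi0)]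
    exact (h.prev i hi.1 (h.perm.pos i hi hi0).1 hi0).symm
  · have hneg := h.perm.lt_zero_of_not_pos hi hi0
    obtain ⟨k, hk, hkF, hkl, hkc⟩ := h.exists_first hi hneg
    have habs := h.perm.natAbs_mem hi
    rw [alphaInv_of_not_pos (y := (w i).natAbs) (by rwa [h.isPositivePos_iff hi]) hk hkF ?_ habs
      (by rwa [h.mem_posValues_iff hi])]
    · omega
    · have h1 := h.perm.card_filter_eq (· ∉ posValues n p) (fun j hj => by
        rw [h.mem_posValues_iff hj]
        exact ⟨h.perm.lt_zero_of_not_pos hj, fun h => by omega⟩) habs.2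
      rw [card_filter_Ico_succ _ habs.1, if_pos (by rwa [h.mem_posValues_iff hi])] at h1
      rw [hkl, h1]
      rfl
    · rw [hkc]
      congr 1
      refine Finset.filter_congr fun j hj => ?_
      rw [Finset.mem_Ico] at hj
      have hjI : j ∈ Set.Icc 1 n := ⟨hj.1, by have := hi.2; omega⟩
      rw [h.isPositivePos_iff hjI]
      exact ⟨fun h => by omega, h.perm.lt_zero_of_not_pos hjI⟩

lemma not_isPositivePos_iff {i : ℕ} (hin : i < n) :
    IsFirst p (i + 1) ↔ ¬ IsPositivePos n p i := by
  unfold IsPositivePos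
  tauto

lemma card_posValues : (posValues n p).card =
    ((Finset.Icc 1 n).filter fun j => IsPositivePos n p j).card := by
  refine Finset.card_image_of_injOn fun i hi j hj h => ?_
  simp only [Finset.coe_filter, Set.mem_ofPred_eq] at hi hj
  have := prevPos_inj hi.2.2 hj.2.2 (by omega) (by omega) h
  omega

lemma posValues_subset : posValues n p ⊆ Finset.Icc 1 n := by
  intro x hx
  obtain ⟨j, hj, rfl⟩ := Finset.mem_image.1 hx
  rw [Finset.mem_filter, Finset.mem_Icc] at hj
  have := prevPos_spec hj.2.2
  exact Finset.mem_Icc.2 ⟨this.1, by omega⟩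

lemma card_first_eq (hn : 1 ≤ n) : ((Finset.Ico 1 (n + 1)).filter (IsFirst p)).card =
    ((Finset.Ico 1 (n + 1)).filter fun j => ¬ IsPositivePos n p j).card := by
  rw [card_filter_shift (n := n) (IsFirst p) (fun j => ¬ IsPositivePos n p j) isFirst_one
    (fun i _ hin => not_isPositivePos_iff hin) hn le_rfl,
    card_filter_Ico_succ (fun j => ¬ IsPositivePos n p j) hn,
    if_pos fun h => absurd h.1 (lt_irrefl n)]

lemma card_notMem_posValues (hn : 1 ≤ n) :
    ((Finset.Ico 1 (n + 1)).filter (· ∉ posValues n p)).card =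
      ((Finset.Ico 1 (n + 1)).filter (IsFirst p)).card := by
  have hI : Finset.Ico 1 (n + 1) = Finset.Icc 1 n := rfl
  have h1 := Finset.card_filter_add_card_filter_not (s := Finset.Icc 1 n) (· ∈ posValues n p)
  have h2 := Finset.card_filter_add_card_filter_not (s := Finset.Icc 1 n)
    (fun j => IsPositivePos n p j)
  rw [Finset.filter_mem_eq_inter, Finset.inter_eq_right.2 posValues_subset, card_posValues] at h1
  rw [card_first_eq hn, hI]
  omega

lemma IsPreferenceFunction.card_first (hp : IsPreferenceFunction n p) {x : ℕ} :
    x ∈ p ↔ 1 ≤ x ∧ x ≤ ((Finset.Ico 1 (n + 1)).filter (IsFirst p)).card := by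
  obtain ⟨hlen, K, -, hK⟩ := hp
  have : ((Finset.Ico 1 (n + 1)).filter (IsFirst p)).card = K := by
    rw [← Nat.card_Icc 1 K |>.trans (Nat.add_sub_cancel ..)]
    refine Finset.card_bij (fun k _ => letter p k) ?_ ?_ ?_
    · intro k hk
      rw [Finset.mem_filter, Finset.mem_Ico] at hk
      exact Finset.mem_Icc.2 ((hK _).1 (letter_mem ⟨hk.1.1, by omega⟩))
    · intro k hk l hl h
      rw [Finset.mem_filter, Finset.mem_Ico] at hk hl
      exact eq_of_isFirst hk.1.1 hl.1.1 hk.2 hl.2 h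
    · intro x hx
      obtain ⟨k, hk, rfl⟩ := exists_letter_eq ((hK x).2 (Finset.mem_Icc.1 hx))
      obtain ⟨r, h1, h2, h3, h4⟩ := exists_isFirst (p := p) hk.1
      refine ⟨r, Finset.mem_filter.2 ⟨Finset.mem_Ico.2 ⟨h1, ?_⟩, h3⟩, h4⟩
      have := hk.2
      omega
  rw [this]
  exact hK x

/-- Matching a first occurrence with a number outside `posValues`. -/
lemma IsPreferenceFunction.exists_value (hp : IsPreferenceFunction n p) (hn : 1 ≤ n) {k : ℕ}
    (hk : k ∈ Set.Icc 1 n) : ∃ y ∈ Set.Icc 1 n, y ∉ posValues n p ∧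
      letter p k = ((Finset.Ico 1 y).filter (· ∉ posValues n p)).card + 1 := by
  have h1 := hp.card_first.1 (letter_mem (p := p) (k := k) (by rwa [hp.1]))
  rw [← card_notMem_posValues hn] at h1
  obtain ⟨y, hy, hyT, hyc⟩ := exists_card_filter_eq (n := n) (· ∉ posValues n p)
    (t := letter p k - 1) (by omega)
  exact ⟨y, hy, hyT, by omega⟩

lemma exists_first_of_not_pos {i : ℕ} (hi : i ∈ Set.Icc 1 n) (h : ¬ IsPositivePos n p i) :
    ∃ k ∈ Set.Icc 1 n, IsFirst p k ∧ ((Finset.Ico 1 k).filter (IsFirst p)).card =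
      ((Finset.Ico 1 i).filter fun j => ¬ IsPositivePos n p j).card := by
  have h1 := (card_filter_Ico_lt_iff (fun j => ¬ IsPositivePos n p j) (m := n) hi.1 h).2 hi.2
  rw [← card_first_eq (hi.1.trans hi.2)] at h1
  exact exists_card_filter_eq (IsFirst p) h1

lemma exists_not_pos_of_first {k : ℕ} (hk : k ∈ Set.Icc 1 n) (h : IsFirst p k) :
    ∃ i ∈ Set.Icc 1 n, ¬ IsPositivePos n p i ∧ ((Finset.Ico 1 k).filter (IsFirst p)).card =
      ((Finset.Ico 1 i).filter fun j => ¬ IsPositivePos n p j).card := by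
  have h1 := (card_filter_Ico_lt_iff (IsFirst p) (m := n) hk.1 h).2 hk.2
  rw [card_first_eq (hk.1.trans hk.2)] at h1
  obtain ⟨i, hi, hi0, hik⟩ := exists_card_filter_eq (fun j => ¬ IsPositivePos n p j) h1
  exact ⟨i, hi, hi0, hik.symm⟩

lemma IsPreferenceFunction.alphaInv_neg (hp : IsPreferenceFunction n p) {i : ℕ}
    (hi : i ∈ Set.Icc 1 n) (h : ¬ IsPositivePos n p i) :
    ∃ y ∈ Set.Icc 1 n, y ∉ posValues n p ∧ alphaInv n p i = -y := by
  obtain ⟨k, hk, hkF, hik⟩ := exists_first_of_not_pos hi h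
  obtain ⟨y, hy, hyT, hyl⟩ := hp.exists_value (hi.1.trans hi.2) hk
  exact ⟨y, hy, hyT, alphaInv_of_not_pos h hk hkF hik hy hyT hyl⟩

lemma IsPreferenceFunction.alphaInv_pos_iff (hp : IsPreferenceFunction n p) {i : ℕ}
    (hi : i ∈ Set.Icc 1 n) : 0 < alphaInv n p i ↔ IsPositivePos n p i := by
  constructor
  · intro h
    by_contra hcon
    obtain ⟨y, -, -, hy⟩ := hp.alphaInv_neg hi hcon
    omega
  · intro h
    rw [alphaInv_of_pos h]
    have := (prevPos_spec h.2).1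
    omega

lemma IsPreferenceFunction.alphaInv_lt_zero_iff (hp : IsPreferenceFunction n p) {i : ℕ}
    (hi : i ∈ Set.Icc 1 n) : alphaInv n p i < 0 ↔ ¬ IsPositivePos n p i := by
  constructor
  · intro h h'
    rw [alphaInv_of_pos h'] at h
    omega
  · intro h
    obtain ⟨y, h1, -, hy⟩ := hp.alphaInv_neg hi h
    have := h1.1
    omega

lemma IsPreferenceFunction.isPrefPerm_alphaInv (hp : IsPreferenceFunction n p) :
    IsPrefPerm n (alphaInv n p) := by
  refine ⟨fun y hy => ?_, fun j hj hpos => ?_⟩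
  · by_cases hyT : y ∈ posValues n p
    · obtain ⟨j, hj, rfl⟩ := Finset.mem_image.1 hyT
      rw [Finset.mem_filter, Finset.mem_Icc] at hj
      exact ⟨j, hj.1, by rw [alphaInv_of_pos hj.2, Int.natAbs_natCast]⟩
    · have hn := hy.1.trans hy.2
      have h1 := (card_filter_Ico_lt_iff (· ∉ posValues n p) (m := n) hy.1 hyT).2 hy.2
      rw [card_notMem_posValues hn] at h1
      obtain ⟨l, hl, hlx⟩ := exists_letter_eq (hp.card_first.2 ⟨Nat.le_add_left 1 _, h1⟩)
      obtain ⟨k, hk1, hkl, hkF, hk⟩ := exists_isFirst (p := p) hl.1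
      have hkI : k ∈ Set.Icc 1 n := ⟨hk1, by have := hl.2; have := hp.1; omega⟩
      obtain ⟨i, hi, hi0, hik⟩ := exists_not_pos_of_first hkI hkF
      exact ⟨i, hi, by rw [alphaInv_of_not_pos hi0 hkI hkF hik hy hyT (hk.trans hlx),
        Int.natAbs_neg, Int.natAbs_natCast]⟩
  · have h := (hp.alphaInv_pos_iff hj).1 hpos
    rw [alphaInv_of_pos h]
    have := (prevPos_spec h.2).2.1
    exact ⟨h.1, by omega⟩

lemma IsPreferenceFunction.corresponds_alphaInv (hp : IsPreferenceFunction n p) :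
    Corresponds n (alphaInv n p) p := by
  have hw := hp.isPrefPerm_alphaInv
  refine ⟨hp.1, hw, fun i hi hin => ?_, fun i hi hin hi0 => ?_, ?_⟩
  · rw [hp.alphaInv_lt_zero_iff ⟨hi, hin.le⟩, not_isPositivePos_iff hin]
  · exact alphaInv_of_pos ((hp.alphaInv_pos_iff ⟨hi, hin.le⟩).1 hi0)
  · intro i hi k hk hi0 hkF hik
    have hS : ∀ j ∈ Set.Icc 1 n, (alphaInv n p j).natAbs ∉ posValues n p ↔ alphaInv n p j < 0 := by
      intro j hj
      rw [hp.alphaInv_lt_zero_iff hj]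
      refine not_congr ⟨fun h => ?_, fun h => ?_⟩
      · by_contra hcon
        obtain ⟨y, -, hyT, hy⟩ := hp.alphaInv_neg hj hcon
        rw [hy, Int.natAbs_neg, Int.natAbs_natCast] at h
        exact hyT h
      · rw [alphaInv_of_pos h, Int.natAbs_natCast]
        exact Finset.mem_image.2 ⟨j, Finset.mem_filter.2 ⟨Finset.mem_Icc.2 hj, h⟩, rfl⟩
    have hcongr : ((Finset.Ico 1 i).filter fun j => alphaInv n p j < 0).card =
        ((Finset.Ico 1 i).filter fun j => ¬ IsPositivePos n p j).card := by
      congr 1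
      refine Finset.filter_congr fun j hj => ?_
      rw [Finset.mem_Ico] at hj
      exact hp.alphaInv_lt_zero_iff ⟨hj.1, by have := hi.2; omega⟩
    obtain ⟨y, hy, hyT, hyl⟩ := hp.exists_value (hi.1.trans hi.2) hk
    have hiy := alphaInv_of_not_pos ((hp.alphaInv_lt_zero_iff hi).1 hi0) hk hkF
      (hik.trans hcongr) hy hyT hyl
    have h1 := hw.card_filter_eq (· ∉ posValues n p) hS hy.2
    rw [card_filter_Ico_succ _ hy.1, if_pos hyT] at h1
    rw [hyl, h1, negRank, hiy, Int.natAbs_neg, Int.natAbs_natCast]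

end AlphaInv

/-! ### Counting preference functions -/

/-- The values of `f` form an initial segment of `ℕ`. -/
def IsInitial {α : Type} (f : α → ℕ) : Prop := ∀ x, ∀ y < f x, ∃ z, f z = y

/-- A function with initial range amounts to the set where it is positive and its restriction to
this set, lowered by one. -/
def initialEquiv (α : Type) [Fintype α] [DecidableEq α] [Nonempty α] :
    {f : α → ℕ // IsInitial f} ≃
      Σ S : {S : Finset α // S ≠ Finset.univ}, {g : S.1 → ℕ // IsInitial g} where
  toFun f := ⟨⟨Finset.univ.filter fun x => f.1 x ≠ 0, by
      intro h
      have h0 : ∃ z, f.1 z = 0 := by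
        obtain ⟨x⟩ := ‹Nonempty α›
        by_cases hx : f.1 x = 0
        · exact ⟨x, hx⟩
        · exact f.2 x 0 (Nat.pos_of_ne_zero hx)
      obtain ⟨z, hz⟩ := h0
      have := Finset.mem_univ z
      rw [← h, Finset.mem_filter] at this
      exact this.2 hz⟩,
    fun x => f.1 x.1 - 1, by
      rintro ⟨x, hx⟩ y hy
      simp only at hy
      obtain ⟨z, hz⟩ := f.2 x (y + 1) (by omega)
      exact ⟨⟨z, Finset.mem_filter.2 ⟨Finset.mem_univ _, by omega⟩⟩, by simp only; omega⟩⟩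
  invFun s := ⟨fun x => if h : x ∈ s.1.1 then s.2.1 ⟨x, h⟩ + 1 else 0, by
    intro x y hy
    simp only at hy ⊢
    obtain _ | y := y
    · have : ∃ z, z ∉ s.1.1 := by
        by_contra hcon
        push Not at hcon
        exact s.1.2 (Finset.eq_univ_iff_forall.2 hcon)
      obtain ⟨z, hz⟩ := this
      exact ⟨z, dif_neg hz⟩
    · split_ifs at hy with h
      · obtain ⟨⟨z, hz⟩, hzy⟩ := s.2.2 ⟨x, h⟩ y (by omega)
        exact ⟨z, by rw [dif_pos hz, hzy]⟩
      · omega⟩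
  left_inv f := by
    ext x
    simp only [Finset.mem_filter, Finset.mem_univ, true_and, ne_eq, dite_eq_ite]
    split_ifs with h <;> omega
  right_inv := by
    rintro ⟨⟨S, hS⟩, ⟨g, hg⟩⟩
    have hfilter : (Finset.univ.filter fun x =>
        (if h : x ∈ S then g ⟨x, h⟩ + 1 else 0) ≠ 0) = S := by
      ext x
      by_cases h : x ∈ S <;> simp [h]
    simp only
    have key : ∀ (T : Finset α) (hT : T = S) (hT' : T ≠ Finset.univ) (g' : T → ℕ)
        (hg' : IsInitial g'), (∀ x : T, g' x = g ⟨x.1, hT ▸ x.2⟩) →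
        (⟨⟨T, hT'⟩, ⟨g', hg'⟩⟩ : Σ S : {S : Finset α // S ≠ Finset.univ},
          {g : S.1 → ℕ // IsInitial g}) = ⟨⟨S, hS⟩, ⟨g, hg⟩⟩ := by
      rintro T rfl hT' g' hg' h
      obtain rfl : g' = g := funext h
      rfl
    refine key _ hfilter _ _ _ ?_
    rintro ⟨x, hx⟩
    have hxS : x ∈ S := hfilter ▸ hx
    simp [hxS]

lemma orderedBell_eq_sum {n : ℕ} (hn : n ≠ 0) :
    orderedBell n = ∑ k ∈ Finset.range n, n.choose k * orderedBell k := by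
  rw [orderedBell, if_neg hn]
  exact Fin.sum_univ_eq_sum_range (fun k => n.choose k * orderedBell k) n

lemma card_isInitial (n : ℕ) : ∀ (α : Type) [Fintype α] [DecidableEq α], Fintype.card α = n →
    Finite {f : α → ℕ // IsInitial f} ∧ Nat.card {f : α → ℕ // IsInitial f} = orderedBell n := by
  induction n using Nat.strong_induction_on with
  | _ n ih =>
    intro α _ _ hα
    obtain rfl | hn := eq_or_ne n 0
    · have : IsEmpty α := Fintype.card_eq_zero_iff.1 hα
      have hu : Unique {f : α → ℕ // IsInitial f} :=
        ⟨⟨⟨isEmptyElim, fun x => isEmptyElim x⟩⟩, fun f => Subsingleton.elim _ _⟩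
      exact ⟨inferInstance, by rw [Nat.card_unique, orderedBell, if_pos rfl]⟩
    · have : Nonempty α := Fintype.card_pos_iff.1 (by omega)
      have hlt : ∀ S : {S : Finset α // S ≠ Finset.univ}, S.1.card < n := fun S => by
        rw [← hα]
        exact (Finset.card_lt_iff_ne_univ S.1).2 S.2
      have hfib := fun S : {S : Finset α // S ≠ Finset.univ} =>
        ih S.1.card (hlt S) S.1 (Fintype.card_coe _)
      have hfin := fun S => (hfib S).1
      refine ⟨Finite.of_equiv _ (initialEquiv α).symm, ?_⟩
      rw [Nat.card_congr (initialEquiv α), Nat.card_sigma]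
      rw [Finset.sum_congr rfl fun S _ => (hfib S).2]
      have h1 := Finset.sum_powerset_apply_card (fun k => orderedBell k)
        (x := (Finset.univ : Finset α))
      rw [Finset.card_univ, hα, Finset.sum_range_succ, Finset.powerset_univ, Nat.choose_self,
        one_smul, ← Finset.sum_erase_add _ _ (Finset.mem_univ (Finset.univ : Finset α)),
        Finset.card_univ, hα] at h1
      rw [orderedBell_eq_sum hn]
      simp only [smul_eq_mul] at h1
      rw [← Nat.add_right_cancel h1]
      exact (Finset.sum_subtype _ (fun S => by simp)
        fun S : Finset α => orderedBell S.card).symm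

section PreferenceFunctions

variable {n : ℕ} {p : List ℕ}

lemma isPreferenceFunction_of_closed (h1 : ∀ x ∈ p, 1 ≤ x)
    (h2 : ∀ x ∈ p, ∀ y, 1 ≤ y → y ≤ x → y ∈ p) : IsPreferenceFunction p.length p := by
  have hle : ∀ x ∈ p, x ≤ p.toFinset.card := by
    intro x hx
    have : Finset.Icc 1 x ⊆ p.toFinset := fun y hy => by
      rw [Finset.mem_Icc] at hy
      exact List.mem_toFinset.2 (h2 x hx y hy.1 hy.2)
    have := Finset.card_le_card this
    simpa using this
  have heq : p.toFinset = Finset.Icc 1 p.toFinset.card :=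
    Finset.eq_of_subset_of_card_le
      (fun x hx => Finset.mem_Icc.2
        ⟨h1 x (List.mem_toFinset.1 hx), hle x (List.mem_toFinset.1 hx)⟩) (by simp)
  refine ⟨rfl, p.toFinset.card, List.toFinset_card_le p, fun x => ?_⟩
  rw [← List.mem_toFinset, ← Finset.mem_Icc, ← heq]

/-- The letters of a preference function are the numbers from `1` to the number of letters. -/
lemma IsPreferenceFunction.mem_iff (hp : IsPreferenceFunction n p) {x : ℕ} :
    x ∈ p ↔ 1 ≤ x ∧ x ≤ p.toFinset.card := by
  obtain ⟨-, k, -, hk⟩ := hp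
  have : p.toFinset = Finset.Icc 1 k := by
    ext x
    rw [List.mem_toFinset, hk, Finset.mem_Icc]
  rw [this, Nat.card_Icc, Nat.add_sub_cancel, hk]

lemma finite_isPreferenceFunction (n : ℕ) : {p | IsPreferenceFunction n p}.Finite := by
  refine (List.finite_length_eq (Fin (n + 1)) n |>.image (List.map Fin.val)).subset ?_
  rintro p ⟨hlen, k, hkn, hk⟩
  refine ⟨p.map (Fin.ofNat (n + 1)), by simpa using hlen, ?_⟩
  rw [List.map_map]
  refine (List.map_congr_left fun x hx => ?_).trans (List.map_id p)
  have := (hk x).1 hx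
  simp only [Function.comp_apply, Fin.val_ofNat, id]
  exact Nat.mod_eq_of_lt (by omega)

lemma ncard_isPreferenceFunction (n : ℕ) :
    {p | IsPreferenceFunction n p}.ncard = orderedBell n := by
  rw [← (card_isInitial n (Fin n) (Fintype.card_fin n)).2, ← Nat.card_coe_set_eq]
  symm
  have hP : ∀ f : {f : Fin n → ℕ // IsInitial f},
      IsPreferenceFunction n (List.ofFn fun i => f.1 i + 1) := by
    intro f
    have := isPreferenceFunction_of_closed (p := List.ofFn fun i => f.1 i + 1) ?_ ?_
    · rwa [List.length_ofFn] at this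
    · intro x hx
      obtain ⟨i, rfl⟩ := (List.mem_ofFn).1 hx
      omega
    · intro x hx y hy1 hyx
      obtain ⟨i, rfl⟩ := (List.mem_ofFn).1 hx
      obtain h | h := eq_or_lt_of_le hyx
      · rwa [h]
      · obtain ⟨z, hz⟩ := f.2 i (y - 1) (by omega)
        exact (List.mem_ofFn).2 ⟨z, by omega⟩
  refine Nat.card_eq_of_bijective (fun f => ⟨_, hP f⟩) ⟨fun f g h => ?_, ?_⟩
  · have := List.ofFn_injective (congrArg Subtype.val h)
    ext i
    have := congrFun this i
    simpa using this
  · rintro ⟨p, hp⟩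
    have hmem := fun x => hp.mem_iff (x := x)
    have hlen : p.length = n := hp.1
    refine ⟨⟨fun i => p[i.1] - 1, ?_⟩, ?_⟩
    · intro i y hy
      simp only at hy
      have h1 := (hmem _).1 (List.getElem_mem (l := p) (n := i.1) (by omega))
      obtain ⟨j, hj, hjy⟩ := List.getElem_of_mem ((hmem (y + 1)).2 ⟨by omega, by omega⟩)
      exact ⟨⟨j, by omega⟩, by simp only; omega⟩
    · refine Subtype.ext (List.ext_getElem (by simpa using hlen.symm) fun i h1 h2 => ?_)
      simp only [List.getElem_ofFn]
      have := (hmem _).1 (List.getElem_mem (l := p) h2)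
      omega

/-- Two atomic words followed by words in larger letters. -/
lemma eq_of_append_eq {u v u' v' : List ℕ} {j j' : ℕ} (hu : u ≠ []) (hu' : u' ≠ [])
    (ha : IsAtomicWord u) (ha' : IsAtomicWord u') (hj : ∀ x ∈ u, x ≤ j) (hv : ∀ x ∈ v, j < x)
    (hj' : ∀ x ∈ u', x ≤ j') (hv' : ∀ x ∈ v', j' < x) (h : u ++ v = u' ++ v') : u = u' := by
  rcases List.append_eq_append_iff.1 h with ⟨t, h1, h2⟩ | ⟨t, h1, h2⟩
  · by_contra hne
    refine ha' ⟨u, t, j, h1, hu, ?_, hj, fun x hx => hv x (by rw [h2]; simp [hx])⟩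
    rintro rfl
    exact hne (by rw [h1, List.append_nil])
  · by_contra hne
    refine ha ⟨u', t, j', h1, hu', ?_, hj', fun x hx => hv' x (by rw [h2]; simp [hx])⟩
    rintro rfl
    exact hne (by rw [h1, List.append_nil])

lemma IsPreferenceFunction.append {k l : ℕ} {u v : List ℕ} (hu : IsPreferenceFunction k u)
    (hv : IsPreferenceFunction l v) :
    IsPreferenceFunction (k + l) (u ++ v.map (· + u.toFinset.card)) := by
  have hlen : (u ++ v.map (· + u.toFinset.card)).length = k + l := by
    rw [List.length_append, List.length_map, hu.1, hv.1]
  rw [← hlen]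
  have hmem : ∀ x, x ∈ u ++ v.map (· + u.toFinset.card) ↔
      1 ≤ x ∧ x ≤ u.toFinset.card + v.toFinset.card := by
    intro x
    rw [List.mem_append, hu.mem_iff, List.mem_map]
    constructor
    · rintro (h | ⟨y, hy, rfl⟩)
      · omega
      · have := hv.mem_iff.1 hy
        omega
    · intro h
      by_cases h1 : x ≤ u.toFinset.card
      · exact Or.inl ⟨h.1, h1⟩
      · exact Or.inr ⟨x - u.toFinset.card, hv.mem_iff.2 ⟨by omega, by omega⟩, by omega⟩
  refine isPreferenceFunction_of_closed (fun x hx => ((hmem x).1 hx).1) fun x hx y h1 h2 => ?_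
  have := (hmem x).1 hx
  exact (hmem y).2 ⟨h1, by omega⟩

/-- A nonempty preference function splits after its shortest nonempty prefix whose letters are
smaller than all later ones; this prefix is atomic. -/
lemma IsPreferenceFunction.exists_append (hp : IsPreferenceFunction n p) (hn : 1 ≤ n) :
    ∃ k ∈ Finset.Icc 1 n, ∃ u ∈ atomicPreferenceFunctions k, ∃ v, IsPreferenceFunction (n - k) v ∧
      u ++ v.map (· + u.toFinset.card) = p := by
  classical
  have hlen : p.length = n := hp.1
  have hex : ∃ m, 1 ≤ m ∧ ∀ x ∈ p.take m, ∀ y ∈ p.drop m, x < y :=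
    ⟨n, hn, fun x _ y hy => by
      rw [← hlen, List.drop_length] at hy
      exact absurd hy (by simp)⟩
  have hmin := fun {m} => Nat.find_min hex (m := m)
  have hmn : Nat.find hex ≤ n := Nat.find_min' hex ⟨hn, fun x _ y hy => by
      rw [← hlen, List.drop_length] at hy
      exact absurd hy (by simp)⟩
  obtain ⟨hm1, hm⟩ := Nat.find_spec hex
  generalize Nat.find hex = m at hmin hmn hm1 hm
  have hsplit := List.take_append_drop m p
  have hul : (p.take m).length = m := by rw [List.length_take]; omega
  have hsub : ∀ {x}, x ∈ p ↔ x ∈ p.take m ∨ x ∈ p.drop m := by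
    intro x
    rw [← List.mem_append, hsplit]
  have hu : IsPreferenceFunction m (p.take m) := by
    conv => arg 1; rw [← hul]
    refine isPreferenceFunction_of_closed (fun x hx => (hp.mem_iff.1 (hsub.2 (Or.inl hx))).1)
      fun x hx y h1 h2 => ?_
    have hy : y ∈ p := hp.mem_iff.2 ⟨h1, h2.trans (hp.mem_iff.1 (hsub.2 (Or.inl hx))).2⟩
    rcases hsub.1 hy with h | h
    · exact h
    · exact absurd (hm x hx y h) (by omega)
  have hcard : (p.take m).toFinset.card ∈ p.take m := by
    obtain ⟨x, hx⟩ := List.exists_mem_of_ne_nil (p.take m)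
      (List.ne_nil_of_length_pos (by omega))
    have := hu.mem_iff.1 hx
    exact hu.mem_iff.2 ⟨by omega, le_rfl⟩
  have hv : ∀ y ∈ p.drop m, (p.take m).toFinset.card < y := fun y hy => hm _ hcard y hy
  refine ⟨m, Finset.mem_Icc.2 ⟨hm1, hmn⟩, p.take m, ⟨hu, ?_⟩,
    (p.drop m).map (· - (p.take m).toFinset.card), ?_, ?_⟩
  · rintro ⟨a, b, j, hab, ha, hb, haj, hbj⟩
    have ha' := List.length_pos_iff.2 ha
    have hb' := List.length_pos_iff.2 hb
    have hlen' : a.length + b.length = m := by rw [← List.length_append, ← hab, hul]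
    refine hmin (m := a.length) (by omega) ⟨ha', ?_⟩
    rw [← hsplit, hab, List.append_assoc, List.take_left, List.drop_left]
    intro x hx y hy
    rcases List.mem_append.1 hy with h | h
    · exact (haj x hx).trans_lt (hbj y h)
    · exact hm x (by rw [hab]; simp [hx]) y h
  · have hvl : ((p.drop m).map (· - (p.take m).toFinset.card)).length = n - m := by
      rw [List.length_map, List.length_drop, hlen]
    rw [← hvl]
    refine isPreferenceFunction_of_closed ?_ ?_
    · intro x hx
      obtain ⟨z, hz, rfl⟩ := List.mem_map.1 hx
      have := hv z hz
      omega
    · intro x hx y h1 h2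
      obtain ⟨z, hz, rfl⟩ := List.mem_map.1 hx
      have hzc := hv z hz
      have hzp := hp.mem_iff.1 (hsub.2 (Or.inr hz))
      have hy : y + (p.take m).toFinset.card ∈ p := hp.mem_iff.2 ⟨by omega, by omega⟩
      rcases hsub.1 hy with h | h
      · have := (hu.mem_iff.1 h).2
        omega
      · exact List.mem_map.2 ⟨_, h, by omega⟩
  · rw [List.map_map]
    conv_rhs => rw [← hsplit]
    congr 1
    refine (List.map_congr_left fun y hy => ?_).trans (List.map_id _)
    have := hv y hy
    simp only [Function.comp_apply, id]
    omega

lemma finite_atomicPreferenceFunctions (n : ℕ) : (atomicPreferenceFunctions n).Finite :=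
  (finite_isPreferenceFunction n).subset fun _ hp => hp.1

lemma ncard_atomicPreferenceFunctions_mul (hn : 1 ≤ n) : orderedBell n =
    ∑ k ∈ Finset.Icc 1 n, (atomicPreferenceFunctions k).ncard * orderedBell (n - k) := by
  simp only [← ncard_isPreferenceFunction]
  rw [Set.ncard_eq_toFinset_card _ (finite_isPreferenceFunction n)]
  simp only [Set.ncard_eq_toFinset_card _ (finite_isPreferenceFunction _),
    Set.ncard_eq_toFinset_card _ (finite_atomicPreferenceFunctions _), ← Finset.card_product]
  rw [← Finset.card_sigma]
  symm
  refine Finset.card_bij (fun s _ => s.2.1 ++ s.2.2.map (· + s.2.1.toFinset.card)) ?_ ?_ ?_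
  · rintro ⟨k, u, v⟩ hs
    simp only [Finset.mem_sigma, Finset.mem_Icc, Finset.mem_product, Set.Finite.mem_toFinset,
      Set.mem_ofPred_eq] at hs ⊢
    have := hs.2.1.1.append hs.2.2
    rwa [Nat.add_sub_cancel' hs.1.2] at this
  · rintro ⟨k, u, v⟩ hs ⟨k', u', v'⟩ hs' h
    simp only [Finset.mem_sigma, Finset.mem_Icc, Finset.mem_product, Set.Finite.mem_toFinset,
      Set.mem_ofPred_eq] at hs hs' h
    have hlt : ∀ (l : ℕ) (v : List ℕ), IsPreferenceFunction l v → ∀ c, ∀ x ∈ v.map (· + c),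
        c < x := by
      intro l v hv c x hx
      obtain ⟨y, hy, rfl⟩ := List.mem_map.1 hx
      have := (hv.mem_iff.1 hy).1
      omega
    have huu := eq_of_append_eq (List.ne_nil_of_length_pos (by have := hs.2.1.1.1; omega))
      (List.ne_nil_of_length_pos (by have := hs'.2.1.1.1; omega)) hs.2.1.2 hs'.2.1.2
      (fun x hx => (hs.2.1.1.mem_iff.1 hx).2) (hlt _ _ hs.2.2 _)
      (fun x hx => (hs'.2.1.1.mem_iff.1 hx).2) (hlt _ _ hs'.2.2 _) h
    subst huu
    obtain rfl : k = k' := hs.2.1.1.1.symm.trans hs'.2.1.1.1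
    have hvv := List.map_injective_iff.2 (add_left_injective _) (List.append_cancel_left h)
    rw [hvv]
  · intro p hp
    rw [Set.Finite.mem_toFinset] at hp
    obtain ⟨k, hk, u, hu, v, hv, huv⟩ := IsPreferenceFunction.exists_append hp hn
    refine ⟨⟨k, u, v⟩, ?_, huv⟩
    simp only [Finset.mem_sigma, Finset.mem_product, Set.Finite.mem_toFinset]
    exact ⟨hk, hu, hv⟩

lemma ncard_atomicPreferenceFunctions (hn : 1 ≤ n) :
    ((atomicPreferenceFunctions n).ncard : ℤ) = A095989 n := by
  induction n using Nat.strong_induction_on with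
  | _ n ih =>
    have h1 := ncard_atomicPreferenceFunctions_mul hn
    have hOB : orderedBell 0 = 1 := by rw [orderedBell, if_pos rfl]
    rw [← Finset.Ico_insert_right hn, Finset.sum_insert (by simp), Nat.sub_self, hOB,
      mul_one] at h1
    rw [A095989, if_neg (by omega),
      Fin.sum_univ_eq_sum_range (fun k => A095989 k * (orderedBell (n - k) : ℤ)) n, h1,
      Finset.range_eq_Ico, Finset.sum_eq_sum_Ico_succ_bot (show 0 < n by omega),
      show A095989 0 = 0 by rw [A095989, if_pos rfl], zero_mul, zero_add, Nat.cast_add,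
      Nat.cast_sum]
    refine eq_sub_of_add_eq (congrArg _ (Finset.sum_congr rfl fun k hk => ?_))
    rw [Finset.mem_Ico] at hk
    rw [Nat.cast_mul, ih k hk.2 hk.1]

end PreferenceFunctions

/-! ### The bijections -/

section Bijections

variable {n : ℕ}

lemma finite_box (n : ℕ) : Finite (Box n) :=
  Finite.of_injective (fun x : Box n => ((⟨x.1.1, by have := x.2; omega⟩,
    ⟨x.1.2, by have := x.2; omega⟩) : Fin (n + 1) × Fin (n + 1))) fun x y h => by
      simp only [Prod.mk.injEq, Fin.mk.injEq] at h
      exact Subtype.ext (Prod.ext h.1 h.2)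

lemma mapsTo_Phi (n : ℕ) :
    Set.MapsTo (Phi n) (leDiagrams n) (atomicPreferenceFunctions n) := by
  intro D _
  have h := (signedPerm_isPrefPerm D).corresponds_alpha
  exact ⟨h.isPreferenceFunction, h.isAtomic_iff.2 (signedPerm_isAtomicPerm D)⟩

lemma leftInvOn_Psi_Phi (n : ℕ) : Set.LeftInvOn (Psi n) (Phi n) (leDiagrams n) := fun D hD =>
  psi_eq D ((mem_leDiagrams_iff D).1 hD) fun _ hj =>
    (signedPerm_isPrefPerm D).corresponds_alpha.alphaInv_eq hj

/-- Atomic preference functions inject into Le-diagrams: the output word of `α⁻¹(p)` is the output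
word of some Le-diagram. -/
lemma ncard_atomicPreferenceFunctions_le (n : ℕ) :
    (atomicPreferenceFunctions n).ncard ≤ (leDiagrams n).ncard := by
  have hex : ∀ p ∈ atomicPreferenceFunctions n, ∃ D ∈ leDiagrams n,
      ∀ j ∈ Set.Icc 1 n, eastVal D.plus j (n + 1) = outputWord n (alphaInv n p) j := by
    intro p hp
    have h := hp.1.corresponds_alphaInv
    exact exists_leDiagram h.perm (h.isAtomic_iff.1 hp.2)
  choose! F hF hout using hex
  have := finite_box n
  refine Set.ncard_le_ncard_of_injOn F hF (fun p hp p' hp' h => ?_) (Set.toFinite _)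
  have hc := hp.1.corresponds_alphaInv
  have hc' := hp'.1.corresponds_alphaInv
  have heq := eq_of_outputWord_eq hc.perm (hc.isAtomic_iff.1 hp.2) hc'.perm
    (hc'.isAtomic_iff.1 hp'.2) fun j hj => by rw [← hout p hp j hj, ← hout p' hp' j hj, h]
  exact hc.word_eq (hc'.congr fun j hj => (heq j hj).symm)

end Bijections

theorem mainTheorem3 (n : ℕ) (hn : 1 ≤ n) :
    Set.BijOn (Phi n) (leDiagrams n) (atomicPreferenceFunctions n) ∧
    Set.BijOn (Psi n) (atomicPreferenceFunctions n) (leDiagrams n) ∧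
    Set.InvOn (Psi n) (Phi n) (leDiagrams n) (atomicPreferenceFunctions n) ∧
    ((leDiagrams n).ncard : ℤ) = A095989 n := by
  have hmaps := mapsTo_Phi n
  have hleft := leftInvOn_Psi_Phi n
  have hle := ncard_atomicPreferenceFunctions_le n
  have himg : Phi n '' leDiagrams n = atomicPreferenceFunctions n :=
    Set.eq_of_subset_of_ncard_le hmaps.image_subset
      (by rwa [hleft.injOn.ncard_image]) (finite_atomicPreferenceFunctions n)
  have hbij : Set.BijOn (Phi n) (leDiagrams n) (atomicPreferenceFunctions n) :=
    ⟨hmaps, hleft.injOn, himg.ge⟩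
  have hinv : Set.InvOn (Psi n) (Phi n) (leDiagrams n) (atomicPreferenceFunctions n) := by
    refine ⟨hleft, fun p hp => ?_⟩
    obtain ⟨D, hD, rfl⟩ := himg.ge hp
    rw [hleft hD]
  refine ⟨hbij, hinv.symm.bijOn (fun p hp => ?_) hmaps, hinv, ?_⟩
  · obtain ⟨D, hD, rfl⟩ := himg.ge hp
    rwa [hleft hD]
  · rw [← ncard_atomicPreferenceFunctions hn, ← himg, hleft.injOn.ncard_image]
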